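/- An instance of the parameterized problem MaxLin2-AA is a pair $(S,k)$, where $k\ge 0$ is an integer (the parameter) and $S$ is a finite system of linear equations $\sum_{i\in I} z_i=b$ over $\mathbb{F}_2$ in variables $z_1,\dots,z_n$; each equation contains at least one variable (the number of variables in an equation is otherwise not bounded) and has a positive integral weight. Let $W$ be the total weight of all equations of $S$ and let $\mathrm{sat}(S)$ be the maximum total weight of equations of $S$ that can be satisfied simultaneously by an assignment in $\mathbb{F}_2^n$. The answer to $(S,k)$ is Yes if and only if $\mathrm{sat}(S)\ge W/2+k$. A kernelization of a parameterized problem is a polynomial-time algorithm that maps each instance $(I,k)$ to an instance $(I',k')$ (the kernel) of the same problem such that $(I,k)$ is a Yes-instance if and only if $(I',k')$ is, $k'\le f(k)$ and $|I'|\le g(k)$ for some functions $f$ and $g$, where $|I'|$ is the size of $I'$ (weights and parameters are written in binary). **Theorem.** MaxLin2-AA has a kernel with at most $O(k^2\log k)$ variables: there are a kernelization of MaxLin2-AA and a function $h$ with $h(k)=O(k^2\log k)$ as $k\to\infty$ such that every instance $(S,k)$ is mapped to an instance $(S',k')$ whose system $S'$ has at most $h(k)$ variables. -/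

import Mathlib

/-! ### Data, programs and running time

A model of computation with an explicit cost: structured while-programs that work on binary
trees (LISP-like data). -/

/-- Binary trees: the values that programs read and write. -/
inductive Data : Type
  | nil : Data
  | cons : Data → Data → Data

namespace Data

/-- The number of nodes of a tree. -/
def size : Data → ℕ
  | nil => 1
  | cons x y => size x + size y + 1

/-- Left component, with `hd nil = nil`. -/
def hd : Data → Data
  | nil => nil
  | cons x _ => x

/-- Right component, with `tl nil = nil`. -/
def tl : Data → Data
  | nil => nil
  | cons _ y => y

/-- A list as a right comb. -/
def ofList : List Data → Data
  | [] => nil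
  | x :: l => cons x (ofList l)

/-- A bit. -/
def ofBool : Bool → Data
  | false => nil
  | true => cons nil nil

/-- A natural number in binary, least significant bit first. -/
def ofNat (a : ℕ) : Data := ofList (a.bits.map ofBool)

/-- A natural number in unary. -/
def unary (a : ℕ) : Data := ofList (List.replicate a nil)

end Data

/-- Programs; each one transforms a tree into a tree (see `Prog.Runs`). -/
inductive Prog : Type
  | skip : Prog
  | nil : Prog
  | hd : Prog
  | tl : Prog
  | pair : Prog → Prog → Prog
  | seq : Prog → Prog → Prog
  | ite : Prog → Prog → Prog → Prog
  | loop : Prog → Prog → Prog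

/-- `p.Runs x y t`: on input `x` the program `p` halts with output `y` at cost `t`.

Every executed instruction costs one plus the size of the tree it is applied to, so that copying
and traversing data is paid for (there is no sharing), and sizes of outputs never exceed costs.
Hence a run of cost `t` can be carried out by a Turing machine in time polynomial in `t`, and
a Turing machine running in time `t` is simulated at cost polynomial in `t`: "polynomial time"
has its usual meaning. A condition is true if it evaluates to a tree other than `nil`. -/
inductive Prog.Runs : Prog → Data → Data → ℕ → Prop
  | skip (x : Data) : Runs .skip x x (x.size + 1)
  | nil (x : Data) : Runs .nil x .nil (x.size + 1)
  | hd (x : Data) : Runs .hd x x.hd (x.size + 1)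
  | tl (x : Data) : Runs .tl x x.tl (x.size + 1)
  | pair {p q : Prog} {x y z : Data} {s t : ℕ} :
      Runs p x y s → Runs q x z t → Runs (.pair p q) x (.cons y z) (s + t + (x.size + 1))
  | seq {p q : Prog} {x y z : Data} {s t : ℕ} :
      Runs p x y s → Runs q y z t → Runs (.seq p q) x z (s + t + (x.size + 1))
  | ite_true {c p q : Prog} {x b y : Data} {s t : ℕ} :
      Runs c x b s → b ≠ .nil → Runs p x y t → Runs (.ite c p q) x y (s + t + (x.size + 1))
  | ite_false {c p q : Prog} {x y : Data} {s t : ℕ} :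
      Runs c x .nil s → Runs q x y t → Runs (.ite c p q) x y (s + t + (x.size + 1))
  | loop_done {c p : Prog} {x : Data} {s : ℕ} :
      Runs c x .nil s → Runs (.loop c p) x x (s + (x.size + 1))
  | loop_step {c p : Prog} {x b y z : Data} {s t u : ℕ} :
      Runs c x b s → b ≠ .nil → Runs p x y t → Runs (.loop c p) y z u →
        Runs (.loop c p) x z (s + t + u + (x.size + 1))

/-- `f` is computed, with respect to the encodings `ea` and `eb`, by a program whose cost is
bounded by a polynomial in the size of the encoded input. -/
def PolyTimeComputable {α β : Type} (ea : α → Data) (eb : β → Data) (f : α → β) : Prop :=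
  ∃ (p : Prog) (P : Polynomial ℕ), ∀ a : α, ∃ t : ℕ,
    p.Runs (ea a) (eb (f a)) t ∧ t ≤ P.eval (ea a).size

/-! ### Parameterized problems and kernelizations -/

/-- A pair (instance, parameter), the parameter being written in binary. -/
def encodePair {α : Type} (enc : α → Data) (q : α × ℕ) : Data :=
  .cons (enc q.1) (.ofNat q.2)

/-- `K` is a kernelization of the parameterized problem `L`, a set of pairs
(instance, parameter), for instances encoded by `enc`: a polynomial-time map
`(I, k) ↦ (I', k')` that preserves membership, with `k'` and the size of `I'` bounded by
functions of `k` alone. -/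
structure IsKernelization {α : Type} (enc : α → Data) (L : Set (α × ℕ))
    (K : α × ℕ → α × ℕ) : Prop where
  polyTime : PolyTimeComputable (encodePair enc) (encodePair enc) K
  mem_iff : ∀ q : α × ℕ, q ∈ L ↔ K q ∈ L
  param_le : ∃ f : ℕ → ℕ, ∀ q : α × ℕ, (K q).2 ≤ f q.2
  size_le : ∃ g : ℕ → ℕ, ∀ q : α × ℕ, (enc (K q).1).size ≤ g q.2

/-! ### The problem MaxLin2-AA -/

/-- A weighted linear equation `∑ i ∈ vars, z i = rhs` over the field with two elements in the
variables `z i`, `i : Fin n`. It contains at least one variable and has positive weight; the number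
of variables in it is otherwise unrestricted. -/
structure LinEq (n : ℕ) where
  vars : Finset (Fin n)
  rhs : ZMod 2
  weight : ℕ
  vars_nonempty : vars.Nonempty
  weight_pos : 0 < weight

/-- A finite system of weighted equations in `n` variables (repetitions are allowed). -/
structure LinSystem where
  n : ℕ
  eqs : List (LinEq n)

/-- The assignment `z` satisfies the equation. -/
def LinEq.Holds {n : ℕ} (e : LinEq n) (z : Fin n → ZMod 2) : Prop :=
  ∑ i ∈ e.vars, z i = e.rhs

instance {n : ℕ} (e : LinEq n) (z : Fin n → ZMod 2) : Decidable (e.Holds z) :=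
  inferInstanceAs (Decidable (∑ i ∈ e.vars, z i = e.rhs))

/-- The row of coefficients, the right-hand side, and the weight in binary. -/
def LinEq.encode {n : ℕ} (e : LinEq n) : Data :=
  .cons (.ofList (List.ofFn fun i : Fin n => .ofBool (decide (i ∈ e.vars))))
    (.cons (.ofBool (decide (e.rhs = 1))) (.ofNat e.weight))

namespace LinSystem

/-- The number of variables in unary, followed by the list of equations. -/
def encode (S : LinSystem) : Data :=
  .cons (.unary S.n) (.ofList (S.eqs.map LinEq.encode))

/-- The total weight `W` of all equations. -/
def totalWeight (S : LinSystem) : ℕ := (S.eqs.map LinEq.weight).sum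

/-- The total weight of the equations satisfied by `z`. -/
def satWeight (S : LinSystem) (z : Fin S.n → ZMod 2) : ℕ :=
  ((S.eqs.filter fun e => e.Holds z).map LinEq.weight).sum

/-- The maximum total weight of equations that can be satisfied simultaneously. -/
def sat (S : LinSystem) : ℕ := Finset.univ.sup S.satWeight

end LinSystem

/-- MaxLin2-AA: the pairs `(S, k)` with `sat S ≥ W / 2 + k`. -/
def MaxLin2AA : Set (LinSystem × ℕ) :=
  {q | (q.1.totalWeight : ℚ) / 2 + q.2 ≤ q.1.sat}

/-! Call the weight of the satisfied equations minus that of the falsified ones the excess of an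
assignment. It equals twice the satisfied weight minus `W`, so the question is whether some excess
reaches `K = 2k`. The excess is a signed weighted sum of characters, one for each equation. Its
average over all assignments is the contribution `constVal` of the equations without variables,
which is zero for a given instance.

Equations with equal left-hand sides are merged, and a Gaussian elimination changes the variables so
that every remaining variable `y` occurs in an equation `y = 1` of its own. The set of attained
excesses stays the same (`val_merge`, `range_excess_normalForm`). Let `n` and `m` be the resulting
numbers of variables and equations.

If `m ≥ n ^ K`, the instance can be decided in polynomial time. Every assignment but the origin sets
some variable to one. This turns the equation `y = 1` of that variable into a satisfied constant
and, left-hand sides being distinct, no other equation becomes constant, so the average grows by at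
least one (`constVal_substHead`). Branching over the variables, and stopping as soon as the origin
or the average has excess `K`, gives a tree of depth at most `K` with at most `n ^ j` nodes at level
`j`. A search that gives up once a level has more than `m` nodes either decides the instance or
proves `m < n ^ K` (`search_spec`).

If `m < n ^ K` and `n` is at least about `k² log k`, the answer is Yes. Then `(m + 1) ^ (K - 1) < 2
^ n`, so some vector `x` is not a sum of at most `K - 1` left-hand sides. A shortest representation
of `x` yields `K` independent left-hand sides such that no sum of two or more of them is a left-hand
side (`exists_sumFree`). Averaged over the assignments that satisfy these `K` equations, all other
equations contribute zero, so some excess is at least `K` (`exists_excess_ge`).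

Otherwise `n` is small. A single equation of weight at least `K` again forces Yes, and without one
the normal form is the kernel: it has at most `2 ^ n` equations, of bounded weight. The algorithm is
written for lists, whose encoding agrees with that of systems (`enc_toNode`). It is assembled from
folds, which run in polynomial time as long as their states stay polynomially large (`PT.foldl`). -/

/-! ### Polynomial-time functions between encoded types -/

/-- A type whose elements are encoded as trees. -/
class Enc (α : Type) where
  enc : α → Data

open Enc

instance : Enc Unit := ⟨fun _ => .nil⟩
instance : Enc Bool := ⟨Data.ofBool⟩
instance : Enc ℕ := ⟨Data.ofNat⟩
instance {α β : Type} [Enc α] [Enc β] : Enc (α × β) := ⟨fun q => .cons (enc q.1) (enc q.2)⟩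
instance {α : Type} [Enc α] : Enc (List α) := ⟨fun l => .ofList (l.map enc)⟩

/-- The size of the encoding. -/
def sz {α : Type} [Enc α] (a : α) : ℕ := (enc a).size

/-- Functions computed in polynomial time with respect to the standard encodings. -/
def PT {α β : Type} [Enc α] [Enc β] (f : α → β) : Prop := PolyTimeComputable enc enc f

/-- Quantities bounded by a polynomial in the size of the encoding. -/
def PolyBdd {α : Type} [Enc α] (T : α → ℕ) : Prop :=
  ∃ P : Polynomial ℕ, ∀ a, T a ≤ P.eval (sz a)

/-- `p` runs from `x` to `y` at cost at most `n`. -/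
def Prog.RunsLe (p : Prog) (x y : Data) (n : ℕ) : Prop := ∃ t ≤ n, p.Runs x y t

theorem Data.size_pos (x : Data) : 0 < x.size := by
  cases x <;> simp [Data.size]

theorem Data.size_hd_le (x : Data) : x.hd.size ≤ x.size := by
  cases x <;> simp [Data.size, Data.hd] <;> omega

theorem Data.size_tl_le (x : Data) : x.tl.size ≤ x.size := by
  cases x <;> simp [Data.size, Data.tl] <;> omega

theorem Prog.Runs.size_le {p : Prog} {x y : Data} {t : ℕ} (h : p.Runs x y t) : y.size ≤ t := by
  induction h with
  | skip x => omega
  | nil x => have := x.size_pos; simp [Data.size]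
  | hd x => have := x.size_hd_le; omega
  | tl x => have := x.size_tl_le; omega
  | @pair _ _ x _ _ _ _ _ _ h1 h2 => have := x.size_pos; simp only [Data.size]; omega
  | _ => omega

/-! ### Upper bounds for the cost of the program constructors -/

namespace Prog.RunsLe

theorem mono {p : Prog} {x y : Data} {m n : ℕ} (h : p.RunsLe x y m) (hmn : m ≤ n) :
    p.RunsLe x y n := by
  obtain ⟨t, ht, h⟩ := h
  exact ⟨t, ht.trans hmn, h⟩

theorem size_le {p : Prog} {x y : Data} {n : ℕ} (h : p.RunsLe x y n) : y.size ≤ n := by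
  obtain ⟨t, ht, h⟩ := h
  exact h.size_le.trans ht

theorem skip (x : Data) : Prog.skip.RunsLe x x (x.size + 1) := ⟨_, le_rfl, .skip x⟩
theorem nil (x : Data) : Prog.nil.RunsLe x .nil (x.size + 1) := ⟨_, le_rfl, .nil x⟩
theorem hd (x : Data) : Prog.hd.RunsLe x x.hd (x.size + 1) := ⟨_, le_rfl, .hd x⟩
theorem tl (x : Data) : Prog.tl.RunsLe x x.tl (x.size + 1) := ⟨_, le_rfl, .tl x⟩

theorem pair {p q : Prog} {x y z : Data} {s t : ℕ} (hp : p.RunsLe x y s) (hq : q.RunsLe x z t) :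
    (p.pair q).RunsLe x (.cons y z) (s + t + (x.size + 1)) := by
  obtain ⟨s', hs, hp⟩ := hp
  obtain ⟨t', ht, hq⟩ := hq
  exact ⟨_, by omega, hp.pair hq⟩

theorem seq {p q : Prog} {x y z : Data} {s t : ℕ} (hp : p.RunsLe x y s) (hq : q.RunsLe y z t) :
    (p.seq q).RunsLe x z (s + t + (x.size + 1)) := by
  obtain ⟨s', hs, hp⟩ := hp
  obtain ⟨t', ht, hq⟩ := hq
  exact ⟨_, by omega, hp.seq hq⟩

theorem ite_true {c p q : Prog} {x b y : Data} {s t : ℕ} (hc : c.RunsLe x b s) (hb : b ≠ .nil)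
    (hp : p.RunsLe x y t) : (Prog.ite c p q).RunsLe x y (s + t + (x.size + 1)) := by
  obtain ⟨s', hs, hc⟩ := hc
  obtain ⟨t', ht, hp⟩ := hp
  exact ⟨_, by omega, hc.ite_true hb hp⟩

theorem ite_false {c p q : Prog} {x y : Data} {s t : ℕ} (hc : c.RunsLe x .nil s)
    (hq : q.RunsLe x y t) : (Prog.ite c p q).RunsLe x y (s + t + (x.size + 1)) := by
  obtain ⟨s', hs, hc⟩ := hc
  obtain ⟨t', ht, hq⟩ := hq
  exact ⟨_, by omega, hc.ite_false hq⟩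

theorem loop_done {c p : Prog} {x : Data} {s : ℕ} (hc : c.RunsLe x .nil s) :
    (Prog.loop c p).RunsLe x x (s + (x.size + 1)) := by
  obtain ⟨s', hs, hc⟩ := hc
  exact ⟨_, by omega, hc.loop_done⟩

theorem loop_step {c p : Prog} {x b y z : Data} {s t u : ℕ} (hc : c.RunsLe x b s)
    (hb : b ≠ .nil) (hp : p.RunsLe x y t) (hl : (Prog.loop c p).RunsLe y z u) :
    (Prog.loop c p).RunsLe x z (s + t + u + (x.size + 1)) := by
  obtain ⟨s', hs, hc⟩ := hc
  obtain ⟨t', ht, hp⟩ := hp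
  obtain ⟨u', hu, hl⟩ := hl
  exact ⟨_, by omega, hc.loop_step hb hp hl⟩

end Prog.RunsLe

/-! ### Sizes of encodings and polynomially bounded quantities -/

section Bounds

variable {α β γ σ : Type} [Enc α] [Enc β] [Enc γ] [Enc σ]

/-- Coefficients are natural numbers, hence nonnegative. Monotonicity lets a size be replaced by an
upper bound inside a polynomial, which is how cost bounds compose. -/
theorem Polynomial.eval_nat_mono (P : Polynomial ℕ) : Monotone fun n => P.eval n := by
  intro m n h
  simp only [Polynomial.eval_eq_sum, Polynomial.sum]
  gcongr

theorem sz_pos (a : α) : 0 < sz a := Data.size_pos _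

theorem sz_pair (q : α × β) : sz q = sz q.1 + sz q.2 + 1 := rfl

theorem sz_nil : sz ([] : List α) = 1 := rfl

theorem sz_cons (a : α) (l : List α) : sz (a :: l) = sz a + sz l + 1 := rfl

theorem sz_append (l₁ l₂ : List α) : sz (l₁ ++ l₂) + 1 = sz l₁ + sz l₂ := by
  induction l₁ with
  | nil => simp [sz_nil]; omega
  | cons a l ih => simp only [List.cons_append, sz_cons]; omega

theorem length_lt_sz (l : List α) : l.length < sz l := by
  induction l with
  | nil => simp [sz_nil]
  | cons a l ih => simp only [List.length_cons, sz_cons]; omega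

theorem sz_le_of_mem {a : α} {l : List α} (h : a ∈ l) : sz a ≤ sz l := by
  induction l with
  | nil => simp at h
  | cons b l ih =>
    rw [sz_cons]
    rcases List.mem_cons.1 h with rfl | h
    · omega
    · have := ih h; omega

/-- A list is encoded by few nodes if it is short and its members are. -/
theorem sz_list_le {l : List α} {m n : ℕ} (hl : l.length ≤ m) (h : ∀ a ∈ l, sz a ≤ n) :
    sz l ≤ m * (n + 1) + 1 := by
  have : sz l ≤ l.length * (n + 1) + 1 := by
    clear hl
    induction l with
    | nil => simp [sz_nil]
    | cons a l ih =>
      have h1 := ih fun b hb => h b (by simp [hb])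
      have h2 := h a (by simp)
      rw [sz_cons, List.length_cons, add_mul]
      omega
  exact this.trans (by gcongr)

namespace PolyBdd

theorem const (n : ℕ) : PolyBdd fun _ : α => n := ⟨Polynomial.C n, by simp⟩

theorem size : PolyBdd fun a : α => sz a := ⟨Polynomial.X, by simp⟩

theorem add {T U : α → ℕ} (hT : PolyBdd T) (hU : PolyBdd U) : PolyBdd fun a => T a + U a := by
  obtain ⟨P, hP⟩ := hT
  obtain ⟨Q, hQ⟩ := hU
  exact ⟨P + Q, fun a => by simpa using add_le_add (hP a) (hQ a)⟩

theorem mul {T U : α → ℕ} (hT : PolyBdd T) (hU : PolyBdd U) : PolyBdd fun a => T a * U a := by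
  obtain ⟨P, hP⟩ := hT
  obtain ⟨Q, hQ⟩ := hU
  exact ⟨P * Q, fun a => by simpa using mul_le_mul' (hP a) (hQ a)⟩

theorem eval {T : α → ℕ} (P : Polynomial ℕ) (hT : PolyBdd T) :
    PolyBdd fun a => P.eval (T a) := by
  obtain ⟨Q, hQ⟩ := hT
  exact ⟨P.comp Q, fun a => by simpa using P.eval_nat_mono (hQ a)⟩

end PolyBdd

end Bounds

/-! ### Closure properties of polynomial-time functions -/

namespace PT

variable {α β γ σ : Type} [Enc α] [Enc β] [Enc γ] [Enc σ]

theorem intro {f : α → β} (p : Prog) (T : α → ℕ) (hT : PolyBdd T)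
    (h : ∀ a, p.RunsLe (enc a) (enc (f a)) (T a)) : PT f := by
  obtain ⟨P, hP⟩ := hT
  refine ⟨p, P, fun a => ?_⟩
  obtain ⟨t, ht, hr⟩ := h a
  exact ⟨t, hr, ht.trans (hP a)⟩

theorem elim {f : α → β} (h : PT f) : ∃ (p : Prog) (P : Polynomial ℕ),
    ∀ a, p.RunsLe (enc a) (enc (f a)) (P.eval (sz a)) := by
  obtain ⟨p, P, h⟩ := h
  refine ⟨p, P, fun a => ?_⟩
  obtain ⟨t, hr, ht⟩ := h a
  exact ⟨t, ht, hr⟩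

theorem sz_bdd {f : α → β} (h : PT f) : PolyBdd fun a => sz (f a) := by
  obtain ⟨p, P, h⟩ := h.elim
  exact ⟨P, fun a => (h a).size_le⟩

/-- Computing a function that does not change the encoding. -/
theorem of_enc_eq {f : α → β} (h : ∀ a, enc (f a) = enc a) : PT f :=
  intro .skip (fun a => sz a + 1) (PolyBdd.size.add (.const 1)) fun a => by
    rw [h]; exact .skip _

protected theorem id : PT fun a : α => a := of_enc_eq fun _ => rfl

theorem congr {f g : α → β} (h : PT f) (hfg : ∀ a, g a = f a) : PT g := by
  rwa [funext hfg]

/-- Outputs are no larger than costs, so `f a` has polynomial size and the cost of `g` on it is a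
polynomial in a polynomial. -/
theorem comp {g : β → γ} {f : α → β} (hg : PT g) (hf : PT f) : PT fun a => g (f a) := by
  have hs := hf.sz_bdd
  obtain ⟨p, P, hp⟩ := hf.elim
  obtain ⟨q, Q, hq⟩ := hg.elim
  exact intro (p.seq q) (fun a => P.eval (sz a) + Q.eval (sz (f a)) + (sz a + 1))
    (((PolyBdd.size.eval P).add (hs.eval Q)).add (PolyBdd.size.add (.const 1)))
    fun a => (hp a).seq (hq (f a))

theorem pair {f : α → β} {g : α → γ} (hf : PT f) (hg : PT g) : PT fun a => (f a, g a) := by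
  obtain ⟨p, P, hp⟩ := hf.elim
  obtain ⟨q, Q, hq⟩ := hg.elim
  exact intro (p.pair q) (fun a => P.eval (sz a) + Q.eval (sz a) + (sz a + 1))
    (((PolyBdd.size.eval P).add (PolyBdd.size.eval Q)).add (PolyBdd.size.add (.const 1)))
    fun a => (hp a).pair (hq a)

theorem cons {f : α → β} {g : α → List β} (hf : PT f) (hg : PT g) : PT fun a => f a :: g a :=
  (of_enc_eq (f := fun q : β × List β => q.1 :: q.2) fun _ => rfl).comp (hf.pair hg)

theorem fst {f : α → β × γ} (hf : PT f) : PT fun a => (f a).1 :=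
  (intro .hd (fun q : β × γ => sz q + 1) (PolyBdd.size.add (.const 1))
    fun q => .hd (enc q)).comp hf

theorem snd {f : α → β × γ} (hf : PT f) : PT fun a => (f a).2 :=
  (intro .tl (fun q : β × γ => sz q + 1) (PolyBdd.size.add (.const 1))
    fun q => .tl (enc q)).comp hf

theorem tail {f : α → List β} (hf : PT f) : PT fun a => (f a).tail :=
  (intro .tl (fun l : List β => sz l + 1) (PolyBdd.size.add (.const 1))
    fun l => by cases l <;> exact .tl (enc _)).comp hf

theorem exists_const (y : Data) : ∃ (p : Prog) (c : ℕ), ∀ x, p.RunsLe x y (c * (x.size + 1)) := by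
  induction y with
  | nil => exact ⟨.nil, 1, fun x => by simpa using .nil x⟩
  | cons y z hy hz =>
    obtain ⟨p, c, hp⟩ := hy
    obtain ⟨q, d, hq⟩ := hz
    exact ⟨p.pair q, c + d + 1, fun x => ((hp x).pair (hq x)).mono (le_of_eq (by ring))⟩

theorem const (b : β) : PT fun _ : α => b := by
  obtain ⟨p, c, hp⟩ := exists_const (enc b)
  exact intro p (fun a => c * (sz a + 1)) ((PolyBdd.const c).mul (PolyBdd.size.add (.const 1)))
    fun a => hp (enc a)

/-- The first branch has to be correct only where the condition holds, and the condition may be any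
tree that is `nil` exactly when `b` fails. Lists use both freedoms: a list is its own test for being
nonempty, and `hd` returns the first member only if there is one. -/
theorem ite_aux {b : α → Bool} {p : Prog} {P : α → ℕ} (hp : ∀ a, ∃ d, (d = .nil ↔ b a = false) ∧
    p.RunsLe (enc a) d (P a)) (hP : PolyBdd P) {f g : α → β} (hf : ∃ (p : Prog) (P : Polynomial ℕ),
    ∀ a, b a = true → p.RunsLe (enc a) (enc (f a)) (P.eval (sz a))) (hg : PT g) :
    PT fun a => if b a = true then f a else g a := by
  obtain ⟨q, Q, hq⟩ := hf
  obtain ⟨r, R, hr⟩ := hg.elim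
  refine intro (.ite p q r) (fun a => P a + (Q.eval (sz a) + R.eval (sz a)) + (sz a + 1))
    ((hP.add ((PolyBdd.size.eval Q).add (PolyBdd.size.eval R))).add (PolyBdd.size.add (.const 1)))
    fun a => ?_
  obtain ⟨d, hd, hp⟩ := hp a
  by_cases hb : b a = true
  · rw [if_pos hb]
    exact (hp.ite_true (by simp [hd, hb]) (hq a hb)).mono (by simp only [sz]; omega)
  · rw [if_neg hb]
    rw [hd.2 (by simpa using hb)] at hp
    exact (hp.ite_false (hr a)).mono (by simp only [sz]; omega)

protected theorem ite {b : α → Bool} {f g : α → β} (hb : PT b) (hf : PT f) (hg : PT g) :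
    PT fun a => if b a = true then f a else g a := by
  obtain ⟨p, P, hp⟩ := hb.elim
  obtain ⟨q, Q, hq⟩ := hf.elim
  exact ite_aux (fun a => ⟨_, by cases b a <;> simp [enc, Data.ofBool], hp a⟩)
    (PolyBdd.size.eval P) ⟨q, Q, fun a _ => hq a⟩ hg

theorem isEmpty {f : α → List β} (hf : PT f) : PT fun a => (f a).isEmpty := by
  have h : PT fun l : List β => if (!l.isEmpty) = true then false else true :=
    ite_aux (p := .skip) (P := fun l => sz l + 1)
      (fun l => ⟨enc l, by cases l <;> simp [enc, Data.ofList], .skip _⟩)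
      (PolyBdd.size.add (.const 1)) (by obtain ⟨p, P, h⟩ := (const (α := List β) false).elim; exact ⟨p, P, fun a _ => h a⟩) (const true)
  exact (h.congr fun l => by cases l <;> simp).comp hf

end PT

namespace PT

variable {α β γ σ : Type} [Enc α] [Enc β] [Enc γ] [Enc σ]

theorem headD {f : α → List β} {d : β} (hf : PT f) : PT fun a => (f a).headD d := by
  have h : PT fun l : List β => if (!l.isEmpty) = true then l.headD d else d := by
    refine ite_aux (p := .skip) (P := fun l => sz l + 1)
      (fun l => ⟨enc l, by cases l <;> simp [enc, Data.ofList], .skip _⟩)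
      (PolyBdd.size.add (.const 1)) ⟨.hd, .X + 1, fun l hl => ?_⟩ (const d)
    cases l with
    | nil => simp at hl
    | cons b l =>
      have h : Prog.hd.RunsLe (enc (b :: l)) (enc b) (sz (b :: l) + 1) := .hd (enc (b :: l))
      rwa [Polynomial.eval_add, Polynomial.eval_X, Polynomial.eval_one]
  have h' : PT fun l : List β => l.headD d := h.congr fun l => by cases l <;> simp
  exact h'.comp hf

/-- The body of the loop that folds a list; it works on triples (context, state, rest). -/
def foldBody (p : Prog) : Prog :=
  .pair .hd (.pair (.seq (.pair .hd (.pair (.seq .tl .hd) (.seq .tl (.seq .tl .hd)))) p)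
    (.seq .tl (.seq .tl .tl)))

theorem foldBody_runsLe {p : Prog} {a s x l s' : Data} {n : ℕ}
    (h : p.RunsLe (.cons a (.cons s x)) s' n) :
    (foldBody p).RunsLe (.cons a (.cons s (.cons x l))) (.cons a (.cons s' l))
      (n + 30 * (Data.cons a (.cons s (.cons x l))).size) := by
  set y := Data.cons a (.cons s (.cons x l)) with hy
  have h1 : Prog.hd.RunsLe y a (y.size + 1) := .hd y
  have h2 : (Prog.seq .tl .hd).RunsLe y s _ := (Prog.RunsLe.tl y).seq (.hd _)
  have h3 : (Prog.seq .tl (.seq .tl .hd)).RunsLe y x _ :=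
    (Prog.RunsLe.tl y).seq ((Prog.RunsLe.tl _).seq (.hd _))
  have h4 : (Prog.seq .tl (.seq .tl .tl)).RunsLe y l _ :=
    (Prog.RunsLe.tl y).seq ((Prog.RunsLe.tl _).seq (.tl _))
  refine (h1.pair (((h1.pair (h2.pair h3)).seq h).pair h4)).mono ?_
  have := a.size_pos
  have := s.size_pos
  simp only [hy, Data.size, Data.tl]
  omega

/-- The hypotheses concern only the states reached after prefixes of `l`, as no others occur. `C`
bounds the cost of one step and `D` the size of a state; the factor 40 generously covers the copying
done by `foldBody` and by the loop test. -/
theorem foldLoop_runsLe {f : σ → β → σ} {p : Prog} {a : Data} {C D : ℕ} (l : List β) (s : σ)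
    (hp : ∀ l₁ x, l₁ ++ [x] <+: l →
      p.RunsLe (.cons a (.cons (enc (l₁.foldl f s)) (enc x))) (enc (f (l₁.foldl f s) x)) C)
    (hD : ∀ l₁, l₁ <+: l → sz (l₁.foldl f s) ≤ D) :
    (Prog.loop (.seq .tl .tl) (foldBody p)).RunsLe (.cons a (.cons (enc s) (enc l)))
      (.cons a (.cons (enc (l.foldl f s)) .nil))
      ((l.length + 1) * (C + 40 * (a.size + D + sz l + 2))) := by
  induction l generalizing s with
  | nil =>
    have := hD [] (by simp)
    refine (Prog.RunsLe.loop_done ((Prog.RunsLe.tl _).seq (.tl _))).mono ?_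
    have h1 : (enc ([] : List β)).size = 1 := rfl
    simp only [List.foldl_nil, sz] at this
    simp only [Data.size, Data.tl, sz, List.length_nil]
    omega
  | cons x l ih =>
    have h0 := hD [] (by simp)
    have h1 := foldBody_runsLe (l := enc l) (hp [] x (by simp))
    have h2 := ih (f s x) (fun l₁ y h => hp (x :: l₁) y (by simpa using h))
      fun l₁ h => hD (x :: l₁) (by simpa using h)
    refine (Prog.RunsLe.loop_step (x := .cons a (.cons (enc s) (enc (x :: l))))
      (b := enc (x :: l)) ((Prog.RunsLe.tl _).seq (.tl _)) (by simp [enc, Data.ofList])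
      h1 h2).mono ?_
    have h3 : (enc (x :: l)).size = sz x + sz l + 1 := rfl
    have h4 : (Data.cons (enc x) (enc l)).size = sz x + sz l + 1 := rfl
    have h5 : (l.length + 1) * (C + 40 * (a.size + D + sz l + 2)) ≤
      (l.length + 1) * (C + 40 * (a.size + D + sz (x :: l) + 2)) := by
      gcongr
      rw [sz_cons]; omega
    simp only [List.foldl_nil, sz] at h0
    rw [List.length_cons, add_mul (l.length + 1) 1]
    refine le_trans ?_ (Nat.add_le_add_right h5 _)
    simp only [Data.size, Data.tl, sz_cons, h3, List.foldl_nil]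
    simp only [sz]
    omega

/-- Folding a list, provided that the intermediate results are of polynomial size. -/
theorem foldl {l : α → List β} {s : α → σ} {f : α → σ → β → σ} (hl : PT l) (hs : PT s)
    (hf : PT fun q : α × σ × β => f q.1 q.2.1 q.2.2)
    (hb : ∃ Q : Polynomial ℕ, ∀ a l₁, l₁ <+: l a → sz (l₁.foldl (f a) (s a)) ≤ Q.eval (sz a)) :
    PT fun a => (l a).foldl (f a) (s a) := by
  have bl := hl.sz_bdd
  obtain ⟨p, P, hp⟩ := hl.elim
  obtain ⟨q, Q, hq⟩ := hs.elim
  obtain ⟨r, R, hr⟩ := hf.elim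
  obtain ⟨B, hB⟩ := hb
  -- One step is applied to a triple (input, state, member); the 2 accounts for its two pair nodes.
  let C : α → ℕ := fun a => R.eval (sz a + B.eval (sz a) + sz (l a) + 2)
  have hC : PolyBdd C := (((PolyBdd.size.add (PolyBdd.size.eval B)).add bl).add (.const 2)).eval R
  -- The program builds the triple (input, initial state, list), runs the loop until the list is
  -- used up, and reads off the state.
  refine intro (.seq (.pair .skip (.pair q p))
    (.seq (.loop (.seq .tl .tl) (foldBody r)) (.seq .tl .hd)))
    (fun a => P.eval (sz a) + Q.eval (sz a) +
      (sz (l a) + 1) * (C a + 40 * (sz a + B.eval (sz a) + sz (l a) + 2)) +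
      20 * (sz a + B.eval (sz a) + sz (l a) + 10))
    ((((PolyBdd.size.eval P).add (PolyBdd.size.eval Q)).add
      ((bl.add (.const 1)).mul (hC.add ((PolyBdd.const 40).mul
        (((PolyBdd.size.add (PolyBdd.size.eval B)).add bl).add (.const 2)))))).add
      ((PolyBdd.const 20).mul
        (((PolyBdd.size.add (PolyBdd.size.eval B)).add bl).add (.const 10)))) fun a => ?_
  have h1 := foldLoop_runsLe (f := f a) (p := r) (a := enc a) (C := C a) (D := B.eval (sz a))
    (l a) (s a) (fun l₁ x h => ?_) (fun l₁ h => hB a l₁ h)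
  · refine (((Prog.RunsLe.skip _).pair ((hq a).pair (hp a))).seq
      (h1.seq ((Prog.RunsLe.tl _).seq (.hd _)))).mono ?_
    have h2 : (enc (s a)).size ≤ B.eval (sz a) := hB a [] (by simp)
    have h3 : (enc ((l a).foldl (f a) (s a))).size ≤ B.eval (sz a) := hB a _ List.prefix_rfl
    have h4 : ((l a).length + 1) * (C a + 40 * (sz a + B.eval (sz a) + sz (l a) + 2)) ≤
        (sz (l a) + 1) * (C a + 40 * (sz a + B.eval (sz a) + sz (l a) + 2)) := by
      gcongr
      exact (length_lt_sz _).le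
    simp only [Data.size, Data.tl]
    simp only [sz] at h4 ⊢ h2 h3
    omega
  · refine (hr (a, l₁.foldl (f a) (s a), x)).mono (R.eval_nat_mono ?_)
    have h2 := hB a l₁ ((List.prefix_append _ _).trans h)
    have h3 : sz x ≤ sz (l a) := sz_le_of_mem (h.subset (by simp))
    simp only [sz_pair]
    omega

/-- Folding a list, when each step enlarges the state by a polynomial amount only. -/
theorem foldl_of_growth {l : α → List β} {s : α → σ} {f : α → σ → β → σ} (hl : PT l) (hs : PT s)
    (hf : PT fun q : α × σ × β => f q.1 q.2.1 q.2.2) {U : α → ℕ} (hU : PolyBdd U)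
    (hb : ∀ a t, ∀ x ∈ l a, sz (f a t x) ≤ sz t + U a) :
    PT fun a => (l a).foldl (f a) (s a) := by
  refine hl.foldl hs hf ?_
  obtain ⟨Q, hQ⟩ := hs.sz_bdd.add (hl.sz_bdd.mul hU)
  refine ⟨Q, fun a l₁ h => le_trans ?_ (hQ a)⟩
  have key : ∀ (l₂ : List β) (t : σ), (∀ x ∈ l₂, x ∈ l a) →
      sz (l₂.foldl (f a) t) ≤ sz t + l₂.length * U a := by
    intro l₂
    induction l₂ with
    | nil => simp
    | cons x l₂ ih =>
      intro t hl
      have h1 := ih (f a t x) fun y hy => hl y (by simp [hy])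
      have h2 := hb a t x (hl x (by simp))
      rw [List.foldl_cons, List.length_cons, add_mul]
      omega
  have hlen := h.length_le.trans (length_lt_sz _).le
  exact (key l₁ (s a) fun x hx => h.subset hx).trans
    (Nat.add_le_add_left (Nat.mul_le_mul_right _ hlen) _)

/-! ### List and vector operations obtained by folding -/

theorem reverse {f : α → List β} (hf : PT f) : PT fun a => (f a).reverse := by
  have h : PT fun l : List β => l.foldl (fun acc x => x :: acc) [] :=
    PT.id.foldl_of_growth (const []) (cons (snd (snd .id)) (fst (snd .id)))
      (PolyBdd.size.add (.const 1)) fun l t x hx => by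
        have := sz_le_of_mem hx
        rw [sz_cons]; omega
  exact (h.congr fun l => by simp).comp hf

theorem append {f g : α → List β} (hf : PT f) (hg : PT g) : PT fun a => f a ++ g a := by
  have h : PT fun a => (f a).reverse.foldl (fun acc x => x :: acc) (g a) :=
    hf.reverse.foldl_of_growth hg (cons (snd (snd .id)) (fst (snd .id)))
      (hf.sz_bdd.add (.const 1)) fun a t x hx => by
        have := sz_le_of_mem (List.mem_reverse.1 hx)
        rw [sz_cons]; omega
  exact h.congr fun a => by simp

/-- A bound in terms of a member of a list that has polynomial size. -/
theorem bdd_of_mem {l : α → List β} {f : α → β → γ} (hl : PT l)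
    (hf : PT fun q : α × β => f q.1 q.2) :
    ∃ U : α → ℕ, PolyBdd U ∧ ∀ a, ∀ x ∈ l a, sz (f a x) ≤ U a := by
  obtain ⟨P, hP⟩ := hf.sz_bdd
  refine ⟨fun a => P.eval (sz a + sz (l a) + 1), ((PolyBdd.size.add hl.sz_bdd).add (.const 1)).eval P,
    fun a x hx => (hP (a, x)).trans (P.eval_nat_mono ?_)⟩
  have := sz_le_of_mem hx
  simp only [sz_pair]
  omega

theorem flatMap {l : α → List β} {f : α → β → List γ} (hl : PT l)
    (hf : PT fun q : α × β => f q.1 q.2) : PT fun a => (l a).flatMap (f a) := by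
  obtain ⟨U, hU, h⟩ := bdd_of_mem hl hf
  have h : PT fun a => (l a).foldl (fun acc x => acc ++ f a x) [] :=
    hl.foldl_of_growth (const [])
      (append (fst (snd .id)) (hf.comp (pair (fst .id) (snd (snd .id))))) hU fun a t x hx => by
        have := sz_append t (f a x)
        have := h a x hx
        omega
  exact h.congr fun a => by rw [← List.flatMap_eq_foldl]

theorem map {l : α → List β} {f : α → β → γ} (hl : PT l)
    (hf : PT fun q : α × β => f q.1 q.2) : PT fun a => (l a).map (f a) :=
  (hl.flatMap (f := fun a x => [f a x]) (hf.cons (const []))).congr fun a => by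
    rw [← List.map_eq_flatMap]

theorem filter {l : α → List β} {b : α → β → Bool} (hl : PT l)
    (hb : PT fun q : α × β => b q.1 q.2) : PT fun a => (l a).filter (b a) := by
  refine (hl.flatMap (f := fun a x => if b a x = true then [x] else [])
    (hb.ite (cons (snd .id) (const [])) (const []))).congr fun a => ?_
  induction l a with
  | nil => rfl
  | cons x l ih =>
    rw [List.flatMap_cons, List.filter_cons, ih]
    split_ifs <;> simp

theorem not {f : α → Bool} (hf : PT f) : PT fun a => !f a :=
  (hf.ite (const false) (const true)).congr fun a => by cases f a <;> rfl

theorem and {f g : α → Bool} (hf : PT f) (hg : PT g) : PT fun a => f a && g a :=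
  (hf.ite hg (const false)).congr fun a => by cases f a <;> simp

theorem or {f g : α → Bool} (hf : PT f) (hg : PT g) : PT fun a => f a || g a :=
  (hf.ite (const true) hg).congr fun a => by cases f a <;> simp

theorem xor {f g : α → Bool} (hf : PT f) (hg : PT g) : PT fun a => Bool.xor (f a) (g a) :=
  (hf.ite hg.not hg).congr fun a => by cases f a <;> simp

theorem any {l : α → List β} {b : α → β → Bool} (hl : PT l)
    (hb : PT fun q : α × β => b q.1 q.2) : PT fun a => (l a).any (b a) :=
  ((hl.filter hb).isEmpty.not).congr fun a => by
    induction l a with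
    | nil => rfl
    | cons x l ih => simp only [List.any_cons, List.filter_cons, ih]; cases b a x <;> simp

theorem sz_bool_le (b : Bool) : sz b ≤ 3 := by
  cases b <;> simp [sz, enc, Data.ofBool, Data.size]

theorem sz_bits_le (l : List Bool) : sz l ≤ 4 * l.length + 1 :=
  (sz_list_le le_rfl fun b _ => sz_bool_le b).trans (by omega)

theorem sz_tail_le (l : List β) : sz l.tail ≤ sz l := by
  cases l
  · simp
  · simp [sz_cons]; omega

/-- Addition of vectors over the field with two elements. -/
theorem zipXor {f g : α → List Bool} (hf : PT f) (hg : PT g) :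
    PT fun a => List.zipWith Bool.xor (f a) (g a) := by
  -- A fold runs through one list only, so the second vector is part of the state and is consumed
  -- along the way; the result accumulates in reverse.
  have h : PT fun a => ((f a).foldl (fun (st : List Bool × List Bool) x =>
      if st.1.isEmpty = true then st else (st.1.tail, Bool.xor x (st.1.headD false) :: st.2))
      (g a, [])).2 := by
    refine snd (hf.foldl_of_growth (f := fun _ (st : List Bool × List Bool) x =>
      if st.1.isEmpty = true then st else (st.1.tail, Bool.xor x (st.1.headD false) :: st.2))
      (hg.pair (const [])) ?_ (PolyBdd.const 4) ?_)
    · exact (fst (fst (snd .id))).isEmpty.ite (fst (snd .id))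
        (pair (fst (fst (snd .id))).tail
          (cons (xor (snd (snd .id)) (fst (fst (snd .id))).headD) (snd (fst (snd .id)))))
    · intro a t x _
      have h1 := sz_bool_le (Bool.xor x (t.1.headD false))
      have h2 := sz_tail_le t.1
      split_ifs
      · omega
      · simp only [sz_pair, sz_cons]; omega
  refine h.reverse.congr fun a => ?_
  have key : ∀ u v w : List Bool, (u.foldl (fun (st : List Bool × List Bool) x =>
      if st.1.isEmpty = true then st else (st.1.tail, Bool.xor x (st.1.headD false) :: st.2))
      (v, w)).2 = (List.zipWith Bool.xor u v).reverse ++ w := by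
    intro u
    induction u with
    | nil => simp
    | cons x u ih =>
      intro v w
      cases v with
      | nil => rw [List.foldl_cons, if_pos (by simp), ih]; simp
      | cons y v => rw [List.foldl_cons, if_neg (by simp), ih]; simp
  rw [key]
  simp

/-- Equality of vectors. -/
theorem bits_eq {f g : α → List Bool} (hf : PT f) (hg : PT g) : PT fun a => f a == g a := by
  -- The state records whether all digits agreed so far, together with the unread rest of the second
  -- vector, which must be empty at the end.
  have h : PT fun a => (f a).foldl (fun (st : Bool × List Bool) x =>
      (st.1 && !st.2.isEmpty && !Bool.xor x (st.2.headD false), st.2.tail)) (true, g a) := by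
    refine hf.foldl_of_growth (f := fun _ (st : Bool × List Bool) x =>
      (st.1 && !st.2.isEmpty && !Bool.xor x (st.2.headD false), st.2.tail))
      ((const true).pair hg) ?_ (PolyBdd.const 4) ?_
    · have h2 : PT fun q : α × (Bool × List Bool) × Bool => q.2.1.2 := snd (fst (snd .id))
      exact pair (((fst (fst (snd .id))).and h2.isEmpty.not).and
        (xor (snd (snd .id)) h2.headD).not) h2.tail
    · intro a t x _
      have h1 := sz_bool_le (t.1 && !t.2.isEmpty && !Bool.xor x (t.2.headD false))
      have h2 := sz_tail_le t.2
      simp only [sz_pair]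
      omega
  refine ((fst h).and (snd h).isEmpty).congr fun a => ?_
  have key : ∀ (u v : List Bool) (b : Bool),
      ((u.foldl (fun (st : Bool × List Bool) x =>
        (st.1 && !st.2.isEmpty && !Bool.xor x (st.2.headD false), st.2.tail)) (b, v)).1 &&
      (u.foldl (fun (st : Bool × List Bool) x =>
        (st.1 && !st.2.isEmpty && !Bool.xor x (st.2.headD false), st.2.tail)) (b, v)).2.isEmpty) =
      (b && (u == v)) := by
    intro u
    induction u with
    | nil => intro v b; cases v <;> simp
    | cons x u ih =>
      intro v b
      rw [List.foldl_cons, ih]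
      cases v with
      | nil => simp
      | cons y v => cases x <;> cases y <;> cases b <;> simp
  rw [key]
  simp

/-- Comparison of the lengths of two lists. -/
theorem length_lt {f : α → List β} {g : α → List γ} (hf : PT f) (hg : PT g) :
    PT fun a => decide ((f a).length < (g a).length) := by
  -- One member of the second list is removed for each member of the first; something is left
  -- exactly if the second list is longer.
  have h : PT fun a => (f a).foldl (fun (st : List γ) _ => st.tail) (g a) := by
    refine hf.foldl_of_growth (f := fun _ (st : List γ) _ => st.tail) hg
      (fst (snd .id)).tail (PolyBdd.const 0) fun a t x _ => ?_
    simpa using sz_tail_le t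
  refine h.isEmpty.not.congr fun a => ?_
  have key : ∀ (u : List β) (v : List γ), u.foldl (fun st _ => st.tail) v = v.drop u.length := by
    intro u
    induction u with
    | nil => simp
    | cons x u ih => intro v; rw [List.foldl_cons, ih]; simp
  rw [key, Bool.eq_iff_iff]
  simp

end PT

/-! ### Arithmetic on binary numbers -/

/-- The number with the given binary digits, least significant digit first. -/
def ofBits (l : List Bool) : ℕ := l.foldr Nat.bit 0

theorem ofBits_bits (n : ℕ) : ofBits n.bits = n := by
  induction n using Nat.binaryRec' with
  | zero => simp [ofBits]
  | bit b n h ih => rw [Nat.bits_append_bit _ _ h]; simpa [ofBits] using congrArg (Nat.bit b) ih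

theorem ofBits_append_singleton (l : List Bool) (b : Bool) :
    ofBits (l ++ [b]) = ofBits l + 2 ^ l.length * b.toNat := by
  induction l with
  | nil => cases b <;> simp [ofBits, Nat.bit]
  | cons x l ih =>
    simp only [ofBits, List.cons_append, List.foldr_cons, List.length_cons] at ih ⊢
    rw [ih, Nat.bit_val, Nat.bit_val]
    ring

theorem ofBits_lt (l : List Bool) : ofBits l < 2 ^ l.length := by
  induction l with
  | nil => simp [ofBits]
  | cons x l ih =>
    simp only [ofBits, List.foldr_cons, List.length_cons] at ih ⊢
    rw [Nat.bit_val, pow_succ]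
    have : x.toNat ≤ 1 := Bool.toNat_le x
    omega

theorem ofBits_eq_head_add (l : List Bool) :
    ofBits l = 2 * ofBits l.tail + (l.headD false).toNat := by
  cases l <;> simp [ofBits, Nat.bit_val]

/-- Majority of three bits. -/
def majority (a b c : Bool) : Bool := (a && b) || ((a && c) || (b && c))

/-- One step of serial addition or (if `neg`) subtraction; the state consists of the carry, the
remaining digits, and the digits of the result in reverse order. -/
def rippleStep (neg : Bool) (st : Bool × List Bool × List Bool × List Bool) :
    Bool × List Bool × List Bool × List Bool :=
  (majority (Bool.xor (st.2.1.headD false) neg) (st.2.2.1.headD false) st.1, st.2.1.tail,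
    st.2.2.1.tail,
    Bool.xor (Bool.xor (st.2.1.headD false) (st.2.2.1.headD false)) st.1 :: st.2.2.2)

/-- Serial addition or subtraction. -/
def ripple (neg : Bool) (u v : List Bool) : Bool × List Bool × List Bool × List Bool :=
  (u ++ (v ++ [false])).foldl (fun st _ => rippleStep neg st) (false, u, v, [])

/-- The integer represented by a state of serial addition or subtraction. -/
def rippleVal (neg : Bool) (st : Bool × List Bool × List Bool × List Bool) : ℤ :=
  ofBits st.2.2.2.reverse + 2 ^ st.2.2.2.length *
    (ofBits st.2.1 + (if neg then -1 else 1) * (ofBits st.2.2.1 + st.1.toNat))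

/-- Addition rests on `a + b + c = (a ⊕ b ⊕ c) + 2 * maj(a, b, c)` and subtraction on `a - b - c =
(a ⊕ b ⊕ c) - 2 * maj(¬a, b, c)`, for digits `a`, `b` and a carry or borrow `c`. -/
theorem rippleVal_step (neg : Bool) (st : Bool × List Bool × List Bool × List Bool) :
    rippleVal neg (rippleStep neg st) = rippleVal neg st := by
  obtain ⟨c, u, v, w⟩ := st
  simp only [rippleVal, rippleStep, List.reverse_cons, ofBits_append_singleton, List.length_cons,
    List.length_reverse]
  rw [ofBits_eq_head_add u, ofBits_eq_head_add v]
  generalize u.headD false = a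
  generalize v.headD false = b
  cases neg <;> cases a <;> cases b <;> cases c <;> simp [majority, pow_succ] <;> ring

theorem rippleStep_foldl (neg : Bool) (l : List Bool)
    (st : Bool × List Bool × List Bool × List Bool) :
    rippleVal neg (l.foldl (fun st _ => rippleStep neg st) st) = rippleVal neg st ∧
    (l.foldl (fun st _ => rippleStep neg st) st).2.1 = st.2.1.drop l.length ∧
    (l.foldl (fun st _ => rippleStep neg st) st).2.2.1 = st.2.2.1.drop l.length := by
  induction l generalizing st with
  | nil => simp
  | cons x l ih =>
    rw [List.foldl_cons]
    obtain ⟨h1, h2, h3⟩ := ih (rippleStep neg st)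
    rw [h1, h2, h3, rippleVal_step]
    simp [rippleStep]

theorem ripple_spec (neg : Bool) (u v : List Bool) :
    (ripple neg u v).2.1 = [] ∧ (ripple neg u v).2.2.1 = [] ∧
    ((ofBits (ripple neg u v).2.2.2.reverse : ℤ) + 2 ^ (ripple neg u v).2.2.2.length *
      ((if neg then -1 else 1) * ((ripple neg u v).1.toNat : ℤ)) =
      ofBits u + (if neg then -1 else 1) * ofBits v) := by
  obtain ⟨h1, h2, h3⟩ := rippleStep_foldl neg (u ++ (v ++ [false])) (false, u, v, [])
  have h2' : (ripple neg u v).2.1 = [] := by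
    rw [ripple, h2]; simp
  have h3' : (ripple neg u v).2.2.1 = [] := by
    rw [ripple, h3]; simp; omega
  refine ⟨h2', h3', ?_⟩
  change rippleVal neg (ripple neg u v) = _ at h1
  simpa [rippleVal, h2', h3', ofBits] using h1

/-- Both operands are used up before the last step, which therefore only moves the carry into the
result. This is the purpose of the additional digit `[false]` in `ripple`. -/
theorem ripple_false_fst (u v : List Bool) : (ripple false u v).1 = false := by
  obtain ⟨-, h2, h3⟩ := rippleStep_foldl false (u ++ v) (false, u, v, [])
  rw [ripple, ← List.append_assoc, List.foldl_append, List.foldl_cons, List.foldl_nil,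
    rippleStep, h2, h3]
  simp [majority]

theorem ofBits_ripple_add (m n : ℕ) : ofBits (ripple false m.bits n.bits).2.2.2.reverse = m + n := by
  have h := (ripple_spec false m.bits n.bits).2.2
  rw [ripple_false_fst, ofBits_bits, ofBits_bits] at h
  simp at h
  exact_mod_cast h

/-- The digits of the result represent a number below `2 ^ length`, so `ripple_spec` forces a final
borrow exactly when the difference is negative. Comparison thus comes for free with subtraction. -/
theorem ripple_sub (m n : ℕ) : (ripple true m.bits n.bits).1 = decide (m < n) ∧
    (¬ m < n → ofBits (ripple true m.bits n.bits).2.2.2.reverse = m - n) := by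
  have h := (ripple_spec true m.bits n.bits).2.2
  have h1 := ofBits_lt (ripple true m.bits n.bits).2.2.2.reverse
  rw [ofBits_bits, ofBits_bits] at h
  rw [List.length_reverse] at h1
  zify at h1
  cases hc : (ripple true m.bits n.bits).1
  · simp only [hc, if_true, Bool.toNat_false] at h
    push_cast at h
    have : ¬ m < n := by omega
    simp only [this, decide_false, true_and, not_false_iff, forall_true_left]
    omega
  · simp only [hc, if_true, Bool.toNat_true] at h
    push_cast at h
    have : m < n := by omega
    simp [this]

namespace PT

variable {α β γ σ : Type} [Enc α] [Enc β] [Enc γ] [Enc σ]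

/-- Computing a value with the same encoding. -/
theorem recode {f : α → β} {g : α → γ} (hf : PT f) (h : ∀ a, enc (g a) = enc (f a)) : PT g := by
  obtain ⟨p, P, hp⟩ := hf
  exact ⟨p, P, fun a => by rw [h]; exact hp a⟩

theorem bits {f : α → ℕ} (hf : PT f) : PT fun a => (f a).bits := hf.recode fun _ => rfl

/-- Removing leading zeros. -/
theorem bits_ofBits (l : List Bool) : (ofBits l).bits =
    l.reverse.foldl (fun acc b => if (acc.isEmpty && !b) = true then acc else b :: acc) [] := by
  induction l with
  | nil => simp [ofBits]
  | cons b l ih =>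
    rw [List.reverse_cons, List.foldl_append, ← ih, List.foldl_cons, List.foldl_nil]
    change (Nat.bit b (ofBits l)).bits = _
    by_cases h : ofBits l = 0 → b = true
    · rw [Nat.bits_append_bit _ _ h]
      rw [if_neg]
      intro h'
      simp only [Bool.and_eq_true, List.isEmpty_iff, Bool.not_eq_true'] at h'
      have := h (by rw [← ofBits_bits (ofBits l), h'.1]; rfl)
      simp [this] at h'
    · push Not at h
      obtain ⟨h1, h2⟩ := h
      simp only [ne_eq, Bool.not_eq_true] at h2
      simp [h1, h2, Nat.bit]

theorem ofBits {f : α → List Bool} (hf : PT f) : PT fun a => _root_.ofBits (f a) := by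
  have h : PT fun a => (f a).reverse.foldl
      (fun acc b => if (acc.isEmpty && !b) = true then acc else b :: acc) [] := by
    refine hf.reverse.foldl_of_growth
      (f := fun _ (acc : List Bool) b => if (acc.isEmpty && !b) = true then acc else b :: acc)
      (const []) ?_ (PolyBdd.const 4) ?_
    · exact ((fst (snd .id)).isEmpty.and (snd (snd .id)).not).ite (fst (snd .id))
        (cons (snd (snd .id)) (fst (snd .id)))
    · intro a t x _
      have := sz_bool_le x
      split_ifs
      · omega
      · rw [sz_cons]; omega
  exact h.recode fun a => by rw [← bits_ofBits]; rfl

theorem rippleStep (neg : Bool) : PT (_root_.rippleStep neg) := by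
  have hc : PT fun st : Bool × List Bool × List Bool × List Bool => st.1 := fst .id
  have hu : PT fun st : Bool × List Bool × List Bool × List Bool => st.2.1 := fst (snd .id)
  have hv : PT fun st : Bool × List Bool × List Bool × List Bool => st.2.2.1 :=
    fst (snd (snd .id))
  have hw : PT fun st : Bool × List Bool × List Bool × List Bool => st.2.2.2 :=
    snd (snd (snd .id))
  have ha := hu.headD (d := false)
  have hb := hv.headD (d := false)
  have han := xor ha (const neg)
  exact pair ((han.and hb).or ((han.and hc).or (hb.and hc)))
    (pair hu.tail (pair hv.tail (cons (xor (xor ha hb) hc) hw)))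

theorem ripple (neg : Bool) {f g : α → List Bool} (hf : PT f) (hg : PT g) :
    PT fun a => _root_.ripple neg (f a) (g a) := by
  refine (hf.append (hg.append (const [false]))).foldl_of_growth
    (f := fun _ st _ => _root_.rippleStep neg st)
    ((const false).pair (hf.pair (hg.pair (const [])))) ((rippleStep neg).comp (fst (snd .id)))
    (PolyBdd.const 10) fun a t x _ => ?_
  simp only [_root_.rippleStep, sz_pair, sz_cons]
  have h1 := sz_bool_le (majority (Bool.xor (t.2.1.headD false) neg) (t.2.2.1.headD false) t.1)
  have h2 := sz_bool_le (Bool.xor (Bool.xor (t.2.1.headD false) (t.2.2.1.headD false)) t.1)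
  have h3 := sz_tail_le t.2.1
  have h4 := sz_tail_le t.2.2.1
  omega

theorem nat_add {f g : α → ℕ} (hf : PT f) (hg : PT g) : PT fun a => f a + g a :=
  (ofBits (snd (snd (snd (ripple false hf.bits hg.bits)))).reverse).congr fun a => by
    rw [ofBits_ripple_add]

theorem nat_lt {f g : α → ℕ} (hf : PT f) (hg : PT g) : PT fun a => decide (f a < g a) :=
  (fst (ripple true hf.bits hg.bits)).congr fun a => by rw [(ripple_sub _ _).1]

theorem nat_sub {f g : α → ℕ} (hf : PT f) (hg : PT g) : PT fun a => f a - g a :=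
  ((hf.nat_lt hg).ite (const 0)
    (ofBits (snd (snd (snd (ripple true hf.bits hg.bits)))).reverse)).congr fun a => by
    split_ifs with h
    · simp only [decide_eq_true_eq] at h; omega
    · rw [(ripple_sub _ _).2 (by simpa using h)]

theorem sz_nat (n : ℕ) : sz n = sz n.bits := rfl

theorem sz_nat_le (n : ℕ) : sz n ≤ 4 * n.size + 1 := by
  rw [sz_nat, ← Nat.size_eq_bits_len n]
  exact sz_bits_le _

theorem size_le_sz_nat (n : ℕ) : n.size ≤ sz n := by
  rw [sz_nat, ← Nat.size_eq_bits_len n]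
  exact (length_lt_sz _).le

end PT

/-! ### The algorithm -/

/-- A weighted equation: coefficients, right-hand side, weight. -/
abbrev Row := List Bool × Bool × ℕ

/-- A system: its number of variables (in unary) and its equations. -/
abbrev Node := List Unit × List Row

/-- The weight of the equations that hold at the origin. -/
def posWeight (R : List Row) : ℕ := ((R.filter fun r => !r.2.1).map fun r => r.2.2).sum

/-- The weight of the equations that fail at the origin. -/
def negWeight (R : List Row) : ℕ := ((R.filter fun r => r.2.1).map fun r => r.2.2).sum

/-- The coefficient vectors of a system, without repetitions. -/
def coefVectors (R : List Row) : List (List Bool) :=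
  R.foldl (fun acc r => if (acc.any fun v => v == r.1) = true then acc else r.1 :: acc) []

/-- The equation (if any) into which all equations with coefficient vector `v` merge. -/
def mergeAt (R : List Row) (v : List Bool) : List Row :=
  if decide (negWeight (R.filter fun r => r.1 == v) <
      posWeight (R.filter fun r => r.1 == v)) = true then
    [(v, false, posWeight (R.filter fun r => r.1 == v) - negWeight (R.filter fun r => r.1 == v))]
  else if decide (posWeight (R.filter fun r => r.1 == v) <
      negWeight (R.filter fun r => r.1 == v)) = true then
    [(v, true, negWeight (R.filter fun r => r.1 == v) - posWeight (R.filter fun r => r.1 == v))]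
  else []

/-- Merging the equations with equal left-hand sides. -/
def merge (R : List Row) : List Row := (coefVectors R).flatMap (mergeAt R)

/-- An equation in old and new variables. -/
abbrev MixedRow := List Bool × List Bool × Bool × ℕ

/-- Eliminating the first old variable from `s` by means of the equation `r`; a new variable states
that `r` holds. -/
def elimHead (r s : MixedRow) : MixedRow :=
  if s.1.headD false = true then
    (List.zipWith Bool.xor s.1.tail r.1.tail, true :: List.zipWith Bool.xor s.2.1 r.2.1,
      Bool.xor s.2.2.1 (!r.2.2.1), s.2.2.2)
  else (s.1.tail, false :: s.2.1, s.2.2)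

/-- The equations that contain the first old variable. -/
def pivots (R : List MixedRow) : List MixedRow := R.filter fun s => s.1.headD false

/-- Eliminating the first old variable. -/
def elimStep (st : List Unit × List MixedRow) : List Unit × List MixedRow :=
  if (pivots st.2).isEmpty = true then (st.1, st.2.map fun s => (s.1.tail, s.2))
  else (() :: st.1, st.2.map (elimHead ((pivots st.2).headD ([], [], false, 0))))

/-- Eliminating all old variables. -/
def elimAll (nd : Node) : List Unit × List MixedRow :=
  nd.1.foldl (fun st _ => elimStep st) ([], nd.2.map fun r => (r.1, [], r.2))

/-- A change of variables after which every variable occurs as an equation of its own, which fails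
at the origin, and unused variables have disappeared. -/
def normalForm (nd : Node) : Node := ((elimAll nd).1, (elimAll nd).2.map fun s => s.2)

/-- Setting the first variable to one. -/
def substHead (R : List Row) : List Row :=
  R.map fun r => (r.1.tail, Bool.xor r.2.1 (r.1.headD false), r.2.2)

/-- Rotating the variables. -/
def rotateVars (R : List Row) : List Row :=
  R.map fun r => (if r.1.isEmpty = true then [] else r.1.tail ++ [r.1.headD false], r.2)

/-- Branching on the first variable being one. -/
def child (nd : Node) : Node := normalForm (nd.1.tail, merge (substHead nd.2))

/-- Branching on some variable being one. -/
def children (nd : Node) : List Node :=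
  (nd.1.foldl (fun (st : List Row × List Node) _ =>
    (rotateVars st.1, child (nd.1, st.1) :: st.2)) (nd.2, [])).2

/-- Does the origin have excess at least `K`? -/
def excessTest (K : ℕ) (R : List Row) : Bool := !decide (posWeight R < negWeight R + K)

/-- The equations without variables. -/
def constRows (R : List Row) : List Row := R.filter fun r => !r.1.any id

/-- Does the origin, or the average assignment, have excess at least `K`? -/
def nodeTest (K : ℕ) (nd : Node) : Bool := excessTest K nd.2 || excessTest K (constRows nd.2)

/-- One level of the search tree; the state tells whether the search is over, whether it was
successful, and the nodes of the current level. -/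
def searchStep (K : ℕ) (cap : List Row) (st : Bool × Bool × List Node) : Bool × Bool × List Node :=
  if st.1 = true then st
  else if st.2.2.any (nodeTest K) = true then (true, true, [])
  else if decide (cap.length < (st.2.2.flatMap children).length) = true then (true, false, [])
  else (false, false, st.2.2.flatMap children)

/-- Searching for an assignment of excess at least `K`, giving up when there are too many nodes. -/
def search (K : ℕ) (nd : Node) : Bool × Bool × List Node :=
  (() :: nd.1).foldl (fun st _ => searchStep K nd.2 st) (false, false, [nd])

/-- The smaller of a unary and a binary number, in unary. -/
def unaryMin (u : List Unit) (k : ℕ) : List Unit :=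
  (u.foldl (fun (st : ℕ × List Unit) _ =>
    if decide (0 < st.1) = true then (st.1 - 1, () :: st.2) else st) (k, [])).2

/-- A list of length `64 * k ^ 2 * Nat.size k`, where `u` has length `k`. -/
def thresholdList (u : List Unit) (k : ℕ) : List Bool :=
  u.flatMap fun _ => u.flatMap fun _ => (List.replicate 64 ()).flatMap fun _ => k.bits

/-- The kernelization in terms of lists. -/
def kernelize (q : Node × ℕ) : Node × ℕ :=
  if decide (0 < q.2) = true then
    let nd := normalForm (q.1.1, merge q.1.2)
    let s := search (q.2 + q.2) nd
    if s.1 = true then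
      if s.2.1 = true then (([], []), 0)
      else if decide (nd.1.length < (thresholdList (unaryMin nd.1 q.2) q.2).length) = true then
        if (nd.2.any fun r => !decide (r.2.2 < q.2 + q.2)) = true then (([], []), 0) else (nd, q.2)
      else (([], []), 0)
    else (([], []), 1)
  else (([], []), 0)

/-! ### Running time of merging and of elimination steps -/

namespace PT

variable {α β γ σ : Type} [Enc α] [Enc β] [Enc γ] [Enc σ]

theorem _root_.Nat.size_add_le (m n : ℕ) : (m + n).size ≤ m.size + n.size := by
  rcases Nat.eq_zero_or_pos m with rfl | hm
  · simp
  rcases Nat.eq_zero_or_pos n with rfl | hn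
  · simp
  have h1 := Nat.size_pos.2 hm
  have h2 := Nat.size_pos.2 hn
  rw [Nat.size_le, pow_add]
  have h3 := Nat.lt_size_self m
  have h4 := Nat.lt_size_self n
  have h5 : 2 ^ 1 ≤ 2 ^ m.size := Nat.pow_le_pow_right (by norm_num) h1
  have h6 : 2 ^ 1 ≤ 2 ^ n.size := Nat.pow_le_pow_right (by norm_num) h2
  nlinarith

/-- Guarantees that the partial sums in `nat_sum` stay polynomially large. -/
theorem _root_.Nat.size_sum_le (l : List ℕ) : l.sum.size ≤ sz l := by
  induction l with
  | nil => simp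
  | cons n l ih =>
    have h1 := Nat.size_add_le n l.sum
    have h2 := size_le_sz_nat n
    rw [List.sum_cons, sz_cons]
    omega

theorem nat_sum {f : α → List ℕ} (hf : PT f) : PT fun a => (f a).sum := by
  have h : PT fun a => (f a).foldl (fun s n => s + n) 0 := by
    refine hf.foldl (const 0) (nat_add (fst (snd .id)) (snd (snd .id))) ?_
    obtain ⟨Q, hQ⟩ := ((PolyBdd.const 4).mul hf.sz_bdd).add (.const 1)
    refine ⟨Q, fun a l₁ h => le_trans ?_ (hQ a)⟩
    rw [← List.sum_eq_foldl]
    refine (sz_nat_le _).trans ?_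
    have h1 := Nat.size_sum_le l₁
    obtain ⟨l₂, h2⟩ := h
    change _ ≤ 4 * sz (f a) + 1
    have h3 := sz_append l₁ l₂
    have h4 := sz_pos l₂
    rw [h2] at h3
    omega
  exact h.congr fun a => List.sum_eq_foldl

theorem posWeight {f : α → List Row} (hf : PT f) : PT fun a => _root_.posWeight (f a) :=
  nat_sum ((hf.filter (b := fun _ r => !r.2.1) (fst (snd (snd .id))).not).map
    (snd (snd (snd .id))))

theorem negWeight {f : α → List Row} (hf : PT f) : PT fun a => _root_.negWeight (f a) :=
  nat_sum ((hf.filter (b := fun _ r => r.2.1) (fst (snd (snd .id)))).map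
    (snd (snd (snd .id))))

theorem coefVectors : PT _root_.coefVectors := by
  refine PT.id.foldl_of_growth (f := fun _ (acc : List (List Bool)) (r : Row) =>
    if (acc.any fun v => v == r.1) = true then acc else r.1 :: acc) (const [])
    (PT.ite ?_ (fst (snd .id)) (cons (fst (snd (snd .id))) (fst (snd .id))))
    (PolyBdd.size.add (.const 1)) ?_
  · exact any (fst (snd .id)) (b := fun (q : List Row × List (List Bool) × Row) v => v == q.2.2.1)
      (bits_eq (snd .id) (fst (snd (snd (fst .id)))))
  · intro R t r hr
    have h := sz_le_of_mem hr
    rw [sz_pair] at h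
    split_ifs
    · omega
    · rw [sz_cons]; omega

theorem mergeAt {f : α → List Row} {g : α → List Bool} (hf : PT f) (hg : PT g) :
    PT fun a => _root_.mergeAt (f a) (g a) := by
  have h : PT fun a => (f a).filter fun r => r.1 == g a :=
    hf.filter (b := fun a r => r.1 == g a) (bits_eq (fst (snd .id)) (hg.comp (fst .id)))
  exact (nat_lt h.negWeight h.posWeight).ite
    (cons (hg.pair ((const false).pair (nat_sub h.posWeight h.negWeight))) (const []))
    ((nat_lt h.posWeight h.negWeight).ite
      (cons (hg.pair ((const true).pair (nat_sub h.negWeight h.posWeight))) (const []))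
      (const []))

theorem merge : PT _root_.merge := coefVectors.flatMap (mergeAt (fst .id) (snd .id))

theorem elimHead : PT fun q : MixedRow × MixedRow => _root_.elimHead q.1 q.2 := by
  have hr : PT fun q : MixedRow × MixedRow => q.1 := fst .id
  have hs : PT fun q : MixedRow × MixedRow => q.2 := snd .id
  exact hs.fst.headD.ite
    ((zipXor hs.fst.tail hr.fst.tail).pair
      ((cons (const true) (zipXor hs.snd.fst hr.snd.fst)).pair
        ((xor hs.snd.snd.fst hr.snd.snd.fst.not).pair hs.snd.snd.snd)))
    (hs.fst.tail.pair ((cons (const false) hs.snd.fst).pair hs.snd.snd))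

theorem elimStep : PT _root_.elimStep := by
  have h : PT fun st : List Unit × List MixedRow => pivots st.2 :=
    (snd .id).filter (b := fun _ (s : MixedRow) => s.1.headD false) (headD (fst (snd .id)))
  exact h.isEmpty.ite
    (fst .id |>.pair ((snd .id).map (f := fun _ (s : MixedRow) => (s.1.tail, s.2))
      ((fst (snd .id)).tail.pair (snd (snd .id)))))
    ((cons (const ()) (fst .id)).pair ((snd .id).map
      (f := fun st s => _root_.elimHead ((pivots st.2).headD ([], [], false, 0)) s)
      (elimHead.comp (((headD h).comp (fst .id)).pair (snd .id)))))

end PT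

/-- Bounds for the dimensions of a system in old and new variables. -/
structure MixedBdd (A B C M : ℕ) (st : List Unit × List MixedRow) : Prop where
  count : st.1.length ≤ C
  length : st.2.length ≤ M
  old : ∀ s ∈ st.2, s.1.length ≤ A
  new : ∀ s ∈ st.2, s.2.1.length ≤ C
  weight : ∀ s ∈ st.2, s.2.2.2.size ≤ B

/-- A step adds at most one new coefficient to each equation and changes neither the number of
equations nor the weights. Such additive control is needed because a bound that is merely polynomial
in the previous state could explode under iteration. -/
theorem MixedBdd.elimStep {A B C M : ℕ} {st : List Unit × List MixedRow}
    (h : MixedBdd A B C M st) : MixedBdd A B (C + 1) M (elimStep st) := by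
  obtain ⟨h1, h2, h3, h4, h5⟩ := h
  unfold _root_.elimStep
  split_ifs
  · refine ⟨by simp; omega, by simpa using h2, ?_, ?_, ?_⟩
    · simp only [List.mem_map]; rintro _ ⟨s, hs, rfl⟩
      have := h3 s hs; simp; omega
    · simp only [List.mem_map]; rintro _ ⟨s, hs, rfl⟩
      have := h4 s hs; simp; omega
    · simp only [List.mem_map]; rintro _ ⟨s, hs, rfl⟩
      exact h5 s hs
  · refine ⟨by simp; omega, by simpa using h2, ?_, ?_, ?_⟩
    · simp only [List.mem_map]; rintro _ ⟨s, hs, rfl⟩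
      have := h3 s hs; unfold elimHead; split_ifs <;> simp <;> omega
    · simp only [List.mem_map]; rintro _ ⟨s, hs, rfl⟩
      have := h4 s hs; unfold elimHead; split_ifs <;> simp <;> omega
    · simp only [List.mem_map]; rintro _ ⟨s, hs, rfl⟩
      have := h5 s hs; unfold elimHead; split_ifs <;> simpa

theorem MixedBdd.foldl {A B C M : ℕ} {st : List Unit × List MixedRow}
    (h : MixedBdd A B C M st) (l : List Unit) :
    MixedBdd A B (C + l.length) M (l.foldl (fun st _ => _root_.elimStep st) st) := by
  induction l generalizing C st with
  | nil => simpa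
  | cons x l ih =>
    have := ih h.elimStep
    rwa [add_assoc, add_comm 1] at this

theorem sz_unit (u : Unit) : sz u = 1 := rfl

theorem sz_units (l : List Unit) : sz l = 2 * l.length + 1 := by
  induction l with
  | nil => rfl
  | cons x l ih => rw [sz_cons, ih, sz_unit, List.length_cons]; ring

theorem MixedBdd.sz_le {A B C M : ℕ} {st : List Unit × List MixedRow}
    (h : MixedBdd A B C M st) :
    sz st ≤ 2 * C + 3 + M * (4 * A + 4 * B + 4 * C + 10) := by
  obtain ⟨h1, h2, h3, h4, h5⟩ := h
  have := sz_list_le (n := 4 * A + 4 * B + 4 * C + 9) h2 fun s hs => by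
    have a1 := PT.sz_bits_le s.1
    have a2 := PT.sz_bits_le s.2.1
    have a3 := PT.sz_nat_le s.2.2.2
    have a4 := PT.sz_bool_le s.2.2.1
    have a5 := h3 s hs
    have a6 := h4 s hs
    have a7 := h5 s hs
    simp only [sz_pair]
    omega
  rw [show 4 * A + 4 * B + 4 * C + 9 + 1 = 4 * A + 4 * B + 4 * C + 10 from rfl] at this
  rw [sz_pair, sz_units]
  omega

theorem mixedBdd_init (nd : Node) :
    MixedBdd (sz nd) (sz nd) 0 (sz nd) ([], nd.2.map fun r => (r.1, [], r.2)) := by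
  have key : ∀ r ∈ nd.2, sz r ≤ sz nd := fun r hr => by
    have := sz_le_of_mem hr
    rw [sz_pair nd]; omega
  refine ⟨by simp, ?_, ?_, ?_, ?_⟩
  · have := length_lt_sz nd.2
    rw [sz_pair]; simp; omega
  all_goals simp only [List.mem_map]; rintro _ ⟨r, hr, rfl⟩; have h := key r hr
  · have := length_lt_sz r.1
    rw [sz_pair r] at h; simp only; omega
  · simp
  · have := PT.size_le_sz_nat r.2.2
    rw [sz_pair r, sz_pair r.2] at h
    simp only; omega

namespace PT

theorem normalForm : PT _root_.normalForm := by
  have h : PT elimAll := by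
    refine (fst .id).foldl (f := fun (_ : Node) st (_ : Unit) => _root_.elimStep st)
      ((const []).pair ((snd .id).map (f := fun (_ : Node) (r : Row) => (r.1, ([] : List Bool), r.2))
        ((fst (snd .id)).pair ((const []).pair (snd (snd .id))))))
      (elimStep.comp (fst (snd .id))) ?_
    obtain ⟨Q, hQ⟩ := (((PolyBdd.const (α := Node) 2).mul .size).add (.const 3)).add
      (PolyBdd.size.mul (((((PolyBdd.const 4).mul .size).add ((PolyBdd.const 4).mul .size)).add
        ((PolyBdd.const 4).mul .size)).add (.const 10)))
    refine ⟨Q, fun nd l₁ h => le_trans ?_ (hQ nd)⟩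
    refine ((mixedBdd_init nd).foldl l₁).sz_le.trans ?_
    have h1 : 0 + l₁.length ≤ sz nd := by
      have h2 := h.length_le
      have h3 := length_lt_sz nd.1
      rw [sz_pair]; omega
    beta_reduce
    gcongr
  exact h.fst.pair (h.snd.map (f := fun _ s => s.2) (snd (snd .id)))

theorem substHead {α : Type} [Enc α] {f : α → List Row} (hf : PT f) :
    PT fun a => _root_.substHead (f a) := by
  have hr : PT fun q : α × Row => q.2 := snd .id
  exact hf.map (f := fun _ r => (r.1.tail, Bool.xor r.2.1 (r.1.headD false), r.2.2))
    (hr.fst.tail.pair ((xor hr.snd.fst hr.fst.headD).pair hr.snd.snd))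

theorem rotateVars {α : Type} [Enc α] {f : α → List Row} (hf : PT f) :
    PT fun a => _root_.rotateVars (f a) := by
  have hr : PT fun q : α × Row => q.2 := snd .id
  exact hf.map (f := fun _ r =>
    (if r.1.isEmpty = true then [] else r.1.tail ++ [r.1.headD false], r.2))
    ((hr.fst.isEmpty.ite (const []) (hr.fst.tail.append (cons hr.fst.headD (const [])))).pair
      hr.snd)

theorem child : PT _root_.child :=
  normalForm.comp ((fst .id).tail.pair (merge.comp (substHead (snd .id))))

/-- Since rotation preserves the size, every child is computed from data as large as the parent, and
one polynomial value bounds all of them. -/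
theorem sz_rotateVars (R : List Row) : sz (_root_.rotateVars R) = sz R := by
  induction R with
  | nil => rfl
  | cons r R ih =>
    unfold _root_.rotateVars at ih ⊢
    rw [List.map_cons, sz_cons, sz_cons, ih]
    obtain ⟨v, s⟩ := r
    cases v with
    | nil => rfl
    | cons b v =>
      have h := sz_append v [b]
      simp only [sz_pair, sz_cons, sz_nil, List.isEmpty_cons, List.tail_cons, List.headD_cons] at h ⊢
      simp
      omega

theorem children : PT _root_.children := by
  refine snd ((fst .id).foldl (f := fun (nd : Node) (st : List Row × List Node) (_ : Unit) =>
    (_root_.rotateVars st.1, _root_.child (nd.1, st.1) :: st.2)) ((snd .id).pair (const [])) ?_ ?_)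
  · have hst : PT fun q : Node × (List Row × List Node) × Unit => q.2.1 := fst (snd .id)
    exact (rotateVars hst.fst).pair
      (cons (child.comp ((fst (fst .id)).pair hst.fst)) hst.snd)
  · obtain ⟨P, hP⟩ := child.sz_bdd
    obtain ⟨Q, hQ⟩ := ((PolyBdd.size (α := Node)).add (.const 2)).add
      (PolyBdd.size.mul ((PolyBdd.size.eval P).add (.const 1)))
    refine ⟨Q, fun nd l₁ h => le_trans ?_ (hQ nd)⟩
    have key : ∀ (l : List Unit) (R : List Row) (F : List Node), sz R = sz nd.2 →
        sz (l.foldl (fun (st : List Row × List Node) _ =>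
          (_root_.rotateVars st.1, _root_.child (nd.1, st.1) :: st.2)) (R, F)) ≤
        sz nd.2 + sz F + 1 + l.length * (P.eval (sz nd) + 1) := by
      intro l
      induction l with
      | nil => intro R F hR; simp [sz_pair, hR]
      | cons x l ih =>
        intro R F hR
        refine (ih (_root_.rotateVars R) _ ((sz_rotateVars R).trans hR)).trans ?_
        have h1 : sz (_root_.child (nd.1, R)) ≤ _ := hP (nd.1, R)
        have h2 : sz (nd.1, R) = sz nd := by rw [sz_pair, sz_pair, hR]
        rw [h2] at h1
        simp only [sz_cons, List.length_cons, add_mul l.length]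
        omega
    refine (key l₁ nd.2 [] rfl).trans ?_
    have h1 : l₁.length ≤ sz nd := by
      have h2 := h.length_le
      have h3 := length_lt_sz nd.1
      rw [sz_pair]; omega
    have h2 : sz nd.2 ≤ sz nd := by rw [sz_pair nd]; omega
    have h3 := Nat.mul_le_mul_right (P.eval (sz nd) + 1) h1
    rw [sz_nil]
    change _ ≤ sz nd + 2 + sz nd * (P.eval (sz nd) + 1)
    omega

theorem excessTest {α : Type} [Enc α] {f : α → ℕ} {g : α → List Row} (hf : PT f) (hg : PT g) :
    PT fun a => _root_.excessTest (f a) (g a) :=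
  (nat_lt hg.posWeight (nat_add hg.negWeight hf)).not

theorem constRows {α : Type} [Enc α] {g : α → List Row} (hg : PT g) :
    PT fun a => _root_.constRows (g a) :=
  hg.filter (b := fun _ (r : Row) => !r.1.any id)
    ((fst (snd .id)).any (b := fun _ b => id b) (snd .id)).not

theorem nodeTest : PT fun q : ℕ × Node => _root_.nodeTest q.1 q.2 :=
  (excessTest (fst .id) (snd (snd .id))).or (excessTest (fst .id) (constRows (snd (snd .id))))

theorem searchStep : PT fun q : (ℕ × List Row) × (Bool × Bool × List Node) =>
    _root_.searchStep q.1.1 q.1.2 q.2 := by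
  have hst : PT fun q : (ℕ × List Row) × (Bool × Bool × List Node) => q.2 := snd .id
  have hF := hst.snd.snd.flatMap (f := fun _ nd => _root_.children nd) (children.comp (snd .id))
  exact hst.fst.ite hst
    ((hst.snd.snd.any (b := fun q nd => _root_.nodeTest q.1.1 nd)
      (nodeTest.comp ((fst (fst (fst .id))).pair (snd .id)))).ite (const (true, true, []))
      ((length_lt (snd (fst .id)) hF).ite (const (true, false, []))
        ((const false).pair ((const false).pair hF))))

end PT

/-! ### Dimensions of the systems that occur, and the running time -/

/-- The total weight of a list of equations. -/
def rowsWeight (R : List Row) : ℕ := (R.map fun r => r.2.2).sum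

theorem posWeight_add_negWeight (R : List Row) : posWeight R + negWeight R = rowsWeight R := by
  induction R with
  | nil => rfl
  | cons r R ih =>
    obtain ⟨v, b, w⟩ := r
    cases b <;> simp [posWeight, negWeight, rowsWeight] at ih ⊢ <;> omega

theorem coefVectors_append_singleton (R : List Row) (r : Row) :
    coefVectors (R ++ [r]) =
      if r.1 ∈ coefVectors R then coefVectors R else r.1 :: coefVectors R := by
  unfold coefVectors
  rw [List.foldl_append, List.foldl_cons, List.foldl_nil]
  congr 1
  simp

theorem mem_coefVectors {R : List Row} {v : List Bool} :
    v ∈ coefVectors R ↔ ∃ r ∈ R, r.1 = v := by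
  induction R using List.reverseRecOn generalizing v with
  | nil => simp [coefVectors]
  | append_singleton R r ih =>
    rw [coefVectors_append_singleton]
    split_ifs with h
    · rw [ih] at h ⊢
      constructor
      · rintro ⟨s, hs, rfl⟩; exact ⟨s, by simp [hs], rfl⟩
      · rintro ⟨s, hs, rfl⟩
        rcases List.mem_append.1 hs with hs | hs
        · exact ⟨s, hs, rfl⟩
        · simp only [List.mem_singleton] at hs; rwa [hs]
    · rw [List.mem_cons, ih]
      constructor
      · rintro (rfl | ⟨s, hs, rfl⟩)
        · exact ⟨r, by simp, rfl⟩
        · exact ⟨s, by simp [hs], rfl⟩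
      · rintro ⟨s, hs, rfl⟩
        rcases List.mem_append.1 hs with hs | hs
        · exact Or.inr ⟨s, hs, rfl⟩
        · simp only [List.mem_singleton] at hs; exact Or.inl (by rw [hs])

theorem nodup_coefVectors (R : List Row) : (coefVectors R).Nodup := by
  induction R using List.reverseRecOn with
  | nil => simp [coefVectors]
  | append_singleton R r ih =>
    rw [coefVectors_append_singleton]
    split_ifs with h
    · exact ih
    · exact List.nodup_cons.2 ⟨h, ih⟩

theorem length_coefVectors_le (R : List Row) : (coefVectors R).length ≤ R.length := by
  induction R using List.reverseRecOn with
  | nil => simp [coefVectors]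
  | append_singleton R r ih =>
    rw [coefVectors_append_singleton]
    split_ifs <;> simp <;> omega

/-- Summing over the equations, grouped by their coefficient vectors. -/
theorem sum_coefVectors {A : Type} [AddCommMonoid A] (R : List Row) (F : Row → A) :
    ((coefVectors R).map fun v => ((R.filter fun r => r.1 == v).map F).sum).sum =
      (R.map F).sum := by
  have key : ∀ (V : List (List Bool)) (_ : V.Nodup) (R : List Row) (_ : ∀ r ∈ R, r.1 ∈ V),
      (V.map fun v => ((R.filter fun r => r.1 == v).map F).sum).sum = (R.map F).sum := by
    intro V hV R
    induction R with
    | nil => simp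
    | cons r R ih =>
      intro h
      have h1 := ih fun s hs => h s (by simp [hs])
      have h2 : (V.map fun v => (((r :: R).filter fun r => r.1 == v).map F).sum) =
          V.map fun v => (if r.1 = v then F r else 0) +
            ((R.filter fun r => r.1 == v).map F).sum := by
        refine List.map_congr_left fun v _ => ?_
        by_cases hv : r.1 = v <;> simp [hv]
      rw [h2, List.sum_map_add, h1, List.map_cons, List.sum_cons]
      congr 1
      rw [← List.sum_toFinset _ hV, Finset.sum_ite_eq, if_pos (by simpa using h r (by simp))]
  exact key _ (nodup_coefVectors R) R fun r hr => mem_coefVectors.2 ⟨r, hr, rfl⟩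

theorem mem_mergeAt {R : List Row} {v : List Bool} {r : Row} (h : r ∈ mergeAt R v) :
    r.1 = v ∧ 0 < r.2.2 := by
  unfold mergeAt at h
  simp only [decide_eq_true_eq] at h
  split_ifs at h <;> simp at h <;> subst h <;> simp <;> omega

theorem mem_merge {R : List Row} {r : Row} (h : r ∈ merge R) :
    (∃ s ∈ R, s.1 = r.1) ∧ 0 < r.2.2 := by
  obtain ⟨v, hv, h⟩ := List.mem_flatMap.1 h
  obtain ⟨rfl, h2⟩ := mem_mergeAt h
  exact ⟨mem_coefVectors.1 hv, h2⟩

theorem length_mergeAt_le (R : List Row) (v : List Bool) : (mergeAt R v).length ≤ 1 := by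
  unfold mergeAt
  split_ifs <;> simp

theorem length_merge_le (R : List Row) : (merge R).length ≤ R.length := by
  refine le_trans ?_ (length_coefVectors_le R)
  unfold merge
  induction coefVectors R with
  | nil => simp
  | cons v V ih =>
    have := length_mergeAt_le R v
    rw [List.flatMap_cons, List.length_append, List.length_cons]
    omega

theorem rowsWeight_mergeAt_le (R : List Row) (v : List Bool) :
    rowsWeight (mergeAt R v) ≤ rowsWeight (R.filter fun r => r.1 == v) := by
  rw [← posWeight_add_negWeight (R.filter fun r => r.1 == v)]
  unfold mergeAt
  simp only [decide_eq_true_eq]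
  split_ifs <;> simp [rowsWeight] <;> omega

theorem rowsWeight_append (R S : List Row) :
    rowsWeight (R ++ S) = rowsWeight R + rowsWeight S := by
  simp [rowsWeight]

theorem rowsWeight_merge_le (R : List Row) : rowsWeight (merge R) ≤ rowsWeight R := by
  rw [rowsWeight.eq_def R, ← sum_coefVectors R fun r => r.2.2]
  unfold merge
  induction coefVectors R with
  | nil => simp [rowsWeight]
  | cons v V ih =>
    have := rowsWeight_mergeAt_le R v
    rw [List.flatMap_cons, rowsWeight_append, List.map_cons, List.sum_cons]
    exact add_le_add this ih

theorem le_rowsWeight {R : List Row} {r : Row} (h : r ∈ R) : r.2.2 ≤ rowsWeight R :=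
  List.le_sum_of_mem (List.mem_map.2 ⟨r, h, rfl⟩)

/-- Bounds for the dimensions of a system. -/
structure NodeBdd (N M W : ℕ) (nd : Node) : Prop where
  count : nd.1.length ≤ N
  length : nd.2.length ≤ M
  coef : ∀ r ∈ nd.2, r.1.length ≤ N
  weight : rowsWeight nd.2 ≤ W

theorem elimStep_weights (st : List Unit × List MixedRow) :
    (elimStep st).2.map (fun s => s.2.2.2) = st.2.map fun s => s.2.2.2 := by
  unfold elimStep
  split_ifs
  · simp
  · rw [List.map_map]
    refine List.map_congr_left fun s _ => ?_
    simp only [Function.comp, elimHead]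
    split_ifs <;> rfl

theorem elimAll_weights (nd : Node) :
    (elimAll nd).2.map (fun s => s.2.2.2) = nd.2.map fun r => r.2.2 := by
  have key : ∀ (l : List Unit) (st : List Unit × List MixedRow),
      (l.foldl (fun st _ => elimStep st) st).2.map (fun s => s.2.2.2) =
        st.2.map fun s => s.2.2.2 := by
    intro l
    induction l with
    | nil => simp
    | cons x l ih => intro st; rw [List.foldl_cons, ih, elimStep_weights]
  rw [elimAll, key, List.map_map]
  rfl

theorem rowsWeight_normalForm (nd : Node) : rowsWeight (normalForm nd).2 = rowsWeight nd.2 := by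
  rw [rowsWeight, rowsWeight, ← elimAll_weights nd, normalForm, List.map_map]
  rfl

theorem length_normalForm (nd : Node) : (normalForm nd).2.length = nd.2.length := by
  have h := congrArg List.length (elimAll_weights nd)
  simpa [normalForm] using h

theorem mixedBdd_elimAll (nd : Node) : ∃ A B M, MixedBdd A B nd.1.length M (elimAll nd) := by
  have h := (mixedBdd_init nd).foldl nd.1
  rw [zero_add] at h
  exact ⟨_, _, _, h⟩

theorem NodeBdd.normalForm {N M W : ℕ} {nd : Node} (h : NodeBdd N M W nd) :
    NodeBdd N M W (normalForm nd) := by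
  obtain ⟨A, B, M', h'⟩ := mixedBdd_elimAll nd
  refine ⟨h'.count.trans h.count, ?_, fun r hr => ?_, ?_⟩
  · rw [length_normalForm]; exact h.length
  · obtain ⟨s, hs, rfl⟩ := List.mem_map.1 hr
    exact (h'.new s hs).trans h.count
  · rw [rowsWeight_normalForm]; exact h.weight

/-- Substituting, merging and eliminating never enlarge the number of variables, the number of
equations or the total weight. Hence bounds for the root hold throughout the search tree, whatever
its depth. -/
theorem NodeBdd.child {N M W : ℕ} {nd : Node} (h : NodeBdd N M W nd) :
    NodeBdd N M W (child nd) := by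
  refine NodeBdd.normalForm ⟨?_, ?_, fun r hr => ?_, ?_⟩
  · have := h.count; simp; omega
  · refine (length_merge_le _).trans ?_
    simpa [substHead] using h.length
  · obtain ⟨⟨s, hs, hsr⟩, -⟩ := mem_merge hr
    obtain ⟨t, ht, rfl⟩ := List.mem_map.1 hs
    have := h.coef t ht
    rw [← hsr]; simp; omega
  · refine (rowsWeight_merge_le _).trans ?_
    have := h.weight
    rw [rowsWeight] at this ⊢
    simpa [substHead, Function.comp_def] using this

theorem NodeBdd.rotateVars {N M W : ℕ} {u : List Unit} {R : List Row} (h : NodeBdd N M W (u, R)) :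
    NodeBdd N M W (u, rotateVars R) := by
  refine ⟨h.count, ?_, fun r hr => ?_, ?_⟩
  · simpa [_root_.rotateVars] using h.length
  · obtain ⟨t, ht, rfl⟩ := List.mem_map.1 hr
    have := h.coef t ht
    obtain ⟨v, s⟩ := t
    cases v
    · simp
    · simpa using this
  · have := h.weight
    rw [rowsWeight] at this ⊢
    simpa [_root_.rotateVars, Function.comp_def] using this

theorem children_foldl (u l : List Unit) (R : List Row) (F : List Node) :
    (l.foldl (fun (st : List Row × List Node) _ =>
      (rotateVars st.1, child (u, st.1) :: st.2)) (R, F)).2 =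
      ((List.range l.length).map fun i => child (u, rotateVars^[i] R)).reverse ++ F := by
  induction l generalizing R F with
  | nil => simp
  | cons x l ih =>
    rw [List.foldl_cons, ih, List.length_cons, List.range_succ_eq_map]
    simp [Function.comp_def]

theorem length_children (nd : Node) : (children nd).length = nd.1.length := by
  simp [children, children_foldl]

theorem mem_children {nd c : Node} :
    c ∈ children nd ↔ ∃ i < nd.1.length, c = child (nd.1, rotateVars^[i] nd.2) := by
  simp [children, children_foldl, eq_comm]

theorem NodeBdd.children {N M W : ℕ} {nd c : Node} (h : NodeBdd N M W nd)
    (hc : c ∈ children nd) : NodeBdd N M W c := by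
  obtain ⟨i, -, rfl⟩ := mem_children.1 hc
  refine NodeBdd.child ?_
  clear hc
  induction i with
  | zero => exact h
  | succ i ih => rw [Function.iterate_succ_apply']; exact ih.rotateVars

theorem NodeBdd.sz_le {N M W : ℕ} {nd : Node} (h : NodeBdd N M W nd) :
    sz nd ≤ 2 * N + 3 + M * (4 * N + 4 * W.size + 8) := by
  have := sz_list_le (n := 4 * N + 4 * W.size + 7) h.length fun r hr => by
    have a1 := PT.sz_bits_le r.1
    have a2 := PT.sz_nat_le r.2.2
    have a3 := PT.sz_bool_le r.2.1
    have a4 := h.coef r hr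
    have a5 := Nat.size_le_size ((le_rowsWeight hr).trans h.weight)
    simp only [sz_pair]
    omega
  rw [show 4 * N + 4 * W.size + 7 + 1 = 4 * N + 4 * W.size + 8 from rfl] at this
  have := h.count
  rw [sz_pair, sz_units]
  omega

theorem nodeBdd_self (nd : Node) : NodeBdd (sz nd) (sz nd) (rowsWeight nd.2) nd := by
  refine ⟨?_, ?_, fun r hr => ?_, le_rfl⟩
  · have := length_lt_sz nd.1
    rw [sz_pair]; omega
  · have := length_lt_sz nd.2
    rw [sz_pair]; omega
  · have h1 := sz_le_of_mem hr
    have h2 := length_lt_sz r.1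
    rw [sz_pair] at h1 ⊢; omega

theorem size_rowsWeight_le (R : List Row) : (rowsWeight R).size ≤ sz R := by
  refine (Nat.size_sum_le _).trans ?_
  induction R with
  | nil => rfl
  | cons r R ih =>
    rw [List.map_cons, sz_cons, sz_cons, sz_pair r, sz_pair r.2]
    omega

/-- Bounds for the states of the search. -/
structure SearchBdd (N M W : ℕ) (st : Bool × Bool × List Node) : Prop where
  length : st.2.2.length ≤ M + 1
  node : ∀ nd ∈ st.2.2, NodeBdd N M W nd

theorem SearchBdd.searchStep {N M W K : ℕ} {cap : List Row} {st : Bool × Bool × List Node}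
    (h : SearchBdd N M W st) (hcap : cap.length ≤ M) :
    SearchBdd N M W (searchStep K cap st) := by
  unfold _root_.searchStep
  split_ifs with h1 h2 h3
  · exact h
  · exact ⟨by simp, by simp⟩
  · exact ⟨by simp, by simp⟩
  · simp only [decide_eq_true_eq, not_lt] at h3
    refine ⟨by simp only; omega, fun c hc => ?_⟩
    obtain ⟨nd, hnd, hc⟩ := List.mem_flatMap.1 hc
    exact (h.node nd hnd).children hc

theorem SearchBdd.sz_le {N M W : ℕ} {st : Bool × Bool × List Node} (h : SearchBdd N M W st) :
    sz st ≤ 9 + (M + 1) * (2 * N + 3 + M * (4 * N + 4 * W.size + 8) + 1) := by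
  have h1 := sz_list_le h.length fun nd hnd => (h.node nd hnd).sz_le
  have h2 := PT.sz_bool_le st.1
  have h3 := PT.sz_bool_le st.2.1
  rw [sz_pair, sz_pair]
  omega

/-! ### Running time of the search and of the kernelization -/

namespace PT

/-- The complete tree may be too large, but a level is kept only if it has at most as many nodes as
the root has equations, and each of these nodes obeys the bounds of the root. -/
theorem search : PT fun q : ℕ × Node => _root_.search q.1 q.2 := by
  refine (cons (const ()) (fst (snd .id))).foldl
    (f := fun (q : ℕ × Node) st (_ : Unit) => _root_.searchStep q.1 q.2.2 st)
    ((const false).pair ((const false).pair (cons (snd .id) (const []))))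
    (searchStep.comp (pair (pair (fst (fst .id)) (snd (snd (fst .id)))) (fst (snd .id)))) ?_
  obtain ⟨Q, hQ⟩ := (PolyBdd.const (α := ℕ × Node) 9).add ((PolyBdd.size.add (.const 1)).mul
    (((((PolyBdd.const 2).mul .size).add (.const 3)).add (PolyBdd.size.mul
      ((((PolyBdd.const 4).mul .size).add ((PolyBdd.const 4).mul .size)).add (.const 8)))).add
      (.const 1)))
  refine ⟨Q, fun q l₁ _ => le_trans ?_ (hQ q)⟩
  have hs : sz q.2 ≤ sz q := by rw [sz_pair q]; omega
  have key : ∀ (l : List Unit) (st : Bool × Bool × List Node),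
      SearchBdd (sz q.2) (sz q.2) (rowsWeight q.2.2) st →
      SearchBdd (sz q.2) (sz q.2) (rowsWeight q.2.2)
        (l.foldl (fun st _ => _root_.searchStep q.1 q.2.2 st) st) := by
    intro l
    induction l with
    | nil => exact fun st h => h
    | cons x l ih => exact fun st h => ih _ (h.searchStep (nodeBdd_self q.2).length)
  have h1 := (key l₁ (false, false, [q.2])
    ⟨by simp, by simpa using nodeBdd_self q.2⟩).sz_le
  refine h1.trans ?_
  have h2 : (rowsWeight q.2.2).size ≤ sz q :=
    (size_rowsWeight_le _).trans (by rw [sz_pair q, sz_pair q.2]; omega)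
  beta_reduce
  gcongr

/-- The parameter is written in binary, so its unary form may be exponentially long; capping it at
the length of a given list keeps it polynomial. -/
theorem unaryMin {α : Type} [Enc α] {f : α → List Unit} {g : α → ℕ} (hf : PT f) (hg : PT g) :
    PT fun a => _root_.unaryMin (f a) (g a) := by
  refine snd (hf.foldl (f := fun _ (st : ℕ × List Unit) (_ : Unit) =>
    if decide (0 < st.1) = true then (st.1 - 1, () :: st.2) else st) (hg.pair (const [])) ?_ ?_)
  · have hst : PT fun q : α × (ℕ × List Unit) × Unit => q.2.1 := fst (snd .id)
    exact (nat_lt (const 0) hst.fst).ite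
      ((nat_sub hst.fst (const 1)).pair (cons (const ()) hst.snd)) hst
  · obtain ⟨Q, hQ⟩ := (((PolyBdd.const 4).mul hg.sz_bdd).add (.const 3)).add
      ((PolyBdd.const 2).mul hf.sz_bdd)
    refine ⟨Q, fun a l₁ h => le_trans ?_ (hQ a)⟩
    have key : ∀ (l : List Unit) (st : ℕ × List Unit),
        (l.foldl (fun (st : ℕ × List Unit) (_ : Unit) =>
          if decide (0 < st.1) = true then (st.1 - 1, () :: st.2) else st) st).1 ≤ st.1 ∧
        (l.foldl (fun (st : ℕ × List Unit) (_ : Unit) =>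
          if decide (0 < st.1) = true then (st.1 - 1, () :: st.2) else st) st).2.length ≤
          st.2.length + l.length := by
      intro l
      induction l with
      | nil => simp
      | cons x l ih =>
        intro st
        rw [List.foldl_cons]
        split_ifs
        · have := ih (st.1 - 1, () :: st.2)
          simp only [List.length_cons] at this ⊢
          omega
        · have := ih st
          simp only [List.length_cons] at this ⊢
          omega
    obtain ⟨k1, k2⟩ := key l₁ (g a, [])
    have h1 := sz_nat_le (l₁.foldl (fun (st : ℕ × List Unit) (_ : Unit) =>
          if decide (0 < st.1) = true then (st.1 - 1, () :: st.2) else st) (g a, [])).1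
    have h2 := Nat.size_le_size k1
    have h3 := size_le_sz_nat (g a)
    have h4 := h.length_le
    have h5 := length_lt_sz (f a)
    rw [sz_pair, sz_units]
    simp only [List.length_nil] at k2 h2
    beta_reduce
    omega

theorem thresholdList {α : Type} [Enc α] {f : α → List Unit} {g : α → ℕ} (hf : PT f) (hg : PT g) :
    PT fun a => _root_.thresholdList (f a) (g a) :=
  hf.flatMap (f := fun a _ => (f a).flatMap fun _ => (List.replicate 64 ()).flatMap fun _ =>
      (g a).bits) ((hf.comp (fst .id)).flatMap
    (f := fun (q : α × Unit) _ => (List.replicate 64 ()).flatMap fun _ => (g q.1).bits)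
    ((const (List.replicate 64 ())).flatMap (f := fun (q : (α × Unit) × Unit) _ => (g q.1.1).bits)
      (bits (hg.comp (fst (fst (fst .id)))))))

theorem kernelize : PT _root_.kernelize := by
  have hk : PT fun q : Node × ℕ => q.2 := snd .id
  have hkk := nat_add hk hk
  have hnd : PT fun q : Node × ℕ => _root_.normalForm (q.1.1, _root_.merge q.1.2) :=
    normalForm.comp ((fst (fst .id)).pair (merge.comp (snd (fst .id))))
  have hs := search.comp (hkk.pair hnd)
  exact (nat_lt (const 0) hk).ite
    (hs.fst.ite
      (hs.snd.fst.ite (const (([], []), 0))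
        ((length_lt hnd.fst (thresholdList (unaryMin hnd.fst hk) hk)).ite
          ((hnd.snd.any (b := fun (q : Node × ℕ) (r : Row) => !decide (r.2.2 < q.2 + q.2))
            (nat_lt (snd (snd (snd .id))) (hkk.comp (fst .id))).not).ite
            (const (([], []), 0)) (hnd.pair hk))
          (const (([], []), 0))))
      (const (([], []), 1)))
    (const (([], []), 0))

end PT

/-! ### Excess of assignments -/

/-- The value of a linear form at an assignment. -/
def dot : List Bool → (ℕ → Bool) → Bool
  | [], _ => false
  | a :: v, z => Bool.xor (a && z 0) (dot v fun i => z (i + 1))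

/-- The sign of a bit. -/
def sgn (b : Bool) : ℤ := if b = true then -1 else 1

/-- The assignment `z` with `x` inserted at the front. -/
def consVal (x : Bool) (z : ℕ → Bool) : ℕ → Bool
  | 0 => x
  | i + 1 => z i

/-- The signed weights of the equations, summed with coefficients depending on the left-hand
side. -/
def val (G : List Bool → ℤ) (R : List Row) : ℤ :=
  (R.map fun r => G r.1 * (sgn r.2.1 * r.2.2)).sum

/-- The weight of the satisfied equations minus the weight of the falsified equations. -/
def excess (R : List Row) (z : ℕ → Bool) : ℤ := val (fun v => sgn (dot v z)) R

/-- The excess of the equations without variables. -/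
def constVal (R : List Row) : ℤ := val (fun v => if v.any id = true then 0 else 1) R

theorem sgn_xor (a b : Bool) : sgn (Bool.xor a b) = sgn a * sgn b := by
  cases a <;> cases b <;> rfl

theorem dot_headD (v : List Bool) (z : ℕ → Bool) :
    dot v z = Bool.xor (v.headD false && z 0) (dot v.tail fun i => z (i + 1)) := by
  cases v <;> simp [dot]

theorem dot_consVal (v : List Bool) (x : Bool) (z : ℕ → Bool) :
    dot v (consVal x z) = Bool.xor (v.headD false && x) (dot v.tail z) := by
  rw [dot_headD]; rfl

theorem dot_congr {v : List Bool} {z z' : ℕ → Bool} (h : ∀ i < v.length, z i = z' i) :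
    dot v z = dot v z' := by
  induction v generalizing z z' with
  | nil => rfl
  | cons a v ih =>
    rw [dot, dot, h 0 (by simp), ih fun i hi => h (i + 1) (by simpa using hi)]

theorem dot_zero (v : List Bool) : dot v (fun _ => false) = false := by
  induction v with
  | nil => rfl
  | cons a v ih => rw [dot, ih]; simp

theorem dot_append_singleton (v : List Bool) (a : Bool) (z : ℕ → Bool) :
    dot (v ++ [a]) z = Bool.xor (dot v z) (a && z v.length) := by
  induction v generalizing z with
  | nil => simp [dot]
  | cons b v ih => simp [dot, ih]

theorem dot_zipWith_xor {u v : List Bool} (h : u.length = v.length) (z : ℕ → Bool) :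
    dot (List.zipWith Bool.xor u v) z = Bool.xor (dot u z) (dot v z) := by
  induction u generalizing v z with
  | nil => cases v <;> simp_all [dot]
  | cons a u ih =>
    cases v with
    | nil => simp at h
    | cons b v =>
      rw [List.zipWith_cons_cons, dot, dot, dot, ih (by simpa using h)]
      generalize z 0 = x
      generalize dot u _ = p
      generalize dot v _ = q
      cases a <;> cases b <;> cases x <;> cases p <;> cases q <;> rfl

theorem val_append (G : List Bool → ℤ) (R S : List Row) :
    val G (R ++ S) = val G R + val G S := by
  simp [val]

theorem val_one (R : List Row) : val (fun _ => 1) R = posWeight R - negWeight R := by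
  induction R with
  | nil => rfl
  | cons r R ih =>
    obtain ⟨v, b, w⟩ := r
    cases b <;> simp [val, posWeight, negWeight, sgn] at ih ⊢ <;> omega

theorem val_of_forall_eq {G : List Bool → ℤ} {R : List Row} {v : List Bool}
    (h : ∀ r ∈ R, r.1 = v) : val G R = G v * (posWeight R - negWeight R) := by
  rw [← val_one, val, val, ← List.sum_map_mul_left]
  refine congrArg List.sum (List.map_congr_left fun r hr => ?_)
  rw [h r hr]; ring

theorem val_mergeAt (G : List Bool → ℤ) (R : List Row) (v : List Bool) :
    val G (mergeAt R v) = val G (R.filter fun r => r.1 == v) := by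
  rw [val_of_forall_eq (G := G) (R := R.filter fun r => r.1 == v) (v := v)
    (by simp)]
  unfold mergeAt
  simp only [decide_eq_true_eq]
  split_ifs with h1 h2
  · simp [val, sgn, Nat.cast_sub h1.le]
  · simp [val, sgn, Nat.cast_sub h2.le]; ring
  · rw [show posWeight (R.filter fun r => r.1 == v) = negWeight (R.filter fun r => r.1 == v) by
      omega]
    simp [val]

/-- Equations with the same left-hand side enter `val` only through the difference of their weights
for the two right-hand sides, which merging keeps. Leaving `G` arbitrary covers `excess` and
`constVal` at once. -/
theorem val_merge (G : List Bool → ℤ) (R : List Row) : val G (merge R) = val G R := by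
  rw [val.eq_def G R, ← sum_coefVectors R]
  unfold merge
  induction coefVectors R with
  | nil => rfl
  | cons v V ih =>
    rw [List.flatMap_cons, val_append, ih, val_mergeAt, List.map_cons, List.sum_cons, val]

theorem nodup_merge (R : List Row) : ((merge R).map fun r => r.1).Nodup := by
  have h : ((merge R).map fun r => r.1).Sublist (coefVectors R) := by
    unfold merge
    induction coefVectors R with
    | nil => simp
    | cons v V ih =>
      rw [List.flatMap_cons, List.map_append]
      have h1 : ((mergeAt R v).map fun r => r.1).Sublist [v] := by
        unfold mergeAt
        split_ifs <;> simp
      exact h1.append ih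
  exact h.nodup (nodup_coefVectors R)

theorem excess_zero (R : List Row) :
    excess R (fun _ => false) = posWeight R - negWeight R := by
  rw [← val_one, excess]
  simp [dot_zero, sgn]

theorem excessTest_iff {K : ℕ} {R : List Row} :
    excessTest K R = true ↔ (K : ℤ) ≤ excess R fun _ => false := by
  rw [excess_zero]
  simp only [excessTest, Bool.not_eq_true', decide_eq_false_iff_not]
  omega

theorem excess_constRows (R : List Row) : excess (constRows R) (fun _ => false) = constVal R := by
  rw [excess, constVal]
  simp only [dot_zero]
  unfold constRows
  induction R with
  | nil => rfl
  | cons r R ih =>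
    simp only [val, List.filter_cons, List.map_cons, List.sum_cons] at ih ⊢
    rw [← ih]
    cases h : r.1.any id <;> simp [sgn]

theorem nodeTest_iff {K : ℕ} {nd : Node} : nodeTest K nd = true ↔
    (K : ℤ) ≤ excess nd.2 (fun _ => false) ∨ (K : ℤ) ≤ constVal nd.2 := by
  rw [nodeTest, Bool.or_eq_true, excessTest_iff, excessTest_iff, excess_constRows]

theorem excess_substHead (R : List Row) (z : ℕ → Bool) :
    excess (substHead R) z = excess R (consVal true z) := by
  rw [excess, excess, val, val, substHead, List.map_map]
  refine congrArg List.sum (List.map_congr_left fun r _ => ?_)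
  simp only [Function.comp, dot_consVal, sgn_xor, Bool.and_true]
  ring

/-- Some assignment has at least average excess. -/
theorem exists_constVal_le_excess (R : List Row) : ∃ z, constVal R ≤ excess R z := by
  obtain ⟨n, hn⟩ : ∃ n, ∀ r ∈ R, r.1.length ≤ n :=
    ⟨(R.map fun r => r.1.length).sum, fun r hr => List.le_sum_of_mem
      (List.mem_map.2 ⟨r, hr, rfl⟩)⟩
  induction n generalizing R with
  | zero =>
    refine ⟨fun _ => false, le_of_eq ?_⟩
    rw [constVal, excess, val, val]
    refine congrArg List.sum (List.map_congr_left fun r hr => ?_)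
    have : r.1 = [] := List.length_eq_zero_iff.1 (Nat.le_zero.1 (hn r hr))
    simp [this, dot, sgn]
  | succ n ih =>
    let R₀ : List Row := R.map fun r => (r.1.tail, r.2)
    have h0 : ∀ z, excess R₀ z = excess R (consVal false z) := fun z => by
      rw [excess, excess, val, val, List.map_map]
      refine congrArg List.sum (List.map_congr_left fun r _ => ?_)
      simp [dot_consVal]
    obtain ⟨z₀, hz₀⟩ := ih R₀ fun r hr => by
      obtain ⟨s, hs, rfl⟩ := List.mem_map.1 hr
      have := hn s hs
      simp; omega
    obtain ⟨z₁, hz₁⟩ := ih (substHead R) fun r hr => by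
      obtain ⟨s, hs, rfl⟩ := List.mem_map.1 hr
      have := hn s hs
      simp; omega
    -- The average is the mean of the averages over the two values of the first variable: an
    -- equation in that variable alone becomes constant with opposite signs in the two branches and
    -- cancels. The better branch is followed, by induction on the number of variables.
    have key : constVal R₀ + constVal (substHead R) = 2 * constVal R := by
      clear ih h0 hn hz₀ hz₁
      simp only [R₀]
      induction R with
      | nil => rfl
      | cons r R ih =>
        simp only [constVal, val, substHead, List.map_cons, List.sum_cons] at ih ⊢
        obtain ⟨v, b, w⟩ := r
        suffices h : (if v.tail.any id = true then (0 : ℤ) else 1) * (sgn b * w) +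
            (if v.tail.any id = true then (0 : ℤ) else 1) *
              (sgn (Bool.xor b (v.headD false)) * w) =
            2 * ((if v.any id = true then (0 : ℤ) else 1) * (sgn b * w)) by
          linear_combination ih + h
        cases v with
        | nil => simp; ring
        | cons a v =>
          simp only [List.tail_cons, List.headD_cons, List.any_cons, sgn_xor]
          cases a <;> simp [sgn] <;> split_ifs <;> ring
    rw [h0] at hz₀
    rw [excess_substHead] at hz₁
    by_cases h : constVal R ≤ constVal R₀
    · exact ⟨_, h.trans hz₀⟩
    · exact ⟨_, le_trans (by omega) hz₁⟩

/-! ### The change of variables -/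

/-- Whether an equation in old and new variables fails. -/
def mixedFails (s : MixedRow) (z y : ℕ → Bool) : Bool :=
  Bool.xor (Bool.xor (dot s.1 z) (dot s.2.1 y)) s.2.2.1

/-- The excess of a system in old and new variables. -/
def mixedExcess (R : List MixedRow) (p : (ℕ → Bool) × (ℕ → Bool)) : ℤ :=
  (R.map fun s => sgn (mixedFails s p.1 p.2) * (s.2.2.2 : ℤ)).sum

/-- The excess of the equations without variables. -/
def mixedConst (R : List MixedRow) : ℤ :=
  (R.map fun s => (if (s.1.any id || s.2.1.any id) = true then 0 else 1) *
    (sgn s.2.2.1 * (s.2.2.2 : ℤ))).sum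

/-- The `i`-th unit vector. -/
def unitVec (n i : ℕ) : List Bool := (List.range n).map fun j => decide (j = i)

theorem length_unitVec (n i : ℕ) : (unitVec n i).length = n := by simp [unitVec]

theorem unitVec_succ_succ (n i : ℕ) : unitVec (n + 1) (i + 1) = false :: unitVec n i := by
  simp [unitVec, List.range_succ_eq_map]

theorem unitVec_succ_zero (n : ℕ) : unitVec (n + 1) 0 = true :: List.replicate n false := by
  simp [unitVec, List.range_succ_eq_map, List.eq_replicate_iff]

theorem zipWith_xor_self (v : List Bool) :
    List.zipWith Bool.xor v v = List.replicate v.length false := by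
  induction v with
  | nil => rfl
  | cons a v ih => simp [List.replicate_succ]

theorem zipWith_xor_cancel {u v w : List Bool} (hu : u.length = w.length)
    (hv : v.length = w.length) (h : List.zipWith Bool.xor u w = List.zipWith Bool.xor v w) :
    u = v := by
  induction w generalizing u v with
  | nil => simp_all
  | cons c w ih =>
    cases u with
    | nil => simp at hu
    | cons a u =>
      cases v with
      | nil => simp at hv
      | cons b v =>
        simp only [List.zipWith_cons_cons, List.cons.injEq, List.length_cons,
          Nat.add_right_cancel_iff] at hu hv h
        rw [ih hu hv h.2]
        have := h.1
        cases a <;> cases b <;> cases c <;> simp_all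

/-- The properties preserved by the elimination of old variables. -/
structure MixedWF (A : ℕ) (st : List Unit × List MixedRow) : Prop where
  old : ∀ s ∈ st.2, s.1.length = A
  new : ∀ s ∈ st.2, s.2.1.length = st.1.length
  nodup : (st.2.map fun s => (s.1, s.2.1)).Nodup
  unit : ∀ i < st.1.length, ∃ w,
    (List.replicate A false, unitVec st.1.length i, true, w) ∈ st.2

/-- Adding the pivot equation `r` to `s` removes the first old variable. The correction is the
failure bit of `r`, which is the new variable plus one; hence the new coefficient `true` and the
negated right-hand side of `r` in `elimHead`. -/
theorem mixedFails_elimHead {r s : MixedRow} {z y : ℕ → Bool} (hr : r.1.headD false = true)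
    (h1 : s.1.length = r.1.length) (h2 : s.2.1.length = r.2.1.length) :
    mixedFails (elimHead r s) (fun i => z (i + 1)) (consVal (!mixedFails r z y) y) =
      mixedFails s z y := by
  unfold elimHead
  split_ifs with h
  · simp only [mixedFails, dot_consVal, List.headD_cons, List.tail_cons]
    rw [dot_zipWith_xor (by simp [h1]), dot_zipWith_xor h2, dot_headD r.1, dot_headD s.1, hr, h]
    generalize dot s.1.tail _ = a₁
    generalize dot r.1.tail _ = a₂
    generalize dot s.2.1 _ = a₃
    generalize dot r.2.1 _ = a₄
    generalize r.2.2.1 = a₅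
    generalize s.2.2.1 = a₆
    generalize z 0 = a₇
    revert a₁ a₂ a₃ a₄ a₅ a₆ a₇
    decide
  · simp only [mixedFails, dot_consVal, List.headD_cons, List.tail_cons, dot_headD s.1]
    simp only [Bool.not_eq_true] at h
    simp only [h, Bool.false_and, Bool.false_xor]

/-- An equation altered by the pivot contains the first old variable before the step and the new
variable after it. So equations without variables neither arise nor change, and `constVal` is
preserved. -/
theorem elimHead_zero_iff {r s : MixedRow} :
    ((elimHead r s).1.any id || (elimHead r s).2.1.any id) = (s.1.any id || s.2.1.any id) ∧
    ((s.1.any id || s.2.1.any id) = false → (elimHead r s).2.2 = s.2.2) := by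
  unfold elimHead
  split_ifs with h
  · obtain ⟨v, c, b, w⟩ := s
    cases v <;> simp_all
  · obtain ⟨v, c, b, w⟩ := s
    cases v with
    | nil => simp
    | cons a v => simp only [List.headD_cons, Bool.not_eq_true] at h; subst h; simp

theorem elimHead_weight (r s : MixedRow) : (elimHead r s).2.2.2 = s.2.2.2 := by
  unfold elimHead; split_ifs <;> rfl

theorem pivots_cases (R : List MixedRow) :
    ((pivots R).isEmpty = true ∧ ∀ s ∈ R, s.1.headD false = false) ∨
    ((pivots R).isEmpty = false ∧ (pivots R).headD ([], [], false, 0) ∈ R ∧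
      ((pivots R).headD ([], [], false, 0)).1.headD false = true) := by
  rcases h : pivots R with _ | ⟨r, l⟩
  · refine Or.inl ⟨rfl, fun s hs => ?_⟩
    simpa using List.filter_eq_nil_iff.1 h s hs
  · have : r ∈ pivots R := by rw [h]; simp
    obtain ⟨h1, h2⟩ := List.mem_filter.1 this
    exact Or.inr ⟨rfl, h1, h2⟩

theorem mixedConst_elimStep (st : List Unit × List MixedRow) :
    mixedConst (elimStep st).2 = mixedConst st.2 := by
  unfold elimStep mixedConst
  rcases pivots_cases st.2 with ⟨h1, h2⟩ | ⟨h1, -, -⟩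
  · rw [if_pos h1, List.map_map]
    refine congrArg List.sum (List.map_congr_left fun s hs => ?_)
    have := h2 s hs
    obtain ⟨v, c, b, w⟩ := s
    cases v with
    | nil => simp
    | cons a v => simp only [List.headD_cons] at this; subst this; simp; rfl
  · rw [if_neg (by simp [h1]), List.map_map]
    refine congrArg List.sum (List.map_congr_left fun s hs => ?_)
    obtain ⟨h3, h4⟩ := elimHead_zero_iff (r := (pivots st.2).headD ([], [], false, 0)) (s := s)
    simp only [Function.comp, h3]
    split_ifs with h5
    · simp
    · rw [h4 (by simpa using h5)]

/-- Without a pivot the first old variable occurs nowhere and may be dropped. With a pivot `r`, that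
variable is traded for the truth value of `r`; every value can be attained because `r` can be solved
for the variable. -/
theorem range_mixedExcess_elimStep {A : ℕ} {st : List Unit × List MixedRow}
    (h : MixedWF (A + 1) st) :
    Set.range (mixedExcess (elimStep st).2) = Set.range (mixedExcess st.2) := by
  unfold elimStep
  rcases pivots_cases st.2 with ⟨h1, h2⟩ | ⟨h1, h2, h3⟩
  · rw [if_pos h1]
    have key : ∀ z y, mixedExcess (st.2.map fun s => (s.1.tail, s.2)) (fun i => z (i + 1), y) =
        mixedExcess st.2 (z, y) := fun z y => by
      rw [mixedExcess, mixedExcess, List.map_map]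
      refine congrArg List.sum (List.map_congr_left fun s hs => ?_)
      simp only [Function.comp, mixedFails, dot_headD s.1 z, h2 s hs, Bool.false_and,
        Bool.false_xor]
    ext x
    constructor
    · rintro ⟨⟨z, y⟩, rfl⟩
      exact ⟨(consVal false z, y), (key (consVal false z) y).symm⟩
    · rintro ⟨⟨z, y⟩, rfl⟩
      exact ⟨_, key z y⟩
  · rw [if_neg (by simp [h1])]
    set r := (pivots st.2).headD ([], [], false, 0)
    have key : ∀ z y, mixedExcess (st.2.map (elimHead r))
        (fun i => z (i + 1), consVal (!mixedFails r z y) y) = mixedExcess st.2 (z, y) := by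
      intro z y
      rw [mixedExcess, mixedExcess, List.map_map]
      refine congrArg List.sum (List.map_congr_left fun s hs => ?_)
      simp only [Function.comp, elimHead_weight]
      rw [mixedFails_elimHead h3 ((h.old s hs).trans (h.old r h2).symm)
        ((h.new s hs).trans (h.new r h2).symm)]
    ext x
    constructor
    · rintro ⟨⟨z, y⟩, rfl⟩
      -- This value of the first old variable makes the truth value of `r` equal to the prescribed
      -- `y 0`: flipping the variable flips `r`.
      have h4 : mixedFails r (consVal (Bool.xor (mixedFails r (consVal false z) fun i => y (i + 1))
          (!y 0)) z) (fun i => y (i + 1)) = !y 0 := by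
        simp only [mixedFails, dot_consVal, h3]
        generalize dot r.1.tail _ = a₁
        generalize dot r.2.1 _ = a₂
        generalize r.2.2.1 = a₃
        generalize y 0 = a₄
        revert a₁ a₂ a₃ a₄
        decide
      refine ⟨(_, _), (key (consVal (Bool.xor (mixedFails r (consVal false z) fun i => y (i + 1))
          (!y 0)) z) (fun i => y (i + 1))).symm.trans ?_⟩
      rw [h4]
      congr 2
      funext i
      cases i <;> simp [consVal]
    · rintro ⟨⟨z, y⟩, rfl⟩
      exact ⟨_, key z y⟩

/-- Left-hand sides stay distinct: the new coefficient tells which equations were altered, and all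
altered ones are shifted by the same vector, that of `r`. Added to itself, `r` becomes the equation
of the new variable, while the earlier unit equations have no old variables left and are only
shifted by one place. -/
theorem MixedWF.elimStep {A : ℕ} {st : List Unit × List MixedRow} (h : MixedWF (A + 1) st) :
    MixedWF A (elimStep st) := by
  unfold _root_.elimStep
  rcases pivots_cases st.2 with ⟨h1, h2⟩ | ⟨h1, h2, h3⟩
  · rw [if_pos h1]
    refine ⟨?_, ?_, ?_, fun i hi => ?_⟩
    · simp only [List.mem_map]; rintro _ ⟨s, hs, rfl⟩
      simp [h.old s hs]
    · simp only [List.mem_map]; rintro _ ⟨s, hs, rfl⟩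
      exact h.new s hs
    · have h3 := h.nodup
      rw [List.map_map]
      refine (List.nodup_map_iff_inj_on (h3.of_map _)).2 fun s hs t ht hst => ?_
      refine List.inj_on_of_nodup_map h3 hs ht ?_
      have h4 := h2 s hs
      have h5 := h2 t ht
      have h6 := h.old s hs
      have h7 := h.old t ht
      obtain ⟨_ | ⟨a, v⟩, c, b, w⟩ := s
      · simp at h6
      obtain ⟨_ | ⟨a', v'⟩, c', b', w'⟩ := t
      · simp at h7
      simp_all
    · obtain ⟨w, hw⟩ := h.unit i hi
      exact ⟨w, List.mem_map.2 ⟨_, hw, by simp [List.replicate_succ]⟩⟩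
  · rw [if_neg (by simp [h1])]
    set r := (pivots st.2).headD ([], [], false, 0)
    have hro := h.old r h2
    have hrn := h.new r h2
    refine ⟨?_, ?_, ?_, fun i hi => ?_⟩
    · simp only [List.mem_map]; rintro _ ⟨s, hs, rfl⟩
      have := h.old s hs
      unfold elimHead; split_ifs <;> simp [this, hro]
    · simp only [List.mem_map]; rintro _ ⟨s, hs, rfl⟩
      have := h.new s hs
      unfold elimHead; split_ifs <;> simp [this, hrn]
    · have h4 := h.nodup
      rw [List.map_map]
      refine (List.nodup_map_iff_inj_on (h4.of_map _)).2 fun s hs t ht hst => ?_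
      refine List.inj_on_of_nodup_map h4 hs ht ?_
      have h6 := h.old s hs
      have h7 := h.old t ht
      have h8 := h.new s hs
      have h9 := h.new t ht
      obtain ⟨_ | ⟨a, v⟩, c, b, w⟩ := s
      · simp at h6
      obtain ⟨_ | ⟨a', v'⟩, c', b', w'⟩ := t
      · simp at h7
      simp only [List.length_cons, Nat.add_right_cancel_iff] at h6 h7 h8 h9
      simp only [Function.comp, elimHead, List.headD_cons, List.tail_cons] at hst
      cases a <;> cases a' <;> simp at hst
      · simp [hst]
      · rw [zipWith_xor_cancel (by simp [h6, hro]) (by simp [h7, hro]) hst.1,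
          zipWith_xor_cancel (h8.trans hrn.symm) (h9.trans hrn.symm) hst.2]
    · cases i with
      | zero =>
        refine ⟨r.2.2.2, List.mem_map.2 ⟨r, h2, ?_⟩⟩
        rw [elimHead, if_pos h3, zipWith_xor_self, zipWith_xor_self, List.length_cons,
          unitVec_succ_zero, hrn, List.length_tail, hro]
        simp
      | succ i =>
        obtain ⟨w, hw⟩ := h.unit i (by simpa using hi)
        refine ⟨w, List.mem_map.2 ⟨_, hw, ?_⟩⟩
        rw [elimHead, if_neg (by simp [List.replicate_succ]), List.length_cons, unitVec_succ_succ]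
        simp

/-! ### Systems in normal form and the correctness of the search -/

/-- The shape of systems in normal form: all left-hand sides are different, and every variable is a
left-hand side, in an equation that fails at the origin. -/
structure RowsWF (n : ℕ) (R : List Row) : Prop where
  length : ∀ r ∈ R, r.1.length = n
  nodup : (R.map fun r => r.1).Nodup
  unit : ∀ i < n, ∃ w, (unitVec n i, true, w) ∈ R
  weight_pos : ∀ r ∈ R, 0 < r.2.2

theorem elimStep_foldl {A : ℕ} {l : List Unit} (hl : l.length = A)
    {st : List Unit × List MixedRow} (h : MixedWF A st) :
    MixedWF 0 (l.foldl (fun st _ => elimStep st) st) ∧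
    Set.range (mixedExcess (l.foldl (fun st _ => elimStep st) st).2) =
      Set.range (mixedExcess st.2) ∧
    mixedConst (l.foldl (fun st _ => elimStep st) st).2 = mixedConst st.2 := by
  induction l generalizing A st with
  | nil => subst hl; exact ⟨h, rfl, rfl⟩
  | cons x l ih =>
    subst hl
    obtain ⟨h1, h2, h3⟩ := ih rfl h.elimStep
    exact ⟨h1, h2.trans (range_mixedExcess_elimStep h), h3.trans (mixedConst_elimStep st)⟩

theorem mixedWF_init {nd : Node} (hlen : ∀ r ∈ nd.2, r.1.length = nd.1.length)
    (hnd : (nd.2.map fun r => r.1).Nodup) :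
    MixedWF nd.1.length ([], nd.2.map fun r => (r.1, [], r.2)) := by
  refine ⟨?_, ?_, ?_, by simp⟩
  · simp only [List.mem_map]; rintro _ ⟨r, hr, rfl⟩; exact hlen r hr
  · simp only [List.mem_map]; rintro _ ⟨r, hr, rfl⟩; rfl
  · have : (fun s : MixedRow => (s.1, s.2.1)) ∘ (fun r : Row => (r.1, ([] : List Bool), r.2)) =
        (fun v => (v, ([] : List Bool))) ∘ fun r : Row => r.1 := rfl
    rw [List.map_map, this, ← List.map_map]
    exact hnd.map fun v w h => congrArg Prod.fst h

theorem mixedWF_elimAll {nd : Node} (hlen : ∀ r ∈ nd.2, r.1.length = nd.1.length)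
    (hnd : (nd.2.map fun r => r.1).Nodup) : MixedWF 0 (elimAll nd) :=
  (elimStep_foldl rfl (mixedWF_init hlen hnd)).1

theorem normalForm_wf {nd : Node} (hlen : ∀ r ∈ nd.2, r.1.length = nd.1.length)
    (hnd : (nd.2.map fun r => r.1).Nodup) (hpos : ∀ r ∈ nd.2, 0 < r.2.2) :
    RowsWF (normalForm nd).1.length (normalForm nd).2 := by
  have h := mixedWF_elimAll hlen hnd
  refine ⟨?_, ?_, fun i hi => ?_, ?_⟩
  · simp only [normalForm, List.mem_map]
    rintro _ ⟨s, hs, rfl⟩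
    exact h.new s hs
  · have h1 := h.nodup
    simp only [normalForm, List.map_map]
    refine (List.nodup_map_iff_inj_on (h1.of_map _)).2 fun s hs t ht hst => ?_
    refine List.inj_on_of_nodup_map h1 hs ht (Prod.ext ?_ hst)
    simp only
    rw [List.length_eq_zero_iff.1 (h.old s hs), List.length_eq_zero_iff.1 (h.old t ht)]
  · obtain ⟨w, hw⟩ := h.unit i hi
    exact ⟨w, List.mem_map.2 ⟨_, hw, rfl⟩⟩
  · simp only [normalForm, List.mem_map]
    rintro _ ⟨s, hs, rfl⟩
    have h1 : s.2.2.2 ∈ (elimAll nd).2.map fun s => s.2.2.2 := List.mem_map.2 ⟨s, hs, rfl⟩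
    rw [elimAll_weights] at h1
    obtain ⟨r, hr, h2⟩ := List.mem_map.1 h1
    rw [← h2]
    exact hpos r hr

/-- Assignments before and after are not matched one to one, as dropped variables are free;
therefore only the sets of attained values are compared. -/
theorem range_excess_normalForm {nd : Node} (hlen : ∀ r ∈ nd.2, r.1.length = nd.1.length)
    (hnd : (nd.2.map fun r => r.1).Nodup) :
    Set.range (excess (normalForm nd).2) = Set.range (excess nd.2) := by
  have h := (elimStep_foldl rfl (mixedWF_init hlen hnd)).2.1
  change Set.range (mixedExcess (elimAll nd).2) = _ at h
  have hwf := mixedWF_elimAll hlen hnd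
  have h1 : ∀ p, mixedExcess (elimAll nd).2 p = excess (normalForm nd).2 p.2 := fun p => by
    rw [mixedExcess, excess, val, normalForm, List.map_map]
    refine congrArg List.sum (List.map_congr_left fun s hs => ?_)
    have : s.1 = [] := List.length_eq_zero_iff.1 (hwf.old s hs)
    simp only [Function.comp, mixedFails, this, dot, Bool.false_xor, sgn_xor]
    ring
  have h2 : ∀ p, mixedExcess (nd.2.map fun r => (r.1, [], r.2)) p = excess nd.2 p.1 := fun p => by
    rw [mixedExcess, excess, val, List.map_map]
    refine congrArg List.sum (List.map_congr_left fun s hs => ?_)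
    simp only [Function.comp, mixedFails, dot, Bool.xor_false, sgn_xor]
    ring
  ext x
  have h3 := Set.ext_iff.1 h x
  constructor
  · rintro ⟨y, rfl⟩
    obtain ⟨p, hp⟩ := h3.1 ⟨(y, y), h1 (y, y)⟩
    exact ⟨p.1, (h2 p).symm.trans hp⟩
  · rintro ⟨z, rfl⟩
    obtain ⟨p, hp⟩ := h3.2 ⟨(z, z), h2 (z, z)⟩
    exact ⟨p.2, (h1 p).symm.trans hp⟩

theorem constVal_normalForm {nd : Node} (hlen : ∀ r ∈ nd.2, r.1.length = nd.1.length)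
    (hnd : (nd.2.map fun r => r.1).Nodup) : constVal (normalForm nd).2 = constVal nd.2 := by
  have h := (elimStep_foldl rfl (mixedWF_init hlen hnd)).2.2
  change mixedConst (elimAll nd).2 = _ at h
  have hwf := mixedWF_elimAll hlen hnd
  rw [mixedConst, mixedConst, List.map_map] at h
  rw [constVal, constVal, val, val, normalForm, List.map_map]
  refine Eq.trans ?_ (h.trans ?_)
  · refine congrArg List.sum (List.map_congr_left fun s hs => ?_)
    have : s.1 = [] := List.length_eq_zero_iff.1 (hwf.old s hs)
    simp [this]
  · refine congrArg List.sum (List.map_congr_left fun s hs => ?_)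
    simp

theorem length_normalForm_fst_le (nd : Node) : (normalForm nd).1.length ≤ nd.1.length := by
  obtain ⟨A, B, M, h⟩ := mixedBdd_elimAll nd
  exact h.count

/-- Vectors that are nonzero stay so under the change of variables. -/
theorem any_normalForm {nd : Node} (hlen : ∀ r ∈ nd.2, r.1.length = nd.1.length)
    (hnd : (nd.2.map fun r => r.1).Nodup) (h0 : ∀ r ∈ nd.2, r.1.any id = true) :
    ∀ r ∈ (normalForm nd).2, r.1.any id = true := by
  have key : ∀ (l : List Unit) (st : List Unit × List MixedRow),
      (∀ s ∈ st.2, (s.1.any id || s.2.1.any id) = true) →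
      ∀ s ∈ (l.foldl (fun st _ => elimStep st) st).2, (s.1.any id || s.2.1.any id) = true := by
    intro l
    induction l with
    | nil => exact fun st h => h
    | cons x l ih =>
      intro st h
      refine ih _ ?_
      change ∀ s ∈ (elimStep st).2, _
      unfold elimStep
      rcases pivots_cases st.2 with ⟨h1, h2⟩ | ⟨h1, -, -⟩
      · rw [if_pos h1]
        simp only [List.mem_map]
        rintro _ ⟨s, hs, rfl⟩
        rw [← h s hs]
        have := h2 s hs
        obtain ⟨v, c, b, w⟩ := s
        cases v with
        | nil => rfl
        | cons a v => simp only [List.headD_cons] at this; subst this; rfl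
      · rw [if_neg (by simp [h1])]
        simp only [List.mem_map]
        rintro _ ⟨s, hs, rfl⟩
        rw [elimHead_zero_iff.1, h s hs]
  have hwf := mixedWF_elimAll hlen hnd
  simp only [normalForm, List.mem_map]
  rintro _ ⟨s, hs, rfl⟩
  have h1 := key nd.1 ([], nd.2.map fun r : Row => (r.1, [], r.2)) (by
    simp only [List.mem_map]
    rintro _ ⟨r, hr, rfl⟩
    simp only [h0 r hr, Bool.true_or]) s hs
  rw [List.length_eq_zero_iff.1 (hwf.old s hs)] at h1
  simpa using h1

/-! #### Rotation -/

theorem rotateVars_eq {n : ℕ} {R : List Row} (h : ∀ r ∈ R, r.1.length = n + 1) :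
    rotateVars R = R.map fun r => (r.1.tail ++ [r.1.headD false], r.2) := by
  refine List.map_congr_left fun r hr => ?_
  have := h r hr
  obtain ⟨_ | ⟨a, v⟩, s⟩ := r
  · simp at this
  · simp

theorem length_rotateVars {n : ℕ} {R : List Row} (h : ∀ r ∈ R, r.1.length = n + 1) :
    ∀ r ∈ rotateVars R, r.1.length = n + 1 := by
  rw [rotateVars_eq h]
  simp only [List.mem_map]
  rintro _ ⟨r, hr, rfl⟩
  simp [h r hr]

theorem excess_rotateVars {n : ℕ} {R : List Row} (h : ∀ r ∈ R, r.1.length = n + 1)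
    (z : ℕ → Bool) : excess (rotateVars R) z = excess R (consVal (z n) z) := by
  rw [rotateVars_eq h, excess, excess, val, val, List.map_map]
  refine congrArg List.sum (List.map_congr_left fun r hr => ?_)
  simp only [Function.comp, dot_append_singleton, dot_consVal, List.length_tail, h r hr,
    Nat.add_sub_cancel]
  rw [Bool.xor_comm]

theorem constVal_rotateVars (R : List Row) : constVal (rotateVars R) = constVal R := by
  rw [constVal, constVal, val, val, rotateVars, List.map_map]
  refine congrArg List.sum (List.map_congr_left fun r hr => ?_)
  obtain ⟨_ | ⟨a, v⟩, s⟩ := r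
  · rfl
  · simp [or_comm]

theorem excess_congr {n : ℕ} {R : List Row} (h : ∀ r ∈ R, r.1.length = n) {z z' : ℕ → Bool}
    (hz : ∀ i < n, z i = z' i) : excess R z = excess R z' := by
  rw [excess, excess, val, val]
  refine congrArg List.sum (List.map_congr_left fun r hr => ?_)
  rw [dot_congr fun i hi => hz i (by rwa [h r hr] at hi)]

theorem tail_unitVec_append {n i : ℕ} (hi : i < n + 1) :
    ∃ j < n + 1, (unitVec (n + 1) j).tail ++ [(unitVec (n + 1) j).headD false] =
      unitVec (n + 1) i := by
  rcases Nat.lt_succ_iff_lt_or_eq.1 hi with h | rfl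
  · refine ⟨i + 1, by omega, ?_⟩
    rw [unitVec_succ_succ, unitVec, unitVec, List.range_succ]
    simp; omega
  · refine ⟨0, by omega, ?_⟩
    rw [unitVec_succ_zero, unitVec, List.range_succ, List.map_append, List.tail_cons,
      List.headD_cons]
    congr 1
    · symm
      simp only [List.eq_replicate_iff, List.length_map, List.length_range, List.mem_map,
        List.mem_range, true_and]
      rintro _ ⟨j, hj, rfl⟩
      simp; omega
    · simp

theorem RowsWF.rotateVars {n : ℕ} {R : List Row} (h : RowsWF (n + 1) R) :
    RowsWF (n + 1) (rotateVars R) := by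
  refine ⟨length_rotateVars h.length, ?_, fun i hi => ?_, ?_⟩
  · have h1 := h.nodup
    rw [rotateVars_eq h.length, List.map_map]
    refine (List.nodup_map_iff_inj_on (h1.of_map _)).2 fun s hs t ht hst => ?_
    refine List.inj_on_of_nodup_map h1 hs ht ?_
    have h2 := h.length s hs
    have h3 := h.length t ht
    obtain ⟨_ | ⟨a, v⟩, s⟩ := s
    · simp at h2
    obtain ⟨_ | ⟨b, u⟩, t⟩ := t
    · simp at h3
    simp only [Function.comp, List.tail_cons, List.headD_cons] at hst
    obtain ⟨h4, h5⟩ := List.append_inj' hst rfl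
    simp_all
  · obtain ⟨j, hj, hji⟩ := tail_unitVec_append hi
    obtain ⟨w, hw⟩ := h.unit j hj
    rw [rotateVars_eq h.length]
    exact ⟨w, List.mem_map.2 ⟨_, hw, by simp only [hji]⟩⟩
  · simp only [_root_.rotateVars, List.mem_map]
    rintro _ ⟨r, hr, rfl⟩
    exact h.weight_pos r hr

theorem RowsWF.rotateVars_iterate {n : ℕ} {R : List Row} (h : RowsWF (n + 1) R) (i : ℕ) :
    RowsWF (n + 1) (_root_.rotateVars^[i] R) := by
  induction i with
  | zero => exact h
  | succ i ih => rw [Function.iterate_succ_apply']; exact ih.rotateVars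

theorem constVal_rotateVars_iterate (R : List Row) (i : ℕ) :
    constVal (rotateVars^[i] R) = constVal R := by
  induction i with
  | zero => rfl
  | succ i ih => rw [Function.iterate_succ_apply', constVal_rotateVars, ih]

theorem range_excess_rotateVars_iterate {n : ℕ} {R : List Row}
    (h : ∀ r ∈ R, r.1.length = n + 1) (i : ℕ) :
    Set.range (excess (rotateVars^[i] R)) ⊆ Set.range (excess R) := by
  induction i generalizing R with
  | zero => exact subset_rfl
  | succ i ih =>
    rw [Function.iterate_succ_apply]
    refine (ih (length_rotateVars h)).trans ?_
    rintro _ ⟨z, rfl⟩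
    exact ⟨_, (excess_rotateVars h z).symm⟩

theorem exists_excess_rotateVars_iterate {n i : ℕ} {R : List Row}
    (h : ∀ r ∈ R, r.1.length = n + 1) (hi : i < n + 1) {z : ℕ → Bool} (hz : z i = true) :
    ∃ z', z' 0 = true ∧ excess (rotateVars^[i] R) z' = excess R z := by
  induction i generalizing R z with
  | zero => exact ⟨z, hz, rfl⟩
  | succ i ih =>
    -- The assignment is shifted cyclically along with the variables, so that the true entry moves
    -- from place `i + 1` to place `i`.
    let z₁ : ℕ → Bool := fun j => if j = n then z 0 else z (j + 1)
    obtain ⟨z', h1, h2⟩ := ih (length_rotateVars h) (by omega) (z := z₁)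
      (by simp only [z₁]; rw [if_neg (by omega), hz])
    refine ⟨z', h1, ?_⟩
    rw [Function.iterate_succ_apply, h2, excess_rotateVars h]
    refine excess_congr h fun j hj => ?_
    cases j with
    | zero => simp [consVal, z₁]
    | succ j => simp only [consVal, z₁]; rw [if_neg (by omega)]

/-! #### Branching -/

/-- The equation of the first variable turns into a satisfied constant of weight at least one. Any
other equation that becomes constant would have the same left-hand side, the first unit vector,
which distinctness excludes. -/
theorem constVal_substHead {n : ℕ} {R : List Row} (h : RowsWF (n + 1) R) :
    constVal R + 1 ≤ constVal (substHead R) := by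
  obtain ⟨w, hw⟩ := h.unit 0 (by omega)
  have hwpos := h.weight_pos _ hw
  obtain ⟨R₁, R₂, rfl⟩ := List.append_of_mem hw
  have hnd := h.nodup
  have hlen := h.length
  rw [List.map_append, List.map_cons, List.nodup_middle] at hnd
  have hne : ∀ r ∈ R₁ ++ R₂, r.1 ≠ unitVec (n + 1) 0 := fun r hr he => by
    refine (List.nodup_cons.1 hnd).1 ?_
    rw [← List.map_append]
    exact List.mem_map.2 ⟨r, hr, he⟩
  have key : ∀ S : List Row, (∀ r ∈ S, r.1.length = n + 1 ∧ r.1 ≠ unitVec (n + 1) 0) →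
      constVal (substHead S) = constVal S := by
    intro S hS
    rw [constVal, constVal, val, val, substHead, List.map_map]
    refine congrArg List.sum (List.map_congr_left fun r hr => ?_)
    obtain ⟨h1, h2⟩ := hS r hr
    obtain ⟨_ | ⟨a, v⟩, b, w⟩ := r
    · simp at h1
    cases a
    · simp
    · have : ∃ b ∈ v, b = true := by
        by_contra hcon
        push Not at hcon
        refine h2 ?_
        rw [unitVec_succ_zero]
        simp only [List.cons.injEq, true_and, List.eq_replicate_iff]
        exact ⟨by simpa using h1, fun b hb => by simpa using hcon b hb⟩
      obtain ⟨b, hb, rfl⟩ := this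
      simp [hb]
  have k1 := key R₁ fun r hr => ⟨hlen r (by simp [hr]), hne r (by simp [hr])⟩
  have k2 := key R₂ fun r hr => ⟨hlen r (by simp [hr]), hne r (by simp [hr])⟩
  have e1 : substHead (R₁ ++ (unitVec (n + 1) 0, true, w) :: R₂) =
      substHead R₁ ++ ([(List.replicate n false, false, w)] ++ substHead R₂) := by
    simp [substHead, unitVec_succ_zero]
  have e2 : R₁ ++ (unitVec (n + 1) 0, true, w) :: R₂ =
      R₁ ++ ([(unitVec (n + 1) 0, true, w)] ++ R₂) := rfl
  rw [e1, e2]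
  unfold constVal at k1 k2 ⊢
  simp only [val_append, k1, k2]
  have e3 : (List.replicate n false).any id = false := by simp
  simp only [val, List.map_cons, List.map_nil, List.sum_cons, List.sum_nil, unitVec_succ_zero, e3]
  simp [sgn]
  omega

theorem length_merge_substHead {n : ℕ} {R : List Row} (h : ∀ r ∈ R, r.1.length = n + 1) :
    ∀ r ∈ merge (substHead R), r.1.length = n := by
  intro r hr
  obtain ⟨⟨s, hs, hsr⟩, -⟩ := mem_merge hr
  obtain ⟨t, ht, rfl⟩ := List.mem_map.1 hs
  rw [← hsr]
  simp [h t ht]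

theorem child_spec {n : ℕ} {u : List Unit} {R : List Row} (hu : u.length = n + 1)
    (h : RowsWF (n + 1) R) :
    RowsWF (child (u, R)).1.length (child (u, R)).2 ∧
    (child (u, R)).1.length ≤ n ∧ constVal R + 1 ≤ constVal (child (u, R)).2 ∧
    Set.range (excess (child (u, R)).2) = Set.range (excess (substHead R)) := by
  have hlen := length_merge_substHead h.length
  rw [show n = u.tail.length by simp [hu]] at hlen
  have hnd := nodup_merge (substHead R)
  refine ⟨normalForm_wf hlen hnd fun r hr => (mem_merge hr).2, ?_, ?_, ?_⟩
  · refine (length_normalForm_fst_le _).trans ?_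
    simp [hu]
  · rw [child, constVal_normalForm hlen hnd]
    refine (constVal_substHead h).trans (le_of_eq ?_)
    exact (val_merge _ _).symm
  · rw [child, range_excess_normalForm hlen hnd]
    congr 1
    funext z
    exact val_merge _ _

theorem children_spec {nd c : Node} (h : RowsWF nd.1.length nd.2) (hc : c ∈ children nd) :
    RowsWF c.1.length c.2 ∧ c.1.length + 1 ≤ nd.1.length ∧
    constVal nd.2 + 1 ≤ constVal c.2 ∧ Set.range (excess c.2) ⊆ Set.range (excess nd.2) := by
  obtain ⟨i, hi, rfl⟩ := mem_children.1 hc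
  obtain ⟨n, hn⟩ : ∃ n, nd.1.length = n + 1 := ⟨nd.1.length - 1, by omega⟩
  rw [hn] at h
  obtain ⟨h1, h2, h3, h4⟩ := child_spec hn (h.rotateVars_iterate i)
  refine ⟨h1, by omega, by rwa [constVal_rotateVars_iterate] at h3, ?_⟩
  rw [h4]
  refine Set.Subset.trans ?_ (range_excess_rotateVars_iterate h.length i)
  rintro _ ⟨z, rfl⟩
  exact ⟨_, (excess_substHead _ z).symm⟩

/-- An assignment is the origin or compatible with one of the branches. -/
theorem exists_children {nd : Node} (h : RowsWF nd.1.length nd.2) (z : ℕ → Bool) :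
    excess nd.2 (fun _ => false) = excess nd.2 z ∨
    ∃ c ∈ children nd, ∃ z', excess c.2 z' = excess nd.2 z := by
  by_cases hz : ∀ i < nd.1.length, z i = false
  · exact Or.inl (excess_congr h.length fun i hi => (hz i hi).symm)
  · push Not at hz
    obtain ⟨i, hi, hzi⟩ := hz
    obtain ⟨n, hn⟩ : ∃ n, nd.1.length = n + 1 := ⟨nd.1.length - 1, by omega⟩
    refine Or.inr ⟨_, mem_children.2 ⟨i, hi, rfl⟩, ?_⟩
    rw [hn] at h
    obtain ⟨-, -, -, h4⟩ := child_spec hn (h.rotateVars_iterate i)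
    obtain ⟨z', h5, h6⟩ := exists_excess_rotateVars_iterate h.length (hn ▸ hi)
      (by simpa using hzi : z i = true)
    have h7 : excess nd.2 z ∈ Set.range (excess (substHead (rotateVars^[i] nd.2))) := by
      refine ⟨fun j => z' (j + 1), ?_⟩
      rw [excess_substHead, ← h6]
      congr 1
      funext j
      cases j
      · exact h5.symm
      · rfl
    rw [← h4] at h7
    exact h7

/-! ### Correctness of the level-by-level search -/

/-- What is known at level `j` of the search tree. -/
structure SearchLevel (K j : ℕ) (nd : Node) (F : List Node) : Prop where
  wf : ∀ c ∈ F, RowsWF c.1.length c.2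
  vars : ∀ c ∈ F, c.1.length + j ≤ nd.1.length
  gain : ∀ c ∈ F, (j : ℤ) ≤ constVal c.2
  sound : ∀ c ∈ F, Set.range (excess c.2) ⊆ Set.range (excess nd.2)
  length : F.length ≤ nd.1.length ^ j
  complete : (∃ z, (K : ℤ) ≤ excess nd.2 z) → ∃ c ∈ F, ∃ z, (K : ℤ) ≤ excess c.2 z

/-- What is known after `j` steps of the search. -/
def SearchInv (K j : ℕ) (nd : Node) (st : Bool × Bool × List Node) : Prop :=
  (st.1 = false ∧ SearchLevel K j nd st.2.2) ∨
  (st.1 = true ∧ st.2.1 = true ∧ ∃ z, (K : ℤ) ≤ excess nd.2 z) ∨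
  (st.1 = true ∧ st.2.1 = false ∧ nd.2.length < nd.1.length ^ K)

/-- A successful test is sound because the average is exceeded or attained by some assignment. If
all tests fail, no node has the origin as a solution, so every solution survives in a child. -/
theorem SearchInv.step {K j : ℕ} {nd : Node} {st : Bool × Bool × List Node}
    (h : SearchInv K j nd st) : SearchInv K (j + 1) nd (searchStep K nd.2 st) := by
  unfold searchStep
  split_ifs with h1 h2 h3
  · rcases h with ⟨h, -⟩ | h | h
    · simp [h] at h1
    · exact Or.inr (Or.inl h)
    · exact Or.inr (Or.inr h)
  all_goals
    obtain ⟨-, h⟩ : st.1 = false ∧ SearchLevel K j nd st.2.2 := by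
      rcases h with h | ⟨h, -⟩ | ⟨h, -⟩
      · exact h
      · exact absurd h h1
      · exact absurd h h1
  · refine Or.inr (Or.inl ⟨rfl, rfl, ?_⟩)
    obtain ⟨c, hc, hct⟩ := List.any_eq_true.1 h2
    have : ∃ z, (K : ℤ) ≤ excess c.2 z := by
      rcases nodeTest_iff.1 hct with h3 | h3
      · exact ⟨_, h3⟩
      · obtain ⟨z, hz⟩ := exists_constVal_le_excess c.2
        exact ⟨z, h3.trans hz⟩
    obtain ⟨z, hz⟩ := this
    obtain ⟨z', hz'⟩ := h.sound c hc ⟨z, rfl⟩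
    exact ⟨z', hz' ▸ hz⟩
  all_goals
    have hlen : (st.2.2.flatMap children).length ≤ nd.1.length ^ (j + 1) := by
      refine le_trans ?_ ((Nat.mul_le_mul_right _ h.length).trans_eq (pow_succ _ _).symm)
      have hv := h.vars
      clear h h2 h3
      generalize st.2.2 = F at hv
      induction F with
      | nil => simp
      | cons c F ih =>
        have h5 := ih fun c hc => hv c (by simp [hc])
        have h6 := hv c (by simp)
        rw [List.flatMap_cons, List.length_append, length_children, List.length_cons, add_mul]
        omega
    have htest : ∀ c ∈ st.2.2, ¬ nodeTest K c = true := fun c hc hct =>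
      h2 (List.any_eq_true.2 ⟨c, hc, hct⟩)
  · refine Or.inr (Or.inr ⟨rfl, rfl, ?_⟩)
    simp only [decide_eq_true_eq] at h3
    have h4 := h3.trans_le hlen
    refine h4.trans_le ?_
    have hn : 0 < nd.1.length := by
      rcases Nat.eq_zero_or_pos nd.1.length with h0 | h0
      · rw [h0] at h4; simp at h4
      · exact h0
    refine Nat.pow_le_pow_right hn ?_
    -- An overfull next level has a parent `c`. Its average is at least `j` and, the test having
    -- failed, below `K`; hence `j + 1 ≤ K`.
    obtain ⟨c, hc⟩ : ∃ c, c ∈ st.2.2 := by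
      by_contra hcon
      push Not at hcon
      rw [List.eq_nil_iff_forall_not_mem.2 hcon] at h3
      simp at h3
    have h5 := htest c hc
    rw [nodeTest_iff] at h5
    push Not at h5
    have h6 := h.gain c hc
    omega
  · refine Or.inl ⟨rfl, ?_, ?_, ?_, ?_, hlen, ?_⟩
    · intro c' hc'
      obtain ⟨c, hc, hcc⟩ := List.mem_flatMap.1 hc'
      exact (children_spec (h.wf c hc) hcc).1
    · intro c' hc'
      obtain ⟨c, hc, hcc⟩ := List.mem_flatMap.1 hc'
      have := (children_spec (h.wf c hc) hcc).2.1
      have := h.vars c hc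
      omega
    · intro c' hc'
      obtain ⟨c, hc, hcc⟩ := List.mem_flatMap.1 hc'
      have := (children_spec (h.wf c hc) hcc).2.2.1
      have := h.gain c hc
      push_cast
      omega
    · intro c' hc'
      obtain ⟨c, hc, hcc⟩ := List.mem_flatMap.1 hc'
      exact (children_spec (h.wf c hc) hcc).2.2.2.trans (h.sound c hc)
    · intro hz
      obtain ⟨c, hc, z, hz⟩ := h.complete hz
      -- A solution with the value of the origin would have made the test succeed.
      rcases exists_children (h.wf c hc) z with h5 | ⟨c', hc', z', hz'⟩
      · exact absurd (nodeTest_iff.2 (Or.inl (h5 ▸ hz))) (htest c hc)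
      · exact ⟨c', List.mem_flatMap.2 ⟨c, hc, hc'⟩, z', hz' ▸ hz⟩

/-- The search finds the right answer unless it gives up, in which case there are few equations. -/
theorem search_spec {K : ℕ} {nd : Node} (h : RowsWF nd.1.length nd.2)
    (h0 : 0 ≤ constVal nd.2) :
    ((search K nd).1 = false ∧ ¬ ∃ z, (K : ℤ) ≤ excess nd.2 z) ∨
    ((search K nd).1 = true ∧ (search K nd).2.1 = true ∧ ∃ z, (K : ℤ) ≤ excess nd.2 z) ∨
    ((search K nd).1 = true ∧ (search K nd).2.1 = false ∧ nd.2.length < nd.1.length ^ K) := by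
  have key : ∀ (l : List Unit) (j : ℕ) (st : Bool × Bool × List Node), SearchInv K j nd st →
      SearchInv K (j + l.length) nd (l.foldl (fun st _ => searchStep K nd.2 st) st) := by
    intro l
    induction l with
    | nil => exact fun j st h => h
    | cons x l ih =>
      intro j st h
      have := ih _ _ h.step
      rwa [add_assoc, add_comm 1] at this
  have h1 := key (() :: nd.1) 0 (false, false, [nd]) (Or.inl ⟨rfl, by simpa using h, by simp,
    by simpa using h0, by simp, by simp, fun hz => ⟨nd, by simp, hz⟩⟩)
  rcases h1 with ⟨h1, h2⟩ | h1
  · refine Or.inl ⟨h1, fun hz => ?_⟩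
    -- Each level costs at least one variable and the search makes one step more than there are
    -- variables, so no node can be left for a solution.
    obtain ⟨c, hc, -⟩ := h2.complete hz
    have := h2.vars c hc
    simp at this
    omega
  · exact Or.inr h1

/-! ### Systems with few equations have assignments of large excess -/

-- Inserting zero pads shorter sums, so the `s`-fold sumset contains the sums of at most `s`
-- distinct vectors of `M`.
open scoped Pointwise in
theorem sum_mem_nsmul_insert_zero {V : Type*} [AddCommGroup V] [DecidableEq V] {M T : Finset V}
    (s : ℕ) (hT : T ⊆ M) (hs : T.card ≤ s) : ∑ v ∈ T, v ∈ s • insert 0 M := by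
  induction s generalizing T with
  | zero =>
    rw [Finset.card_eq_zero.1 (Nat.le_zero.1 hs)]
    simp
  | succ s ih =>
    rw [succ_nsmul]
    rcases T.eq_empty_or_nonempty with rfl | ⟨v, hv⟩
    · have := ih (Finset.empty_subset M) (by simp)
      simpa using Finset.add_mem_add this (Finset.mem_insert_self 0 M)
    · rw [← Finset.sum_erase_add T _ hv]
      refine Finset.add_mem_add (ih ((Finset.erase_subset v T).trans hT) ?_)
        (Finset.mem_insert_of_mem (hT hv))
      rw [Finset.card_erase_of_mem hv]
      omega

open scoped Pointwise in
/-- A small spanning set `M` contains many vectors such that no sum of two or more of them is in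
`M`. -/
theorem exists_sumFree {V : Type*} [AddCommGroup V] [Fintype V] [DecidableEq V]
    (h2 : ∀ v : V, v + v = 0) {M : Finset V} {s : ℕ} (h0 : (0 : V) ∉ M)
    (hspan : ∀ x, ∃ T ⊆ M, ∑ v ∈ T, v = x) (hcard : (M.card + 1) ^ s < Fintype.card V) :
    ∃ T ⊆ M, T.card = s + 1 ∧ (∀ A ⊆ T, ∑ v ∈ A, v = 0 → A = ∅) ∧
      ∀ A ⊆ T, ∑ v ∈ A, v ∈ M → ∃ v, A = {v} := by
  -- The sumset has at most `(M.card + 1) ^ s` members and so misses some vector.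
  obtain ⟨x, hx⟩ : ∃ x, x ∉ s • insert 0 M := by
    by_contra hcon
    push Not at hcon
    have h1 : Fintype.card V ≤ (s • insert 0 M).card :=
      Finset.card_le_card fun x _ => hcon x
    have h3 : (s • insert 0 M).card ≤ (insert 0 M).card ^ s := Finset.card_nsmul_le
    have h4 := Nat.pow_le_pow_left (Finset.card_insert_le (0 : V) M) s
    omega
  have hex : ∃ m, ∃ T ⊆ M, ∑ v ∈ T, v = x ∧ T.card = m := by
    obtain ⟨T, hT, hTx⟩ := hspan x
    exact ⟨_, T, hT, hTx, rfl⟩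
  classical
  obtain ⟨T, hT, hTx, hTc⟩ := Nat.find_spec hex
  -- `T` is a shortest representation of `x`; since `x` avoids the sumset, it has more than `s`
  -- terms.
  have hmin : ∀ T' ⊆ M, ∑ v ∈ T', v = x → T.card ≤ T'.card := fun T' h1 h3 => by
    rw [hTc]
    exact Nat.find_min' hex ⟨T', h1, h3, rfl⟩
  have hs : s + 1 ≤ T.card := by
    by_contra hcon
    exact hx (hTx ▸ sum_mem_nsmul_insert_zero s hT (by omega))
  -- A nonempty part with sum zero could be omitted.
  have hzero : ∀ A ⊆ T, ∑ v ∈ A, v = 0 → A = ∅ := fun A hA hsum => by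
    have h3 := hmin (T \ A) (Finset.sdiff_subset.trans hT) (by
      rw [← hTx, ← Finset.sum_sdiff hA, hsum, add_zero])
    rw [Finset.card_sdiff_of_subset hA] at h3
    have h4 := Finset.card_le_card hA
    exact Finset.card_eq_zero.1 (by omega)
  -- Two or more terms whose sum lies in `M` could be replaced by that single vector.
  have hsf : ∀ A ⊆ T, ∑ v ∈ A, v ∈ M → ∃ v, A = {v} := fun A hA hsum => by
    have h1 : A.card ≠ 0 := fun h => by
      rw [Finset.card_eq_zero.1 h, Finset.sum_empty] at hsum
      exact h0 hsum
    by_contra hcon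
    rw [← Finset.card_eq_one] at hcon
    set y := ∑ v ∈ A, v with hy
    have h3 : ∑ v ∈ T \ A, v + y = x := by rw [← hTx, ← Finset.sum_sdiff hA]
    have h4 := Finset.card_sdiff_of_subset hA
    have h5 := Finset.card_le_card hA
    -- If the replacement already occurs among the remaining terms, the two copies cancel, which
    -- shortens the representation even more.
    by_cases hyT : y ∈ T \ A
    · have := hmin ((T \ A).erase y)
        ((Finset.erase_subset _ _).trans (Finset.sdiff_subset.trans hT)) (by
          rw [← h3, ← Finset.sum_erase_add _ _ hyT, add_assoc, h2, add_zero])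
      rw [Finset.card_erase_of_mem hyT] at this
      omega
    · have := hmin (insert y (T \ A))
        (Finset.insert_subset hsum (Finset.sdiff_subset.trans hT)) (by
          rw [Finset.sum_insert hyT, add_comm, h3])
      rw [Finset.card_insert_of_notMem hyT] at this
      omega
  -- Both properties pass to subsets, so the size can be made exactly `s + 1`.
  obtain ⟨T', hT', hc⟩ := Finset.exists_subset_card_eq hs
  exact ⟨T', hT'.trans hT, hc, fun A hA => hzero A (hA.trans hT'),
    fun A hA => hsf A (hA.trans hT')⟩

/-! ### Characters and averages over the solutions of some equations -/

/-- The character of the group of assignments that belongs to a vector. -/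
def chi {n : ℕ} (v : Fin n → ZMod 2) (z : ℕ → Bool) : ℤ :=
  ∏ i, if v i = 1 ∧ z i = true then -1 else 1

/-- A list of coefficients as a vector. -/
def toVec (n : ℕ) (v : List Bool) : Fin n → ZMod 2 := fun i => if v.getD i false = true then 1 else 0

/-- Extension of a finite assignment. -/
def extend {n : ℕ} (z : Fin n → Bool) : ℕ → Bool := fun i => if h : i < n then z ⟨i, h⟩ else false

theorem sgn_dot (v : List Bool) (z : ℕ → Bool) : sgn (dot v z) = chi (toVec v.length v) z := by
  induction v generalizing z with
  | nil => rfl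
  | cons a v ih =>
    rw [dot, sgn_xor, ih, chi, chi, List.length_cons, Fin.prod_univ_succ]
    congr 1
    cases a <;> cases h : z 0 <;> simp [sgn, toVec, h]

theorem chi_add {n : ℕ} (u v : Fin n → ZMod 2) (z : ℕ → Bool) :
    chi (u + v) z = chi u z * chi v z := by
  rw [chi, chi, chi, ← Finset.prod_mul_distrib]
  refine Finset.prod_congr rfl fun i _ => ?_
  rw [Pi.add_apply]
  generalize u i = a
  generalize v i = b
  generalize z i = c
  revert a b c
  decide

theorem chi_zero {n : ℕ} (z : ℕ → Bool) : chi (0 : Fin n → ZMod 2) z = 1 := by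
  simp [chi]

theorem chi_sum {n : ℕ} (A : Finset (Fin n → ZMod 2)) (z : ℕ → Bool) :
    chi (∑ v ∈ A, v) z = ∏ v ∈ A, chi v z := by
  classical
  induction A using Finset.induction_on with
  | empty => simp [chi_zero]
  | insert v A hv ih => rw [Finset.sum_insert hv, Finset.prod_insert hv, chi_add, ih]

theorem chi_eq_or {n : ℕ} (v : Fin n → ZMod 2) (z : ℕ → Bool) : chi v z = 1 ∨ chi v z = -1 := by
  unfold chi
  refine Finset.prod_induction _ (fun x : ℤ => x = 1 ∨ x = -1) ?_ (Or.inl rfl) fun i _ => ?_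
  · rintro a b (rfl | rfl) (rfl | rfl) <;> simp
  · split_ifs <;> simp

/-- The sum factors over the coordinates, and a coordinate where `v` is one contributes `1 - 1 = 0`.
-/
theorem sum_chi {n : ℕ} (v : Fin n → ZMod 2) :
    ∑ z : Fin n → Bool, chi v (extend z) = if v = 0 then 2 ^ n else 0 := by
  have h1 : ∀ z : Fin n → Bool, chi v (extend z) =
      ∏ i, if v i = 1 ∧ z i = true then (-1 : ℤ) else 1 := fun z =>
    Finset.prod_congr rfl fun i _ => by simp [extend]
  have h2 := Finset.prod_univ_sum (fun _ : Fin n => (Finset.univ : Finset Bool))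
    (fun i b => if v i = 1 ∧ b = true then (-1 : ℤ) else 1)
  rw [Fintype.piFinset_univ] at h2
  simp only [h1]
  rw [← h2]
  split_ifs with hv
  · subst hv; simp
  · obtain ⟨i, hi⟩ := Function.ne_iff.1 hv
    refine Finset.prod_eq_zero (Finset.mem_univ i) ?_
    have : v i = 1 := by
      revert hi
      rw [Pi.zero_apply]
      generalize v i = a
      revert a
      decide
    simp [this]

theorem add_self_vec {n : ℕ} (v : Fin n → ZMod 2) : v + v = 0 := by
  funext i
  exact CharTwo.add_self_eq_zero _

theorem add_eq_zero_iff_vec {n : ℕ} {u v : Fin n → ZMod 2} : u + v = 0 ↔ u = v := by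
  constructor
  · intro h
    rw [← add_zero u, ← add_self_vec v, ← add_assoc, h, zero_add]
  · rintro rfl
    exact add_self_vec u

theorem toVec_injOn {n : ℕ} {u v : List Bool} (hu : u.length = n) (hv : v.length = n)
    (h : toVec n u = toVec n v) : u = v := by
  refine List.ext_getElem (hu.trans hv.symm) fun i h1 h2 => ?_
  have h3 := congrFun h ⟨i, hu ▸ h1⟩
  simp only [toVec, List.getD_eq_getElem _ _ h1, List.getD_eq_getElem _ _ h2] at h3
  cases h4 : u[i] <;> cases h5 : v[i] <;> simp_all

theorem toVec_unitVec {n : ℕ} (i : Fin n) : toVec n (unitVec n i) = Pi.single i 1 := by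
  funext j
  simp only [toVec, Pi.single_apply]
  rw [List.getD_eq_getElem _ _ (by simp [length_unitVec])]
  simp [unitVec, Fin.ext_iff]

/-- The weighted average of a function over the assignments that satisfy certain equations, in terms
of its Fourier coefficients. -/
theorem sum_chi_mul_prod {n : ℕ} (T : Finset (Fin n → ZMod 2)) (c : (Fin n → ZMod 2) → ℤ)
    (u : Fin n → ZMod 2) :
    ∑ z : Fin n → Bool, chi u (extend z) * ∏ v ∈ T, (1 + c v * chi v (extend z)) =
      ∑ A ∈ T.powerset, if u = ∑ v ∈ A, v then 2 ^ n * ∏ v ∈ A, c v else 0 := by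
  classical
  have h1 : ∀ z : Fin n → Bool,
      chi u (extend z) * ∏ v ∈ T, (1 + c v * chi v (extend z)) =
      ∑ A ∈ T.powerset, (∏ v ∈ A, c v) * chi (u + ∑ v ∈ A, v) (extend z) := fun z => by
    rw [Finset.prod_one_add, Finset.mul_sum]
    refine Finset.sum_congr rfl fun A _ => ?_
    rw [Finset.prod_mul_distrib, chi_add, chi_sum]
    ring
  simp only [h1]
  rw [Finset.sum_comm]
  refine Finset.sum_congr rfl fun A _ => ?_
  rw [← Finset.mul_sum, sum_chi]
  simp only [add_eq_zero_iff_vec]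
  split_ifs <;> ring

theorem RowsWF.toVec_inj {n : ℕ} {R : List Row} (h : RowsWF n R) :
    ∀ r ∈ R, ∀ r' ∈ R, toVec n r.1 = toVec n r'.1 → r = r' := fun r hr r' hr' he =>
  List.inj_on_of_nodup_map h.nodup hr hr' (toVec_injOn (h.length r hr) (h.length r' hr') he)

theorem toVec_ne_zero {n : ℕ} {v : List Bool} (hv : v.length = n) (h : v.any id = true) :
    toVec n v ≠ 0 := fun h0 => by
  obtain ⟨b, hb, hbt⟩ := List.any_eq_true.1 h
  obtain ⟨i, hi, rfl⟩ := List.getElem_of_mem hb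
  have h2 := congrFun h0 ⟨i, hv ▸ hi⟩
  simp only [id] at hbt
  simp [toVec, hi, hbt] at h2

/-- All equations can be satisfied on average whose left-hand sides form a set such that no sum of
two or more of its members is a left-hand side. -/
theorem exists_excess_ge_of_sumFree {n : ℕ} {R : List Row} (h : RowsWF n R)
    {T : Finset (Fin n → ZMod 2)} (hTzero : ∀ A ⊆ T, ∑ v ∈ A, v = 0 → A = ∅)
    (hTfree : ∀ A ⊆ T, ∀ r ∈ R, ∑ v ∈ A, v = toVec n r.1 → ∃ v, A = {v}) :
    ∃ z, (R.map fun r => if toVec n r.1 ∈ T then (r.2.2 : ℤ) else 0).sum ≤ excess R z := by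
  classical
  have hinj := h.toVec_inj
  -- The sign of the right-hand side belonging to `v`: a row with this left-hand side holds exactly
  -- where `c v * chi v = 1`.
  let c : (Fin n → ZMod 2) → ℤ := fun v =>
    if ∃ r ∈ R, toVec n r.1 = v ∧ r.2.1 = true then -1 else 1
  have hc : ∀ r ∈ R, c (toVec n r.1) = sgn r.2.1 := fun r hr => by
    simp only [c, sgn]
    refine if_congr ⟨?_, fun hb => ⟨r, hr, rfl, hb⟩⟩ rfl rfl
    rintro ⟨r', hr', he, hb⟩
    rwa [← hinj r' hr' r hr he]
  have hc1 : ∀ v, c v = 1 ∨ c v = -1 := fun v => by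
    simp only [c]
    split_ifs <;> simp
  -- Each factor is 2 or 0, so `Φ` is `2 ^ T.card` times the indicator of `c v * chi v = 1` for all
  -- `v ∈ T`, and can serve as a weight for averaging.
  let Φ : (Fin n → Bool) → ℤ := fun z => ∏ v ∈ T, (1 + c v * chi v (extend z))
  have hΦ : ∀ z, 0 ≤ Φ z := fun z => Finset.prod_nonneg fun v _ => by
    rcases hc1 v with h1 | h1 <;> rcases chi_eq_or v (extend z) with h3 | h3 <;> simp [h1, h3]
  have hΦsum : ∑ z, Φ z = 2 ^ n := by
    have h1 := sum_chi_mul_prod T c 0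
    simp only [chi_zero, one_mul] at h1
    refine h1.trans ?_
    -- Independence of `T` leaves only the empty subset.
    rw [Finset.sum_eq_single ∅]
    · simp
    · intro A hA hA0
      rw [if_neg fun he => hA0 (hTzero A (Finset.mem_powerset.1 hA) he.symm)]
    · simp
  have hrow : ∀ r ∈ R, ∑ z, chi (toVec n r.1) (extend z) * Φ z =
      if toVec n r.1 ∈ T then 2 ^ n * sgn r.2.1 else 0 := fun r hr => by
    rw [sum_chi_mul_prod]
    -- A left-hand side is a subset sum of `T` only as a single member of `T`; so the rows outside
    -- `T` average to zero.
    have h1 : ∀ A ∈ T.powerset, toVec n r.1 = ∑ v ∈ A, v → A = {toVec n r.1} := by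
      intro A hA he
      obtain ⟨v, rfl⟩ := hTfree A (Finset.mem_powerset.1 hA) r hr he.symm
      rw [Finset.sum_singleton] at he
      rw [he]
    split_ifs with hrT
    · rw [Finset.sum_eq_single {toVec n r.1}]
      · rw [if_pos (by simp), Finset.prod_singleton, hc r hr]
      · intro A hA hA1
        rw [if_neg fun he => hA1 (h1 A hA he)]
      · intro hcon
        exact absurd (Finset.mem_powerset.2 (Finset.singleton_subset_iff.2 hrT)) hcon
    · refine Finset.sum_eq_zero fun A hA => ?_
      rw [if_neg fun he => hrT ?_]
      have := Finset.mem_powerset.1 hA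
      rw [h1 A hA he] at this
      exact Finset.singleton_subset_iff.1 this
  have hsum : ∑ z, excess R (extend z) * Φ z =
      2 ^ n * (R.map fun r => if toVec n r.1 ∈ T then (r.2.2 : ℤ) else 0).sum := by
    have h1 : ∀ S : List Row, (∀ r ∈ S, r ∈ R) → ∑ z, excess S (extend z) * Φ z =
        2 ^ n * (S.map fun r => if toVec n r.1 ∈ T then (r.2.2 : ℤ) else 0).sum := by
      intro S
      induction S with
      | nil => intro _; simp [excess, val]
      | cons r S ih =>
        intro hS
        have h3 := ih fun r' hr' => hS r' (by simp [hr'])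
        have hr := hS r (by simp)
        have h4 : ∀ z, excess (r :: S) (extend z) * Φ z =
            sgn r.2.1 * r.2.2 * (chi (toVec n r.1) (extend z) * Φ z) +
              excess S (extend z) * Φ z := fun z => by
          have h5 : excess (r :: S) (extend z) =
              sgn (dot r.1 (extend z)) * (sgn r.2.1 * r.2.2) + excess S (extend z) := by
            simp [excess, val]
          rw [h5, sgn_dot, h.length r hr]
          ring
        simp only [h4]
        rw [Finset.sum_add_distrib, ← Finset.mul_sum, hrow r hr, h3, List.map_cons,
          List.sum_cons]
        split_ifs
        · cases r.2.1 <;> simp [sgn] <;> ring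
        · ring
    exact h1 R fun r hr => hr
  by_contra hcon
  push Not at hcon
  -- Were every excess smaller than the claimed bound, integrality would give a gap of one
  -- everywhere, and the weighted sums would differ by the total weight `2 ^ n > 0`.
  have h5 : ∑ z, (excess R (extend z) + 1) * Φ z ≤
      ∑ z, (R.map fun r => if toVec n r.1 ∈ T then (r.2.2 : ℤ) else 0).sum * Φ z :=
    Finset.sum_le_sum fun z _ => mul_le_mul_of_nonneg_right (hcon _) (hΦ z)
  simp only [add_mul, one_mul] at h5
  rw [Finset.sum_add_distrib, ← Finset.mul_sum, hΦsum, hsum, mul_comm] at h5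
  have : (0 : ℤ) < 2 ^ n := by positivity
  omega

/-- Applies `exists_sumFree` to the set of left-hand sides; the `s + 1` selected equations have
weight at least one each and are satisfied together on average, with nothing lost on the others. -/
theorem exists_excess_ge {n s : ℕ} {R : List Row} (h : RowsWF n R)
    (hne : ∀ r ∈ R, r.1.any id = true) (hcard : (R.length + 1) ^ s < 2 ^ n) :
    ∃ z, (s : ℤ) + 1 ≤ excess R z := by
  classical
  set M : Finset (Fin n → ZMod 2) := (R.map fun r => toVec n r.1).toFinset with hM
  have hmem : ∀ r ∈ R, toVec n r.1 ∈ M := fun r hr => by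
    rw [hM, List.mem_toFinset]; exact List.mem_map.2 ⟨r, hr, rfl⟩
  have hinj := h.toVec_inj
  have h0 : (0 : Fin n → ZMod 2) ∉ M := fun hmem => by
    rw [hM, List.mem_toFinset, List.mem_map] at hmem
    obtain ⟨r, hr, hr0⟩ := hmem
    exact toVec_ne_zero (h.length r hr) (hne r hr) hr0
  have hspan : ∀ x, ∃ T ⊆ M, ∑ v ∈ T, v = x := fun x => by
    -- The normal form puts every unit vector into `M`, and `x` is the sum of those in its support.
    refine ⟨(Finset.univ.filter fun i => x i = 1).image fun i => Pi.single i 1, ?_, ?_⟩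
    · intro v hv
      obtain ⟨i, -, rfl⟩ := Finset.mem_image.1 hv
      obtain ⟨w, hw⟩ := h.unit i i.2
      simpa only [toVec_unitVec] using hmem _ hw
    · rw [Finset.sum_image fun i _ j _ hij => by
        by_contra hne'
        have := congrFun hij i
        simp only [Pi.single_eq_same, Pi.single_eq_of_ne hne'] at this
        exact one_ne_zero this]
      funext j
      rw [Finset.sum_apply, Finset.sum_filter]
      simp only [Pi.single_apply]
      have h1 : ∀ a : ZMod 2, (if a = 1 then (1 : ZMod 2) else 0) = a := by decide
      rw [Finset.sum_eq_single j]
      · simpa using h1 (x j)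
      · intro i _ hij
        simp [hij.symm]
      · simp
  have hMcard : (M.card + 1) ^ s < Fintype.card (Fin n → ZMod 2) := by
    have h1 : M.card ≤ R.length := (List.toFinset_card_le _).trans (by simp)
    rw [Fintype.card_fun, ZMod.card, Fintype.card_fin]
    exact (Nat.pow_le_pow_left (by omega) s).trans_lt hcard
  obtain ⟨T, hT, hTc, hTzero, hTfree⟩ := exists_sumFree add_self_vec h0 hspan hMcard
  have hlow : (T.card : ℤ) ≤ (R.map fun r => if toVec n r.1 ∈ T then (r.2.2 : ℤ) else 0).sum := by
    have h1 : (R.map fun r => if toVec n r.1 ∈ T then (1 : ℤ) else 0).sum ≤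
        (R.map fun r => if toVec n r.1 ∈ T then (r.2.2 : ℤ) else 0).sum := by
      refine List.sum_le_sum fun r hr => ?_
      have := h.weight_pos r hr
      split_ifs <;> omega
    refine le_trans ?_ h1
    have h3 : (R.map fun r => toVec n r.1).Nodup := by
      refine (List.nodup_map_iff_inj_on (h.nodup.of_map _)).2 hinj
    have h4 : (R.map fun r => if toVec n r.1 ∈ T then (1 : ℤ) else 0).sum =
        ∑ v ∈ M, if v ∈ T then (1 : ℤ) else 0 := by
      rw [hM, List.sum_toFinset _ h3, List.map_map]
      rfl
    rw [h4, Finset.sum_ite_mem, Finset.inter_eq_right.2 hT]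
    simp
  rw [hTc] at hlow
  obtain ⟨z, hz⟩ := exists_excess_ge_of_sumFree h hTzero fun A hA r hr he =>
    hTfree A hA (he ▸ hmem r hr)
  exact ⟨z, le_trans (by exact_mod_cast hlow) hz⟩

/-- A large weight yields a large excess. -/
theorem exists_excess_ge_weight {n : ℕ} {R : List Row} (h : RowsWF n R)
    (hne : ∀ r ∈ R, r.1.any id = true) {r : Row} (hr : r ∈ R) :
    ∃ z, (r.2.2 : ℤ) ≤ excess R z := by
  have hr0 := toVec_ne_zero (h.length r hr) (hne r hr)
  -- A single nonzero left-hand side is trivially independent and free of longer sums.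
  obtain ⟨z, hz⟩ := exists_excess_ge_of_sumFree h (T := {toVec n r.1})
    (fun A hA h0 => by
      rcases Finset.subset_singleton_iff.1 hA with rfl | rfl
      · rfl
      · rw [Finset.sum_singleton] at h0
        exact absurd h0 hr0)
    (fun A hA x hx h0 => by
      rcases Finset.subset_singleton_iff.1 hA with rfl | rfl
      · rw [Finset.sum_empty] at h0
        exact absurd h0.symm (toVec_ne_zero (h.length x hx) (hne x hx))
      · exact ⟨_, rfl⟩)
  refine ⟨z, le_trans ?_ hz⟩
  refine List.single_le_sum (fun x hx => ?_) _ (List.mem_map.2 ⟨r, hr, by simp⟩)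
  obtain ⟨y, -, rfl⟩ := List.mem_map.1 hx
  split_ifs <;> positivity

/-! ### The threshold -/

/-- With `l = n.size`, so `n < 2 ^ l`, it suffices that `4 * k² * l ≤ n`. Otherwise `n ≥ 64 * k² *
k.size` forces `l > 16 * k.size`. Then `k²` is at most about `2 ^ (l / 8)`, and `n < 4 * k² * l`
contradicts `2 ^ (l - 1) ≤ n`. -/
theorem pow_lt_two_pow {k n : ℕ} (hk : 0 < k) (hn : 64 * (k * k * k.size) ≤ n) :
    n ^ (4 * (k * k)) < 2 ^ n := by
  set l := n.size with hl
  have hnl : n < 2 ^ l := Nat.lt_size_self n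
  have hL : 0 < k.size := Nat.size_pos.2 hk
  have hkk : 0 < k * k := Nat.mul_pos hk hk
  have hn0 : 0 < n := lt_of_lt_of_le (by positivity) hn
  by_cases hcase : l * (4 * (k * k)) ≤ n
  · calc n ^ (4 * (k * k)) < (2 ^ l) ^ (4 * (k * k)) := Nat.pow_lt_pow_left hnl (by omega)
      _ = 2 ^ (l * (4 * (k * k))) := (pow_mul _ _ _).symm
      _ ≤ 2 ^ n := Nat.pow_le_pow_right (by norm_num) hcase
  · exfalso
    push Not at hcase
    have h1 : 16 * k.size < l := by
      have : 64 * (k * k * k.size) < l * (4 * (k * k)) := hn.trans_lt hcase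
      have h2 : 4 * (k * k) * (16 * k.size) < 4 * (k * k) * l := by nlinarith
      exact lt_of_mul_lt_mul_left h2 (Nat.zero_le _)
    have h3 : 2 ^ (l - 1) ≤ n := Nat.lt_size.1 (by omega)
    have h4 : k * k ≤ 2 ^ (2 * k.size) := by
      have := (Nat.lt_size_self k).le
      rw [two_mul, pow_add]
      exact Nat.mul_le_mul this this
    -- With `q` the integral part of `l / 8`, the contradiction reduces to `2 ^ (7 * q - 1) ≥ 4 * (8
    -- * q + 7)` for `q ≥ 2`.
    obtain ⟨q, hq⟩ : ∃ q, l = 8 * q + l % 8 := ⟨l / 8, by omega⟩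
    have hq2 : 2 * k.size ≤ q := by omega
    have hq1 : 2 ≤ q := by omega
    have h5 : k * k ≤ 2 ^ q := h4.trans (Nat.pow_le_pow_right (by norm_num) hq2)
    have h6 : n < (8 * q + 7) * (4 * 2 ^ q) := hcase.trans_le
      (Nat.mul_le_mul (by omega) (Nat.mul_le_mul_left 4 h5))
    have h7 : 2 ^ (8 * q - 1) ≤ n := (Nat.pow_le_pow_right (by norm_num) (by omega)).trans h3
    have h8 : 2 ^ (8 * q - 1) = 2 ^ (7 * q - 1) * 2 ^ q := by
      rw [← pow_add]; congr 1; omega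
    have h9 : 2 ^ (7 * q - 1) < (8 * q + 7) * 4 := by
      have : 2 ^ (7 * q - 1) * 2 ^ q < (8 * q + 7) * 4 * 2 ^ q := by
        rw [← h8]
        calc _ ≤ n := h7
          _ < _ := h6
          _ = _ := by ring
      exact lt_of_mul_lt_mul_right this (Nat.zero_le _)
    have h10 : q < 2 ^ q := Nat.lt_two_pow_self
    have h11 : 2 ^ q * 2 ^ 7 ≤ 2 ^ (7 * q - 1) := by
      rw [← pow_add]
      exact Nat.pow_le_pow_right (by norm_num) (by omega)
    omega

/-- The hypothesis of `exists_excess_ge` for `s = 2k - 1`, which gives excess `2k`. The exponent `2k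
* (2k - 1)` is at most `4 * k²`. -/
theorem few_equations {k n m : ℕ} (hk : 0 < k) (hn : 64 * (k * k * k.size) ≤ n)
    (hm : m < n ^ (k + k)) : (m + 1) ^ (k + k - 1) < 2 ^ n := by
  have hn0 : 0 < n := by
    have := Nat.size_pos.2 hk
    exact lt_of_lt_of_le (by positivity) hn
  refine lt_of_le_of_lt ?_ (pow_lt_two_pow hk hn)
  calc (m + 1) ^ (k + k - 1) ≤ (n ^ (k + k)) ^ (k + k - 1) := Nat.pow_le_pow_left hm _
    _ = n ^ ((k + k) * (k + k - 1)) := (pow_mul _ _ _).symm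
    _ ≤ n ^ (4 * (k * k)) := Nat.pow_le_pow_right hn0 (by
      have : (k + k) * (k + k - 1) ≤ (k + k) * (k + k) := Nat.mul_le_mul_left _ (by omega)
      nlinarith)

/-- The bound for the number of variables. -/
def varBound (k : ℕ) : ℕ := 64 * (k * k * k.size)

theorem varBound_isBigO : (fun k : ℕ => (varBound k : ℝ)) =O[Filter.atTop]
    fun k : ℕ => (k : ℝ) ^ 2 * Real.log (k : ℝ) := by
  -- For `k ≥ 2`, `log 2 ≥ 1 / 2` gives `k.size ≤ 2 * log k + 1 ≤ 4 * log k`, and `64 * 4 = 256`.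
  refine Asymptotics.IsBigO.of_bound 256 (Filter.eventually_atTop.2 ⟨2, fun k hk => ?_⟩)
  have hk' : (2 : ℝ) ≤ k := by exact_mod_cast hk
  have h1 : 2 ^ (k.size - 1) ≤ k := Nat.lt_size.1 (by have := Nat.size_pos.2 (by omega : 0 < k); omega)
  have h2 : ((k.size - 1 : ℕ) : ℝ) * Real.log 2 ≤ Real.log k := by
    rw [← Real.log_pow]
    exact Real.log_le_log (by positivity) (by exact_mod_cast h1)
  have h3 : (1 / 2 : ℝ) ≤ Real.log 2 := by have := Real.log_two_gt_d9; linarith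
  have h4 : (k.size : ℝ) ≤ ((k.size - 1 : ℕ) : ℝ) + 1 := by
    have : k.size ≤ k.size - 1 + 1 := by omega
    exact_mod_cast this
  have h5 : Real.log 2 ≤ Real.log k := Real.log_le_log (by norm_num) hk'
  have h6 : (k.size : ℝ) ≤ 4 * Real.log k := by
    have : (0 : ℝ) ≤ ((k.size - 1 : ℕ) : ℝ) := by positivity
    nlinarith
  have h7 : 0 ≤ Real.log k := by linarith
  rw [Real.norm_of_nonneg (by positivity), Real.norm_of_nonneg (by positivity)]
  unfold varBound
  push_cast
  have h8 : (0 : ℝ) ≤ (k : ℝ) * k := by positivity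
  nlinarith [mul_le_mul_of_nonneg_left h6 h8]

/-! ### The kernel -/

theorem length_unaryMin (u : List Unit) (k : ℕ) : (unaryMin u k).length = min u.length k := by
  have key : ∀ (l : List Unit) (st : ℕ × List Unit),
      (l.foldl (fun (st : ℕ × List Unit) (_ : Unit) =>
        if decide (0 < st.1) = true then (st.1 - 1, () :: st.2) else st) st).2.length =
        st.2.length + min l.length st.1 := by
    intro l
    induction l with
    | nil => simp
    | cons x l ih =>
      intro st
      rw [List.foldl_cons, ih]
      split_ifs with h <;> simp at h ⊢ <;> omega
  rw [unaryMin, key]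
  simp

theorem length_thresholdList (u : List Unit) (k : ℕ) :
    (thresholdList u k).length = 64 * (u.length * u.length * k.size) := by
  simp only [thresholdList, List.length_flatMap, List.map_const', List.sum_replicate,
    List.length_replicate, ← Nat.size_eq_bits_len, smul_eq_mul]
  ring

/-- The shape of systems without superfluous equations. -/
structure Proper (nd : Node) : Prop where
  length : ∀ r ∈ nd.2, r.1.length = nd.1.length
  nonzero : ∀ r ∈ nd.2, r.1.any id = true
  weight_pos : ∀ r ∈ nd.2, 0 < r.2.2

theorem constVal_eq_zero {R : List Row} (h : ∀ r ∈ R, r.1.any id = true) : constVal R = 0 := by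
  rw [constVal, val]
  refine List.sum_eq_zero fun x hx => ?_
  obtain ⟨r, hr, rfl⟩ := List.mem_map.1 hx
  rw [if_pos (h r hr), zero_mul]

/-- Whether some assignment has excess at least `2 * k`. -/
def HasExcess (q : Node × ℕ) : Prop := ∃ z, ((q.2 + q.2 : ℕ) : ℤ) ≤ excess q.1.2 z

theorem hasExcess_zero : HasExcess (([], []), 0) := ⟨fun _ => false, le_rfl⟩

theorem not_hasExcess_one : ¬ HasExcess (([], []), 1) := by
  rintro ⟨z, hz⟩
  have h : excess ((([], []), 1) : Node × ℕ).1.2 z = 0 := rfl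
  rw [h] at hz
  simp at hz

/-- What is required of the kernel of an instance. -/
structure IsKernelOf (q r : Node × ℕ) : Prop where
  proper : Proper r.1
  iff : HasExcess q ↔ HasExcess r
  param : r.2 ≤ q.2 + 1
  vars : r.1.1.length ≤ varBound q.2
  nodup : (r.1.2.map fun r => r.1).Nodup
  weight : ∀ x ∈ r.1.2, x.2.2 ≤ q.2 + q.2

theorem isKernelOf_yes {q : Node × ℕ} (h : HasExcess q) : IsKernelOf q (([], []), 0) :=
  ⟨⟨by simp, by simp, by simp⟩, iff_of_true h hasExcess_zero, by simp, by simp, by simp, by simp⟩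

theorem isKernelOf_no {q : Node × ℕ} (h : ¬ HasExcess q) : IsKernelOf q (([], []), 1) :=
  ⟨⟨by simp, by simp, by simp⟩, iff_of_false h not_hasExcess_one, by simp, by simp, by simp, by simp⟩

/-- Each exit of the algorithm rests on one result: `search_spec` when the search decides,
`exists_excess_ge_weight` for a heavy equation, `exists_excess_ge` for many variables, and the zero
average for `k = 0`. In the remaining case the normal form itself is small. -/
theorem kernelize_spec {q : Node × ℕ} (h : Proper q.1) : IsKernelOf q (kernelize q) := by
  obtain ⟨nd₀, k⟩ := q
  have hlen : ∀ r ∈ (nd₀.1, merge nd₀.2).2, r.1.length = (nd₀.1, merge nd₀.2).1.length := by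
    intro r hr
    obtain ⟨⟨s, hs, hsr⟩, -⟩ := mem_merge hr
    rw [← hsr]; exact h.length s hs
  have hnd : ((nd₀.1, merge nd₀.2).2.map fun r => r.1).Nodup := nodup_merge _
  have hpos : ∀ r ∈ (nd₀.1, merge nd₀.2).2, 0 < r.2.2 := fun r hr => (mem_merge hr).2
  have hany : ∀ r ∈ (nd₀.1, merge nd₀.2).2, r.1.any id = true := by
    intro r hr
    obtain ⟨⟨s, hs, hsr⟩, -⟩ := mem_merge hr
    rw [← hsr]; exact h.nonzero s hs
  have hwf := normalForm_wf hlen hnd hpos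
  have hrange := range_excess_normalForm hlen hnd
  have hconst := constVal_normalForm hlen hnd
  have hany' := any_normalForm hlen hnd hany
  rw [constVal_eq_zero hany] at hconst
  unfold kernelize
  set nd := normalForm (nd₀.1, merge nd₀.2)
  have hiff : HasExcess (nd₀, k) ↔ HasExcess (nd, k) := by
    have h1 : Set.range (excess nd.2) = Set.range (excess nd₀.2) := by
      rw [hrange]
      congr 1
      funext z
      exact val_merge _ _
    constructor
    · rintro ⟨z, hz⟩
      obtain ⟨z', hz'⟩ := h1.symm.subset ⟨z, rfl⟩
      exact ⟨z', hz.trans_eq hz'.symm⟩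
    · rintro ⟨z, hz⟩
      obtain ⟨z', hz'⟩ := h1.subset ⟨z, rfl⟩
      exact ⟨z', hz.trans_eq hz'.symm⟩
  simp only [decide_eq_true_eq]
  split_ifs with hk h1 h2 h3 h4
  · refine isKernelOf_yes (hiff.2 ?_)
    rcases search_spec (K := k + k) hwf hconst.ge with h5 | h5 | h5
    · simp [h5.1] at h1
    · exact h5.2.2
    · simp [h5.2.1] at h2
  · obtain ⟨x, hx, hxk⟩ := List.any_eq_true.1 h4
    obtain ⟨z, hz⟩ := exists_excess_ge_weight hwf hany' hx
    simp only [Bool.not_eq_true', decide_eq_false_iff_not, not_lt] at hxk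
    exact isKernelOf_yes (hiff.2 ⟨z, le_trans (by exact_mod_cast hxk) hz⟩)
  · refine ⟨⟨hwf.length, hany', hwf.weight_pos⟩, hiff, by simp, ?_, hwf.nodup, fun x hx => ?_⟩
    · rw [length_thresholdList, length_unaryMin] at h3
      refine h3.le.trans ?_
      unfold varBound
      gcongr <;> exact min_le_right _ _
    · by_contra hcon
      exact h4 (List.any_eq_true.2 ⟨x, hx, by simp; simp at hcon; omega⟩)
  · refine isKernelOf_yes (hiff.2 ?_)
    rcases search_spec (K := k + k) hwf hconst.ge with h5 | h5 | ⟨-, -, h5⟩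
    · simp [h5.1] at h1
    · exact absurd h5.2.1 h2
    · rw [length_thresholdList, length_unaryMin, not_lt] at h3
      -- Without variables the search cannot have given up, as this would mean fewer than `0 ^ (2 *
      -- k) = 0` equations.
      have hn : 0 < nd.1.length := by
        rcases Nat.eq_zero_or_pos nd.1.length with h0 | h0
        · rw [h0, zero_pow (by omega)] at h5
          omega
        · exact h0
      have hL : 0 < k.size := Nat.size_pos.2 hk
      -- For `n < k` the computed threshold is `64 * n² * k.size`, which exceeds `n`. So truncating
      -- `k` to `n` in `unaryMin` does no harm.
      have hkn : k ≤ nd.1.length := by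
        by_contra hcon
        rw [min_eq_left (by omega)] at h3
        have h6 : nd.1.length * 1 ≤ nd.1.length * nd.1.length := Nat.mul_le_mul_left _ hn
        have h7 : nd.1.length * nd.1.length * 1 ≤ nd.1.length * nd.1.length * k.size :=
          Nat.mul_le_mul_left _ hL
        omega
      rw [min_eq_right hkn] at h3
      obtain ⟨z, hz⟩ := exists_excess_ge hwf hany' (few_equations hk h3 h5)
      refine ⟨z, le_trans ?_ hz⟩
      push_cast
      omega
  · refine isKernelOf_no fun hcon => ?_
    rcases search_spec (K := k + k) hwf hconst.ge with h5 | h5 | h5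
    · exact h5.2 (hiff.1 hcon)
    · exact h1 h5.1
    · exact h1 h5.1
  · refine isKernelOf_yes ?_
    obtain ⟨z, hz⟩ := exists_constVal_le_excess nd₀.2
    refine ⟨z, le_trans ?_ hz⟩
    rw [constVal_eq_zero h.nonzero]
    simp only
    omega

/-- Kernels are small. -/
theorem IsKernelOf.sz_le {q r : Node × ℕ} (h : IsKernelOf q r) :
    sz r.1 ≤ 2 * varBound q.2 + 3 + 2 ^ varBound q.2 * (4 * varBound q.2 +
      4 * (2 ^ varBound q.2 * (q.2 + q.2)).size + 8) := by
  have hlen : r.1.2.length ≤ 2 ^ varBound q.2 := by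
    -- The left-hand sides are distinct vectors over the field with two elements, so there are at
    -- most `2 ^ n` equations.
    have h1 : (r.1.2.map fun x => toVec r.1.1.length x.1).Nodup := by
      refine (List.nodup_map_iff_inj_on (h.nodup.of_map _)).2 fun x hx y hy hxy => ?_
      exact List.inj_on_of_nodup_map h.nodup hx hy
        (toVec_injOn (h.proper.length x hx) (h.proper.length y hy) hxy)
    have h2 := h1.length_le_card
    rw [Fintype.card_fun, ZMod.card, Fintype.card_fin, List.length_map] at h2
    exact h2.trans (Nat.pow_le_pow_right (by norm_num) h.vars)
  refine NodeBdd.sz_le ⟨h.vars, hlen, fun x hx => (h.proper.length x hx).trans_le h.vars, ?_⟩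
  refine (List.sum_le_card_nsmul _ (q.2 + q.2) fun w hw => ?_).trans ?_
  · obtain ⟨x, hx, rfl⟩ := List.mem_map.1 hw
    exact h.weight x hx
  · rw [List.length_map, smul_eq_mul]
    exact Nat.mul_le_mul_right _ hlen

/-! ### Translation between the two representations of systems -/

/-- An equation as a list of coefficients, right-hand side and weight. -/
def LinEq.toRow {n : ℕ} (e : LinEq n) : Row :=
  (List.ofFn fun i => decide (i ∈ e.vars), decide (e.rhs = 1), e.weight)

/-- The equation given by a row, if there is one. -/
def Row.toLinEq (n : ℕ) (r : Row) : Option (LinEq n) :=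
  if h : (Finset.univ.filter fun i : Fin n => r.1.getD i false = true).Nonempty ∧ 0 < r.2.2 then
    some ⟨_, if r.2.1 = true then 1 else 0, r.2.2, h.1, h.2⟩
  else none

/-- A system in terms of lists. -/
def LinSystem.toNode (S : LinSystem) : Node := (List.replicate S.n (), S.eqs.map LinEq.toRow)

/-- The system given by lists of coefficients. -/
def Node.toLinSystem (nd : Node) : LinSystem :=
  ⟨nd.1.length, nd.2.filterMap (Row.toLinEq nd.1.length)⟩

instance : Enc LinSystem := ⟨LinSystem.encode⟩

/-- Programs see only encodings, so the passage from systems to lists costs nothing. -/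
theorem enc_toNode (S : LinSystem) : enc S.toNode = enc S := by
  have h1 : enc (List.replicate S.n ()) = Data.unary S.n := by
    simp only [enc, Data.unary, List.map_replicate]
  have h2 : ∀ e : LinEq S.n, enc e.toRow = e.encode := fun e => by
    have : enc (List.ofFn fun i => decide (i ∈ e.vars)) =
        Data.ofList (List.ofFn fun i : Fin S.n => .ofBool (decide (i ∈ e.vars))) := by
      simp only [enc, List.map_ofFn]
      rfl
    exact congrArg (fun d => Data.cons d _) this
  change Data.cons (enc (List.replicate S.n ())) (Data.ofList ((S.eqs.map LinEq.toRow).map enc)) = _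
  rw [h1, List.map_map, show enc ∘ LinEq.toRow = LinEq.encode from funext h2]
  rfl

/-- `Row.toLinEq` rejects only rows without variables or without weight, and a proper system has
none. -/
theorem toNode_toLinSystem {nd : Node} (h : Proper nd) : (Node.toLinSystem nd).toNode = nd := by
  have key : ∀ r ∈ nd.2, ∃ e, Row.toLinEq nd.1.length r = some e ∧ e.toRow = r := by
    intro r hr
    have hlen := h.length r hr
    have hne : (Finset.univ.filter fun i : Fin nd.1.length =>
        r.1.getD i false = true).Nonempty := by
      obtain ⟨b, hb, hbt⟩ := List.any_eq_true.1 (h.nonzero r hr)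
      obtain ⟨i, hi, rfl⟩ := List.getElem_of_mem hb
      refine ⟨⟨i, hlen ▸ hi⟩, ?_⟩
      simp only [id] at hbt
      simp [hi, hbt]
    refine ⟨_, dif_pos ⟨hne, h.weight_pos r hr⟩, ?_⟩
    refine Prod.ext ?_ (Prod.ext ?_ rfl)
    · refine List.ext_getElem (by simp [LinEq.toRow, hlen]) fun i h1 h2 => ?_
      simp [LinEq.toRow, h2]
    · simp only [LinEq.toRow]
      cases r.2.1 <;> simp
  refine Prod.ext ?_ ?_
  · exact (List.eq_replicate_iff.2 ⟨rfl, fun _ _ => rfl⟩).symm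
  · simp only [LinSystem.toNode, Node.toLinSystem]
    revert key
    generalize nd.2 = R
    intro key
    induction R with
    | nil => rfl
    | cons r R ih =>
      obtain ⟨e, he, her⟩ := key r (by simp)
      rw [List.filterMap_cons_some he, List.map_cons, her, ih fun x hx => key x (by simp [hx])]

theorem proper_toNode (S : LinSystem) : Proper S.toNode := by
  refine ⟨?_, ?_, ?_⟩ <;> simp only [LinSystem.toNode, List.mem_map] <;> rintro _ ⟨e, -, rfl⟩
  · simp [LinEq.toRow]
  · obtain ⟨i, hi⟩ := e.vars_nonempty
    rw [List.any_eq_true]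
    exact ⟨true, by simp only [LinEq.toRow, List.mem_ofFn]; exact ⟨i, by simpa using hi⟩, rfl⟩
  · exact e.weight_pos

theorem dot_ofFn {n : ℕ} (f : Fin n → Bool) (z : ℕ → Bool) :
    (if dot (List.ofFn f) z = true then (1 : ZMod 2) else 0) =
      ∑ i, if f i = true ∧ z i = true then 1 else 0 := by
  induction n generalizing z with
  | zero => simp [dot]
  | succ n ih =>
    rw [List.ofFn_succ, dot, Fin.sum_univ_succ]
    have h1 := ih (fun i => f i.succ) fun i => z (i + 1)
    simp only [Fin.val_succ]
    rw [← h1]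
    generalize dot _ _ = b
    rw [show z ((0 : Fin (n + 1)) : ℕ) = z 0 from rfl]
    generalize z 0 = c
    generalize f 0 = a
    revert a b c
    decide

theorem holds_iff {n : ℕ} (e : LinEq n) (z : ℕ → Bool) :
    e.Holds (fun i => if z i = true then 1 else 0) ↔
      Bool.xor (dot e.toRow.1 z) e.toRow.2.1 = false := by
  have h1 := dot_ofFn (fun i => decide (i ∈ e.vars)) z
  have h2 : (∑ i ∈ e.vars, if z i = true then (1 : ZMod 2) else 0) =
      ∑ i, if decide (i ∈ e.vars) = true ∧ z i = true then 1 else 0 := by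
    rw [← Finset.sum_filter_add_sum_filter_not Finset.univ (fun i => i ∈ e.vars)]
    rw [Finset.filter_univ_mem, Finset.sum_congr rfl fun i hi => ?_, Finset.sum_eq_zero (s :=
      Finset.univ.filter fun i => i ∉ e.vars), add_zero]
    · intro i hi
      simp only [Finset.mem_filter] at hi
      simp [hi.2]
    · simp [hi]
  rw [LinEq.Holds, h2, ← h1, LinEq.toRow]
  simp only
  generalize dot _ _ = b
  generalize e.rhs = c
  revert b c
  decide

theorem excess_toNode (S : LinSystem) (z : ℕ → Bool) : excess S.toNode.2 z =
    2 * S.satWeight (fun i => if z i = true then 1 else 0) - S.totalWeight := by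
  obtain ⟨n, eqs⟩ := S
  simp only [LinSystem.satWeight, LinSystem.totalWeight, LinSystem.toNode]
  induction eqs with
  | nil => rfl
  | cons e eqs ih =>
    have h1 : excess ((e :: eqs).map LinEq.toRow) z =
        sgn (Bool.xor (dot e.toRow.1 z) e.toRow.2.1) * e.weight +
          excess (eqs.map LinEq.toRow) z := by
      simp only [excess, val, List.map_cons, List.sum_cons, sgn_xor, mul_assoc]
      rfl
    rw [h1, ih, List.filter_cons]
    have h2 := holds_iff e z
    by_cases h3 : e.Holds fun i => if z i = true then 1 else 0
    · rw [if_pos (by simpa using h3), h2.1 h3]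
      simp [sgn]; ring
    · rw [if_neg (by simpa using h3)]
      rw [h2, Bool.not_eq_false] at h3
      rw [h3]
      simp [sgn]; ring

/-- By `excess_toNode`, doubling `sat ≥ W / 2 + k` says that the maximal excess `2 * sat - W` is at
least `2 * k`. Finite assignments are extended by zero. -/
theorem mem_maxLin2AA_iff (q : LinSystem × ℕ) :
    q ∈ MaxLin2AA ↔ HasExcess (q.1.toNode, q.2) := by
  obtain ⟨S, k⟩ := q
  have h1 : (S, k) ∈ MaxLin2AA ↔ S.totalWeight + 2 * k ≤ 2 * S.sat := by
    simp only [MaxLin2AA, Set.mem_ofPred_eq]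
    rw [← @Nat.cast_le ℚ]
    push_cast
    constructor <;> intro h <;> linarith
  rw [h1]
  constructor
  · intro h
    obtain ⟨z, -, hz⟩ := Finset.exists_mem_eq_sup Finset.univ Finset.univ_nonempty S.satWeight
    rw [LinSystem.sat, hz] at h
    refine ⟨extend fun i => decide (z i = 1), ?_⟩
    rw [excess_toNode]
    have h2 : (fun i : Fin S.n => if extend (fun i => decide (z i = 1)) i = true then (1 : ZMod 2)
        else 0) = z := by
      funext i
      simp only [extend, i.2, dite_true, decide_eq_true_eq]
      generalize z i = a
      revert a
      decide
    rw [h2]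
    push_cast
    omega
  · rintro ⟨z, hz⟩
    rw [excess_toNode] at hz
    have h2 : S.satWeight (fun i => if z i = true then 1 else 0) ≤ S.sat :=
      Finset.le_sup (f := S.satWeight) (Finset.mem_univ _)
    push_cast at hz
    omega

/-- The kernelization of MaxLin2-AA. -/
def maxLin2Kernel (q : LinSystem × ℕ) : LinSystem × ℕ :=
  (Node.toLinSystem (kernelize (q.1.toNode, q.2)).1, (kernelize (q.1.toNode, q.2)).2)

theorem maxLin2Kernel_spec (q : LinSystem × ℕ) :
    IsKernelOf (q.1.toNode, q.2) ((maxLin2Kernel q).1.toNode, (maxLin2Kernel q).2) := by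
  have h := kernelize_spec (q := (q.1.toNode, q.2)) (proper_toNode q.1)
  rw [maxLin2Kernel, toNode_toLinSystem h.proper]
  exact h

/-- `kernelize` keeps systems proper, so its output has the same encoding as the system built from
it, and its program can be reused unchanged. -/
theorem pt_maxLin2Kernel : PT maxLin2Kernel := by
  have h1 : PT fun q : LinSystem × ℕ => (q.1.toNode, q.2) :=
    (PT.of_enc_eq enc_toNode).comp (PT.fst .id) |>.pair (PT.snd .id)
  refine (PT.kernelize.comp h1).recode fun q => ?_
  have h := kernelize_spec (q := (q.1.toNode, q.2)) (proper_toNode q.1)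
  change Data.cons (enc (maxLin2Kernel q).1) _ = Data.cons (enc (kernelize _).1) _
  rw [← enc_toNode, maxLin2Kernel, toNode_toLinSystem h.proper]

theorem mainTheorem2 :
    ∃ K : LinSystem × ℕ → LinSystem × ℕ,
      IsKernelization LinSystem.encode MaxLin2AA K ∧
      ∃ h : ℕ → ℕ,
        (fun k : ℕ => (h k : ℝ)) =O[Filter.atTop] (fun k : ℕ => (k : ℝ) ^ 2 * Real.log (k : ℝ)) ∧
        ∀ (S : LinSystem) (k : ℕ), (K (S, k)).1.n ≤ h k := by
  refine ⟨maxLin2Kernel, ⟨pt_maxLin2Kernel, fun q => ?_, ⟨fun k => k + 1, fun q => ?_⟩,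
    ⟨fun k => 2 * varBound k + 3 + 2 ^ varBound k * (4 * varBound k +
      4 * (2 ^ varBound k * (k + k)).size + 8), fun q => ?_⟩⟩, varBound, varBound_isBigO,
    fun S k => ?_⟩
  · rw [mem_maxLin2AA_iff, mem_maxLin2AA_iff]
    exact (maxLin2Kernel_spec q).iff
  · exact (maxLin2Kernel_spec q).param
  · have h := (maxLin2Kernel_spec q).sz_le
    rwa [sz, enc_toNode] at h
  · simpa [LinSystem.toNode] using (maxLin2Kernel_spec (S, k)).vars
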